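/- Theorem (First Order Comparison Principle). Let $N\ge 1$, $\ell\ge 2$ be integers, $\beta\in[0,1]$, $T>0$. \textbf{Curvatures.} Let $\mathfrak C$ (resp. $\mathfrak C^{1,1}$) be the class of subsets of $\mathbb R^N$ that are closures of open sets with compact boundary of class $C^{\ell,\beta}$ (resp. $C^{1,1}$). Let $\kappa(x,E)\in\mathbb R$ be given for all $E\in\mathfrak C$, $x\in\partial E$, such that: (A) if $E\subseteq F$ are in $\mathfrak C$ and $x\in\partial E\cap\partial F$, then $\kappa(x,F)\le\kappa(x,E)$; (B) $\kappa(x+y,E+y)=\kappa(x,E)$ for all $y\in\mathbb R^N$; (C) if $E_n,E\in\mathfrak C$, $\partial E_n\to\partial E$ in the $C^{\ell,\beta}$ sense (local description by finitely many graphs of functions that converge in $C^{\ell,\beta}$) and $\partial E_n\ni x_n\to x\in\partial E$, then $\kappa(x_n,E_n)\to\kappa(x,E)$. \textbf{Relaxed curvatures.} For $E\subseteq\mathbb R^N$, $x_0\in\partial E$, $p\in\mathbb R^N$ and a symmetric $N\times N$ matrix $X$, write $(p,X)\in\mathcal J^{2,+}_E(x_0)$ if for every $\delta>0$ one has $(x-x_0)\cdot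 p+\frac12(X+\delta I)(x-x_0)\cdot(x-x_0)\ge 0$ for all $x\in E$ in a neighbourhood of $x_0$, and $(p,X)\in\mathcal J^{2,-}_E(x_0)$ if $(-p,-X)\in\mathcal J^{2,+}_{\mathbb R^N\setminus E}(x_0)$. With values in $[-\infty,+\infty]$ let $$\kappa_*(x,p,X,F)=\sup\{\kappa(x,E): E\in\mathfrak C,\ F\subseteq E,\ (p,X)\in\mathcal J^{2,-}_E(x)\},$$ $$\kappa^*(x,p,X,F)=\inf\{\kappa(x,E): E\in\mathfrak C,\ \mathrm{int}\,E\subseteq F,\ (p,X)\in\mathcal J^{2,+}_E(x)\}.$$ \textbf{Condition (FO).} Assume that for all $\Sigma\in\mathfrak C^{1,1}$, $x\in\partial\Sigma$, $p\ne0$, $(p,X)\in\mathcal J^{2,+}_\Sigma(x)$ and $(p,Y)\in\mathcal J^{2,-}_\Sigma(x)$ one has $\kappa_*(x,p,X,\Sigma)=\kappa^*(x,p,Y,\Sigma)$. \textbf{Test functions.} Let $\overline c(\rho)=\max_{x\in\partial B_\rho}\max\{\kappa(x,\overline{B_\rho}),-\kappa(x,\mathbb R^N\setminus B_\rho)\}$,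 where $B_\rho$ is the open ball of radius $\rho$ about $0$. Let $\mathcal F$ be the set of $f\in C^\infty([0,\infty))$ with $f(0)=f'(0)=f''(0)=0$, $f''>0$ on some interval $(0,\varepsilon)$, $f$ constant on some $[M,\infty)$, and $f'(\rho)\,\overline c(\rho)\to0$ as $\rho\to0^+$. A function on $\mathbb R^N\times I$ is called constant outside a compact set if for some compact $K\subset\mathbb R^N$ it is, at each time of $I$, constant on $\mathbb R^N\setminus K$ (the constant may depend on time). Let $\hat z=(\hat x,\hat t)\in\mathbb R^N\times(0,T)$ and let $A\subseteq(0,T)$ be an open interval containing $\hat t$. A continuous $\varphi:\mathbb R^N\times\overline A\to\mathbb R$, constant outside a compact set and of class $C^2$ near $\hat z$, is admissible at $\hat z$ if either $D\varphi(\hat z)\neq0$, or $D\varphi(\hat z)=0$ and there are $f\in\mathcal F$ and $\omega\in C^\infty([0,\infty))$ with $\omega(0)=\omega'(0)=0$, $\omega>0$ on $(0,\infty)$, such that $|\varphi(x,t)-\varphi(\hat z)-\varphi_t(\hat z)(t-\hat t)|\le f(|x-\hat x|)+\omega(|t-\hat t|)$ on $\mathbb R^N\times A$. Here $D$, $D^2$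 are the spatial gradient and Hessian. \textbf{Sub- and supersolutions.} A subsolution of $\partial_tu+|Du|\,\kappa(x,\{y:u(y,t)\ge u(x,t)\})=0$ is an upper semicontinuous $u:\mathbb R^N\times[0,T]\to\mathbb R$, constant outside a compact set, such that whenever $\varphi$ is admissible at $z=(x,t)\in\mathbb R^N\times(0,T)$ and $u-\varphi$ has a maximum over $\mathbb R^N\times\overline A$ at $z$, then $\varphi_t(z)\le0$ if $D\varphi(z)=0$, and $$\varphi_t(z)+|D\varphi(z)|\,\kappa_*\bigl(x,D\varphi(z),D^2\varphi(z),\{y:\varphi(y,t)\ge\varphi(z)\}\bigr)\le0$$ if $D\varphi(z)\ne0$. A supersolution is a lower semicontinuous $v:\mathbb R^N\times[0,T]\to\mathbb R$, constant outside a compact set, such that whenever $\varphi$ is admissible at $z=(x,t)\in\mathbb R^N\times(0,T)$ and $v-\varphi$ has a minimum over $\mathbb R^N\times\overline A$ at $z$, then $\varphi_t(z)\ge0$ if $D\varphi(z)=0$, and $$\varphi_t(z)+|D\varphi(z)|\,\kappa^*\bigl(x,D\varphi(z),D^2\varphi(z),\{y:\varphi(y,t)>\varphi(z)\}\bigr)\ge0$$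 if $D\varphi(z)\ne0$. \textbf{Conclusion.} Let $u$ be a subsolution and $v$ a supersolution with $u(\cdot,0)\le v(\cdot,0)$. Then $u\le v$ in $\mathbb R^N\times[0,T)$. If moreover, for every $x\in\mathbb R^N$, $u(x,T)\le\limsup u(y,s)$ and $v(x,T)\ge\liminf v(y,s)$ as $(y,s)\to(x,T)$ with $s<T$, then $u\le v$ in $\mathbb R^N\times[0,T]$. -/

import Mathlib

open Set Filter Topology
open scoped NNReal RealInnerProductSpace ContDiff

noncomputable section

namespace NonlocalCurvature

/-- The Euclidean space `ℝ^N`. -/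
abbrev Space (N : ℕ) : Type := EuclideanSpace ℝ (Fin N)

variable {N : ℕ}

/-! ### Sets with boundary of class `C^{ℓ,β}` and their convergence -/

/-- `h` is of class `C^{ℓ,β}` on the open set `S`. For `β = 0` the second condition only says that
the oscillation of the `ℓ`-th derivative is bounded, so that locally `C^{ℓ,0}` is `C^ℓ`. -/
def IsCHolderOn (ℓ : ℕ) (β : ℝ≥0) (h : Space N → ℝ) (S : Set (Space N)) : Prop :=
  ContDiffOn ℝ ℓ h S ∧ ∃ C : ℝ≥0, HolderOnWith C β (iteratedFDeriv ℝ ℓ h) S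

/-- `hn → h` in the `C^{ℓ,β}` norm on the open set `S`: uniform convergence of the derivatives up
to order `ℓ`, and convergence to `0` of the `β`-Hölder seminorm of the difference of the `ℓ`-th
derivatives. -/
def TendstoCHolderOn (ℓ : ℕ) (β : ℝ≥0) (hn : ℕ → Space N → ℝ) (h : Space N → ℝ)
    (S : Set (Space N)) : Prop :=
  (∀ j ≤ ℓ, TendstoUniformlyOn (fun n => iteratedFDeriv ℝ j (hn n)) (iteratedFDeriv ℝ j h)
    atTop S) ∧
  ∃ ε : ℕ → ℝ≥0, Tendsto ε atTop (𝓝 0) ∧ ∀ᶠ n in atTop,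
    HolderOnWith (ε n) β (fun y => iteratedFDeriv ℝ ℓ (hn n) y - iteratedFDeriv ℝ ℓ h y) S

/-- The component of `y` orthogonal to the unit vector `ν`. -/
def horiz (ν y : Space N) : Space N := y - ⟪ν, y⟫ • ν

/-- The open cylinder with centre `c`, axis `ν`, radius `r` and half height `s`. -/
def cylinder (c ν : Space N) (r s : ℝ) : Set (Space N) :=
  {y | ‖horiz ν (y - c)‖ < r ∧ |⟪ν, y - c⟫| < s}

/-- `h` is a `C^{ℓ,β}` graph function over the base of the cylinder, with values in `(-s, s)`.
It is defined on a ball of `ℝ^N`, but is only ever evaluated on the hyperplane orthogonal to `ν`. -/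
def IsGraphFun (ℓ : ℕ) (β : ℝ≥0) (r s : ℝ) (h : Space N → ℝ) : Prop :=
  IsCHolderOn ℓ β h (Metric.ball 0 r) ∧ ∀ y ∈ Metric.ball (0 : Space N) r, |h y| < s

/-- `U` is an open set with boundary of class `C^{ℓ,β}`: in a cylinder around each boundary point
it is, in suitable orthonormal coordinates, the strict subgraph of a `C^{ℓ,β}` function. -/
def IsOpenOfClass (ℓ : ℕ) (β : ℝ≥0) (U : Set (Space N)) : Prop :=
  IsOpen U ∧ ∀ x ∈ frontier U, ∃ (c ν : Space N) (r s : ℝ) (h : Space N → ℝ),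
    ‖ν‖ = 1 ∧ x ∈ cylinder c ν r s ∧ IsGraphFun ℓ β r s h ∧
    ∀ y ∈ cylinder c ν r s, y ∈ U ↔ ⟪ν, y - c⟫ < h (horiz ν (y - c))

/-- The class of closures of open sets with compact boundary of class `C^{ℓ,β}`. -/
def RegularSets (N ℓ : ℕ) (β : ℝ≥0) : Set (Set (Space N)) :=
  {E | ∃ U : Set (Space N), IsOpenOfClass ℓ β U ∧ IsCompact (frontier U) ∧ E = closure U}

/-- The boundaries of the `En n` converge to that of `E` in the `C^{ℓ,β}` sense: finitely many
cylinders cover `∂E` and, for large `n`, `∂(En n)`, and in each of them the sets are the subgraphs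
of functions that converge in `C^{ℓ,β}`. -/
def TendstoRegular (ℓ : ℕ) (β : ℝ≥0) (En : ℕ → Set (Space N)) (E : Set (Space N)) : Prop :=
  ∃ (m : ℕ) (c ν : Fin m → Space N) (r s : Fin m → ℝ) (h : Fin m → Space N → ℝ)
    (hn : ℕ → Fin m → Space N → ℝ),
    (∀ i, ‖ν i‖ = 1) ∧
    frontier E ⊆ ⋃ i, cylinder (c i) (ν i) (r i) (s i) ∧
    (∀ i, IsGraphFun ℓ β (r i) (s i) (h i) ∧
      ∀ y ∈ cylinder (c i) (ν i) (r i) (s i),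
        y ∈ E ↔ ⟪ν i, y - c i⟫ ≤ h i (horiz (ν i) (y - c i))) ∧
    (∀ᶠ n in atTop, frontier (En n) ⊆ ⋃ i, cylinder (c i) (ν i) (r i) (s i) ∧
      ∀ i, IsGraphFun ℓ β (r i) (s i) (hn n i) ∧
        ∀ y ∈ cylinder (c i) (ν i) (r i) (s i),
          y ∈ En n ↔ ⟪ν i, y - c i⟫ ≤ hn n i (horiz (ν i) (y - c i))) ∧
    ∀ i, TendstoCHolderOn ℓ β (fun n => hn n i) (h i) (Metric.ball 0 (r i))

/-! ### Nonlocal curvatures -/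

/-- A nonlocal curvature: a real number `κ x E` for every regular set `E` and `x ∈ ∂E` (other
values of the total function `κ` are never used), subject to monotonicity, translation invariance
and continuity. -/
structure IsCurvature (ℓ : ℕ) (β : ℝ≥0) (κ : Space N → Set (Space N) → ℝ) : Prop where
  mono : ∀ E ∈ RegularSets N ℓ β, ∀ F ∈ RegularSets N ℓ β, E ⊆ F →
    ∀ x ∈ frontier F ∩ frontier E, κ x F ≤ κ x E
  translation : ∀ E ∈ RegularSets N ℓ β, ∀ x ∈ frontier E, ∀ y : Space N,
    κ x E = κ (x + y) ((fun z => z + y) '' E)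
  continuity : ∀ (En : ℕ → Set (Space N)) (E : Set (Space N)) (xn : ℕ → Space N) (x : Space N),
    (∀ n, En n ∈ RegularSets N ℓ β) → E ∈ RegularSets N ℓ β → TendstoRegular ℓ β En E →
    (∀ n, xn n ∈ frontier (En n)) → x ∈ frontier E → Tendsto xn atTop (𝓝 x) →
    Tendsto (fun n => κ (xn n) (En n)) atTop (𝓝 (κ x E))

/-- `c̄(ρ)`, the maximum over `x ∈ ∂B_ρ` of `max {κ(x, B_ρ), -κ(x, ℝ^N ∖ B_ρ)}`. -/
def upperBallCurvature (κ : Space N → Set (Space N) → ℝ) (ρ : ℝ) : ℝ :=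
  sSup ((fun x => max (κ x (Metric.closedBall 0 ρ)) (-κ x (Metric.ball 0 ρ)ᶜ)) ''
    Metric.sphere (0 : Space N) ρ)

/-! ### Second order jets of sets and the relaxed curvatures -/

/-- `(p, X)` is in the superjet of `E` at `x₀ ∈ ∂E`; symmetric matrices are represented by
symmetric operators. -/
def IsSuperjet (E : Set (Space N)) (x₀ p : Space N) (X : Space N →L[ℝ] Space N) : Prop :=
  x₀ ∈ frontier E ∧ (X : Space N →ₗ[ℝ] Space N).IsSymmetric ∧
  ∀ δ : ℝ, 0 < δ → ∀ᶠ x in 𝓝 x₀, x ∈ E →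
    0 ≤ ⟪x - x₀, p⟫ + 1 / 2 * (⟪X (x - x₀), x - x₀⟫ + δ * ‖x - x₀‖ ^ 2)

/-- `(p, X)` is in the subjet of `E` at `x₀`. -/
def IsSubjet (E : Set (Space N)) (x₀ p : Space N) (X : Space N →L[ℝ] Space N) : Prop :=
  IsSuperjet Eᶜ x₀ (-p) (-X)

/-- The lower relaxed curvature `κ_*(x, p, X, F)`. -/
def lowerCurvature (ℓ : ℕ) (β : ℝ≥0) (κ : Space N → Set (Space N) → ℝ)
    (x p : Space N) (X : Space N →L[ℝ] Space N) (F : Set (Space N)) : EReal :=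
  sSup {k | ∃ E ∈ RegularSets N ℓ β, F ⊆ E ∧ IsSubjet E x p X ∧ k = (κ x E : EReal)}

/-- The upper relaxed curvature `κ^*(x, p, X, F)`. -/
def upperCurvature (ℓ : ℕ) (β : ℝ≥0) (κ : Space N → Set (Space N) → ℝ)
    (x p : Space N) (X : Space N →L[ℝ] Space N) (F : Set (Space N)) : EReal :=
  sInf {k | ∃ E ∈ RegularSets N ℓ β, interior E ⊆ F ∧ IsSuperjet E x p X ∧ k = (κ x E : EReal)}

/-- The first order condition: on `C^{1,1}` sets the two relaxed curvatures coincide and do not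
depend on the second order variable. -/
def FirstOrderCondition (ℓ : ℕ) (β : ℝ≥0) (κ : Space N → Set (Space N) → ℝ) : Prop :=
  ∀ S ∈ RegularSets N 1 1, ∀ x ∈ frontier S, ∀ p : Space N, p ≠ 0 →
    ∀ X Y : Space N →L[ℝ] Space N, IsSuperjet S x p X → IsSubjet S x p Y →
      lowerCurvature ℓ β κ x p X S = upperCurvature ℓ β κ x p Y S

/-! ### Viscosity sub- and supersolutions of the level set equation -/

/-- The family of functions `f ∈ C^∞([0, ∞))` used at critical points of test functions. -/
def IsFlatProfile (κ : Space N → Set (Space N) → ℝ) (f : ℝ → ℝ) : Prop :=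
  ContDiffOn ℝ ∞ f (Ici 0) ∧ f 0 = 0 ∧ derivWithin f (Ici 0) 0 = 0 ∧
  iteratedDerivWithin 2 f (Ici 0) 0 = 0 ∧
  (∃ ε > 0, ∀ r ∈ Ioo 0 ε, 0 < iteratedDerivWithin 2 f (Ici 0) r) ∧
  (∃ M > 0, ∀ r ≥ M, f r = f M) ∧
  Tendsto (fun ρ => derivWithin f (Ici 0) ρ * upperBallCurvature κ ρ) (𝓝[>] 0) (𝓝 0)

/-- The family of functions `η ∈ C^∞([0, ∞))` with `η(0) = η'(0) = 0` and `η > 0` on `(0, ∞)`. -/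
def IsTimeModulus (η : ℝ → ℝ) : Prop :=
  ContDiffOn ℝ ∞ η (Ici 0) ∧ η 0 = 0 ∧ derivWithin η (Ici 0) 0 = 0 ∧ ∀ r > 0, 0 < η r

/-- `g` is constant outside a compact set of `ℝ^N`, at each time of `A`, with a constant that may
depend on time. -/
def ConstOutsideCompact (g : Space N × ℝ → ℝ) (A : Set ℝ) : Prop :=
  ∃ K : Set (Space N), IsCompact K ∧ ∀ t ∈ A, ∃ c : ℝ, ∀ x ∉ K, g (x, t) = c

/-- The spatial gradient `Dφ(z)`. -/
def spaceGrad (φ : Space N × ℝ → ℝ) (z : Space N × ℝ) : Space N :=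
  gradient (fun y => φ (y, z.2)) z.1

/-- The spatial Hessian `D²φ(z)`. -/
def spaceHess (φ : Space N × ℝ → ℝ) (z : Space N × ℝ) : Space N →L[ℝ] Space N :=
  fderiv ℝ (fun y => gradient (fun y' => φ (y', z.2)) y) z.1

/-- The time derivative `φ_t(z)`. -/
def timeDeriv (φ : Space N × ℝ → ℝ) (z : Space N × ℝ) : ℝ :=
  deriv (fun s => φ (z.1, s)) z.2

/-- The test function `φ`, defined on `ℝ^N × [a, b]`, is admissible at the point `z` of
`ℝ^N × (a, b)`, where `(a, b) ⊆ (0, T)`. -/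
def IsAdmissible (κ : Space N → Set (Space N) → ℝ) (T a b : ℝ) (φ : Space N × ℝ → ℝ)
    (z : Space N × ℝ) : Prop :=
  0 ≤ a ∧ b ≤ T ∧ z.2 ∈ Ioo a b ∧
  ContinuousOn φ (univ ×ˢ Icc a b) ∧ ContDiffAt ℝ 2 φ z ∧ ConstOutsideCompact φ (Icc a b) ∧
  (spaceGrad φ z = 0 → ∃ f η : ℝ → ℝ, IsFlatProfile κ f ∧ IsTimeModulus η ∧
    ∀ x : Space N, ∀ t ∈ Ioo a b,
      |φ (x, t) - φ z - timeDeriv φ z * (t - z.2)| ≤ f ‖x - z.1‖ + η |t - z.2|)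

/-- `u` is a viscosity subsolution of `∂ₜu + |Du| κ(x, {u ≥ u(x,t)}) = 0` in `ℝ^N × (0, T)`; no
inequality is required at the initial time. -/
def IsSubsolution (ℓ : ℕ) (β : ℝ≥0) (κ : Space N → Set (Space N) → ℝ) (T : ℝ)
    (u : Space N × ℝ → ℝ) : Prop :=
  UpperSemicontinuousOn u (univ ×ˢ Icc 0 T) ∧ ConstOutsideCompact u (Icc 0 T) ∧
  ∀ (a b : ℝ) (φ : Space N × ℝ → ℝ) (z : Space N × ℝ), IsAdmissible κ T a b φ z →
    IsMaxOn (fun w => u w - φ w) (univ ×ˢ Icc a b) z →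
    (spaceGrad φ z = 0 → timeDeriv φ z ≤ 0) ∧
    (spaceGrad φ z ≠ 0 →
      (timeDeriv φ z : EReal) + (‖spaceGrad φ z‖ : EReal) *
        lowerCurvature ℓ β κ z.1 (spaceGrad φ z) (spaceHess φ z) {y | φ z ≤ φ (y, z.2)} ≤ 0)

/-- `v` is a viscosity supersolution of `∂ₜv + |Dv| κ(x, {v ≥ v(x,t)}) = 0` in `ℝ^N × (0, T)`; no
inequality is required at the initial time. -/
def IsSupersolution (ℓ : ℕ) (β : ℝ≥0) (κ : Space N → Set (Space N) → ℝ) (T : ℝ)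
    (v : Space N × ℝ → ℝ) : Prop :=
  LowerSemicontinuousOn v (univ ×ˢ Icc 0 T) ∧ ConstOutsideCompact v (Icc 0 T) ∧
  ∀ (a b : ℝ) (φ : Space N × ℝ → ℝ) (z : Space N × ℝ), IsAdmissible κ T a b φ z →
    IsMinOn (fun w => v w - φ w) (univ ×ˢ Icc a b) z →
    (spaceGrad φ z = 0 → 0 ≤ timeDeriv φ z) ∧
    (spaceGrad φ z ≠ 0 →
      0 ≤ (timeDeriv φ z : EReal) + (‖spaceGrad φ z‖ : EReal) *
        upperCurvature ℓ β κ z.1 (spaceGrad φ z) (spaceHess φ z) {y | φ z < φ (y, z.2)})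

/-- `u(x, T) ≤ limsup u(y, s)` as `(y, s) → (x, T)` with `s < T`, for every `x`. -/
def TerminalFromBelow (T : ℝ) (u : Space N × ℝ → ℝ) : Prop :=
  ∀ x : Space N, ∀ ε > 0, ∃ᶠ w in 𝓝[{w : Space N × ℝ | w.2 < T}] (x, T), u (x, T) - ε < u w

/-- `v(x, T) ≥ liminf v(y, s)` as `(y, s) → (x, T)` with `s < T`, for every `x`. -/
def TerminalFromAbove (T : ℝ) (v : Space N × ℝ → ℝ) : Prop :=
  ∀ x : Space N, ∀ ε > 0, ∃ᶠ w in 𝓝[{w : Space N × ℝ | w.2 < T}] (x, T), v w < v (x, T) + ε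

end NonlocalCurvature

end

/-! Suppose `u` exceeds `v` by `δ` at arbitrarily close pairs of points. Subtract a barrier `h(t) =
γ / (T - t)` from `u` and from `-v`, replace both by supremal convolutions `U`, `W` with a bounded
flat penalty `F` in space and `n t²` in time, and maximise `U(x,t) + W(y,t) - n‖x - y‖²`. Time is
not doubled. Upper bounds on `u` and `-v` force the points `(x',t')`, `(y',s')` where the
convolutions are attained to lie close to `(x,t)`, `(y,t)`; the initial ordering excludes small
times and the barrier excludes the final one, so the viscosity inequalities hold there
(`false_of_gap`).

Off the diagonal put `p = 2n(x - y) ≠ 0`. Shifts of `U` and `-W` serve as test functions, and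
maximality says that `ξ ↦ U(x+ξ,t) - U(x,t)` lies below `ξ ↦ W(y,t) - W(y+ξ,t)`. The first function
is semiconvex and the second semiconcave, so a `C^{1,1}` function fits between them
(`exists_interposition`, a supremal followed by an infimal convolution). Made regular at level zero,
it has a superlevel set `S` of class `C^{1,1}` between the two superlevel sets. Condition (FO)
equates `κ_*` and `κ^*` at `S` with no relation between the second order arguments. Each competitor
in `κ_*` of `S` contains the superlevel set of the test function for `u`, so the subsolution
property bounds `κ_*` from above; symmetrically the supersolution property bounds `κ^*` from below.
Hence the time slopes are ordered (`slope_le_of_firstOrder`), with no theorem on sums and no matrix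
inequality, against the strict growth of `h`.

Regularity of the level set is the delicate point (`exists_regular_interposition`). Wherever the two
functions touch, the doubled functional is again maximal, so the slope there is `p` and nothing has
to be changed. Away from the contact set there is room for an affine perturbation, supplied by a
Sard argument applied to the Lipschitz slope map.

On the diagonal the spatial slope vanishes, which forces `x' = x` and `y' = y`; then `F` plus a
quadratic in time is an admissible test function, and the two inequalities for the time derivative
contradict `h' > 0`. Admissibility needs a profile flat enough to beat the growth of `c̄` at zero.
Since `c̄` is finite and nonincreasing, such a profile can be built (`exists_flatProfile`). -/

namespace NonlocalCurvature

/-! ### Quadratic expansions, a pointwise form of `C^{1,1}` regularity -/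

section QuadExpansion

variable {N : ℕ}

/-- `w` has at every point a first order expansion with slope `q` and remainder at most
`C ‖k‖²`. -/
def HasQuadExpansion (C : ℝ) (w : Space N → ℝ) (q : Space N → Space N) : Prop :=
  ∀ x k, |w (x + k) - w x - ⟪q x, k⟫| ≤ C * ‖k‖ ^ 2

/-- At every point `w` is touched from below by a concave paraboloid of opening `C`. -/
def LowerSupported (C : ℝ) (w : Space N → ℝ) : Prop :=
  ∀ x, ∃ q, ∀ k, w x + ⟪q, k⟫ - C * ‖k‖ ^ 2 ≤ w (x + k)

/-- At every point `w` is touched from above by a convex paraboloid of opening `C`. -/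
def UpperSupported (C : ℝ) (w : Space N → ℝ) : Prop :=
  ∀ x, ∃ q, ∀ k, w (x + k) ≤ w x + ⟪q, k⟫ + C * ‖k‖ ^ 2

/-- A linear form bounded by a quadratic near the origin vanishes. -/
lemma eq_zero_of_inner_le_sq {q : Space N} {C r : ℝ} (hr : 0 < r)
    (h : ∀ k, ‖k‖ < r → ⟪q, k⟫ ≤ C * ‖k‖ ^ 2) : q = 0 := by
  by_contra hq
  have hq' : 0 < ‖q‖ := norm_pos_iff.2 hq
  -- The bound is tested on `k = ε • q`: the left side is linear in `ε` and the right side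
  -- quadratic, so a small `ε` is contradictory.
  obtain ⟨ε, hε, hε1, hε2⟩ : ∃ ε : ℝ, 0 < ε ∧ ε * ‖q‖ < r ∧ |C| * ε < 1 := by
    refine ⟨min (r / (2 * ‖q‖)) (1 / (2 * (|C| + 1))), by positivity, ?_, ?_⟩
    · calc _ ≤ r / (2 * ‖q‖) * ‖q‖ := by gcongr; exact min_le_left _ _
        _ = r / 2 := by field_simp
        _ < r := by linarith
    · calc _ ≤ |C| * (1 / (2 * (|C| + 1))) := by gcongr; exact min_le_right _ _
        _ < 1 := by
          rw [mul_one_div, div_lt_one (by positivity)]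
          linarith [abs_nonneg C]
  have := h (ε • q) (by rwa [norm_smul, Real.norm_of_nonneg hε.le])
  rw [inner_smul_right, real_inner_self_eq_norm_sq, norm_smul, Real.norm_of_nonneg hε.le] at this
  have h1 : C * (ε * ‖q‖) ^ 2 ≤ (|C| * ε) * (ε * ‖q‖ ^ 2) := by
    have : C * (ε * ‖q‖) ^ 2 ≤ |C| * (ε * ‖q‖) ^ 2 := by gcongr; exact le_abs_self C
    linarith
  have h2 : (|C| * ε) * (ε * ‖q‖ ^ 2) < 1 * (ε * ‖q‖ ^ 2) := by gcongr
  linarith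

/-- Two slopes whose difference is squeezed by a quadratic near the origin coincide. -/
lemma slope_unique {p q : Space N} {C D r : ℝ} (hr : 0 < r)
    (h : ∀ k, ‖k‖ < r → ⟪p, k⟫ - C * ‖k‖ ^ 2 ≤ ⟪q, k⟫ + D * ‖k‖ ^ 2) : p = q := by
  rw [← sub_eq_zero]
  refine eq_zero_of_inner_le_sq (C := C + D) hr fun k hk => ?_
  rw [inner_sub_left]
  linarith [h k hk]

lemma scalar_slope_unique {a b C D r : ℝ} (hr : 0 < r)
    (h : ∀ k, |k| < r → a * k - C * k ^ 2 ≤ b * k + D * k ^ 2) : a = b := by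
  have key : (EuclideanSpace.single 0 a : Space 1) = EuclideanSpace.single 0 b := by
    refine slope_unique (C := C) (D := D) hr fun k hk => ?_
    have hk' : ‖k‖ = |k 0| := by simp [EuclideanSpace.norm_eq, Real.sqrt_sq_eq_abs]
    have := h (k 0) (by rwa [← hk'])
    simpa [hk', PiLp.inner_apply, mul_comm] using this
  simpa using congrArg (fun z : Space 1 => z 0) key

namespace HasQuadExpansion

variable {C D : ℝ} {w w' : Space N → ℝ} {q q' : Space N → Space N}

lemma add (h : HasQuadExpansion C w q) (h' : HasQuadExpansion D w' q') :
    HasQuadExpansion (C + D) (fun x => w x + w' x) (fun x => q x + q' x) := fun x k => by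
  have := abs_add_le (w (x + k) - w x - ⟪q x, k⟫) (w' (x + k) - w' x - ⟪q' x, k⟫)
  rw [inner_add_left]
  calc _ = |w (x + k) - w x - ⟪q x, k⟫ + (w' (x + k) - w' x - ⟪q' x, k⟫)| := by ring_nf
    _ ≤ _ := this
    _ ≤ _ := by linarith [h x k, h' x k]

lemma mono (h : HasQuadExpansion C w q) (hCD : C ≤ D) : HasQuadExpansion D w q := fun x k =>
  (h x k).trans (by gcongr)

lemma hasFDerivAt (h : HasQuadExpansion C w q) (x : Space N) :
    HasFDerivAt w (innerSL ℝ (q x)) x := by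
  rw [hasFDerivAt_iff_isLittleO_nhds_zero]
  refine Asymptotics.IsBigO.trans_isLittleO (g := fun k : Space N => ‖k‖ ^ 2) ?_ ?_
  · refine Asymptotics.IsBigO.of_bound C (Eventually.of_forall fun k => ?_)
    simpa [Real.norm_eq_abs] using h x k
  · simpa using (Asymptotics.isLittleO_norm_pow_id (E' := Space N) one_lt_two)

lemma continuous (h : HasQuadExpansion C w q) : Continuous w :=
  continuous_iff_continuousAt.2 fun x => (h.hasFDerivAt x).continuousAt

/-- Expand along the triangle `x`, `x + k`, `x + k + e`, with `e` of length `‖k‖` in the direction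
of the slope difference. The function values cancel, leaving `‖k‖` times that difference bounded by
`C (1 + 1 + 4) ‖k‖²`. -/
lemma norm_slope_sub_le (h : HasQuadExpansion C w q) (x k : Space N) :
    ‖q (x + k) - q x‖ ≤ 6 * C * ‖k‖ := by
  rcases eq_or_ne (q (x + k) - q x) 0 with h0 | h0
  · rw [h0, norm_zero]
    have : 0 ≤ C * ‖k‖ ^ 2 := (abs_nonneg _).trans (h x k)
    rcases (norm_nonneg k).eq_or_lt with hk | hk
    · simp [← hk]
    · have : 0 ≤ C := nonneg_of_mul_nonneg_left this (by positivity)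
      positivity
  rcases eq_or_ne k 0 with rfl | hk
  · simp at h0
  have hk' : 0 < ‖k‖ := norm_pos_iff.2 hk
  have hd : 0 < ‖q (x + k) - q x‖ := norm_pos_iff.2 h0
  set d := q (x + k) - q x with hdef
  set e : Space N := (‖k‖ / ‖d‖) • d with he
  have hen : ‖e‖ = ‖k‖ := by
    rw [he, norm_smul, Real.norm_of_nonneg (by positivity)]
    field_simp
  have h1 := abs_le.1 (h x k)
  have h2 := abs_le.1 (h (x + k) e)
  have h3 := abs_le.1 (h x (k + e))
  have hC : 0 ≤ C := nonneg_of_mul_nonneg_left ((abs_nonneg _).trans (h x k)) (by positivity)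
  have h4 : C * ‖k + e‖ ^ 2 ≤ C * (4 * ‖k‖ ^ 2) := by
    gcongr
    have : ‖k + e‖ ≤ 2 * ‖k‖ := (norm_add_le _ _).trans (by rw [hen]; linarith)
    calc _ ≤ (2 * ‖k‖) ^ 2 := by gcongr
      _ = _ := by ring
  rw [← add_assoc, inner_add_right] at h3
  rw [hen] at h2
  have h5 : ⟪d, e⟫ = ‖k‖ * ‖d‖ := by
    rw [he, inner_smul_right, real_inner_self_eq_norm_sq]
    field_simp
  have h6 : ⟪d, e⟫ = ⟪q (x + k), e⟫ - ⟪q x, e⟫ := inner_sub_left _ _ _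
  have h7 : ‖k‖ * ‖d‖ ≤ ‖k‖ * (6 * C * ‖k‖) := by nlinarith
  exact le_of_mul_le_mul_left h7 hk'

lemma nonneg_of_ne (h : HasQuadExpansion C w q) {k : Space N} (hk : k ≠ 0) : 0 ≤ C :=
  nonneg_of_mul_nonneg_left ((abs_nonneg _).trans (h 0 k)) (by positivity)

lemma lipschitz_slope (h : HasQuadExpansion C w q) : LipschitzWith (6 * C).toNNReal q :=
  LipschitzWith.of_dist_le_mul fun x y => by
    rw [dist_eq_norm, dist_eq_norm]
    have := h.norm_slope_sub_le y (x - y)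
    rw [add_sub_cancel] at this
    exact this.trans (by gcongr; exact Real.le_coe_toNNReal _)

end HasQuadExpansion

/-- A smooth function with globally Lipschitz derivative has quadratic expansions. -/
lemma hasQuadExpansion_of_lipschitz_gradient {w : Space N → ℝ} {q : Space N → Space N} {C : ℝ≥0}
    (hw : ∀ x, HasFDerivAt w (innerSL ℝ (q x)) x) (hq : LipschitzWith C q) :
    HasQuadExpansion C w q := fun x k => by
  have := (convex_closedBall x ‖k‖).norm_image_sub_le_of_norm_hasFDerivWithin_le' (f := w)
    (f' := fun y => innerSL ℝ (q y)) (φ := innerSL ℝ (q x)) (C := C * ‖k‖) (x := x) (y := x + k)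
    (fun y _ => (hw y).hasFDerivWithinAt) (fun y hy => ?_) (by simp) (by simp)
  · simpa [Real.norm_eq_abs, pow_two, mul_assoc] using this
  · rw [← map_sub, innerSL_apply_norm, ← dist_eq_norm]
    exact (hq.dist_le_mul y x).trans (by gcongr; exact hy)

/-- A `C²` function that is constant outside a compact set has quadratic expansions. -/
lemma exists_hasQuadExpansion {w : Space N → ℝ} (hw : ContDiff ℝ 2 w) {R c : ℝ}
    (hc : ∀ x, R < ‖x‖ → w x = c) : ∃ C : ℝ≥0, HasQuadExpansion C w (gradient w) := by
  have hd : ContDiff ℝ 1 (fderiv ℝ w) := hw.fderiv_right (by norm_num)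
  have hsupp : HasCompactSupport (fderiv ℝ w) := by
    refine HasCompactSupport.intro (isCompact_closedBall (0 : Space N) R) fun x hx => ?_
    have : w =ᶠ[𝓝 x] fun _ => c := by
      have : {y : Space N | R < ‖y‖} ∈ 𝓝 x :=
        (isOpen_lt continuous_const continuous_norm).mem_nhds (by simpa using hx)
      filter_upwards [this] with y hy using hc y hy
    rw [this.fderiv_eq]
    simp
  obtain ⟨C, hC⟩ := ContDiff.lipschitzWith_of_hasCompactSupport hsupp hd (by norm_num)
  refine ⟨C, hasQuadExpansion_of_lipschitz_gradient (fun x => ?_) ?_⟩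
  · exact ((hw.differentiable (by norm_num)) x).hasGradientAt.hasFDerivAt
  · have : LipschitzWith 1 (InnerProductSpace.toDual ℝ (Space N)).symm :=
      (InnerProductSpace.toDual ℝ (Space N)).symm.isometry.lipschitz
    have h := this.comp hC
    rw [one_mul] at h
    exact h

/-- If `w` has quadratic expansions and lies above a function which has a lower paraboloid of
slope `p` touching `w` at `x`, then the slope of `w` at `x` is `p`. -/
lemma HasQuadExpansion.slope_eq {C D : ℝ} {w : Space N → ℝ} {q : Space N → Space N}
    (h : HasQuadExpansion C w q) {x p : Space N}
    (hp : ∀ k, w x + ⟪p, k⟫ - D * ‖k‖ ^ 2 ≤ w (x + k)) : q x = p :=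
  (slope_unique one_pos (C := D) (D := C) fun k _ => by
    linarith [hp k, (abs_le.1 (h x k)).2]).symm

end QuadExpansion

/-! ### A `C^{1,1}` function between a semiconvex and a semiconcave one -/

section Interposition

variable {N : ℕ}

/-- A function bounded above and continuous, penalized by a quadratic, attains its maximum. -/
lemma exists_max_sub_sq {g : Space N → ℝ} (hg : Continuous g) {B : ℝ} (hB : ∀ x, g x ≤ B)
    {A : ℝ} (hA : 0 < A) (x : Space N) :
    ∃ y, ∀ z, g z - A * ‖z - x‖ ^ 2 ≤ g y - A * ‖y - x‖ ^ 2 := by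
  have hcont : Continuous fun z => g z - A * ‖z - x‖ ^ 2 := by fun_prop
  refine hcont.exists_forall_ge' (x₀ := x) ?_
  have ht : Tendsto (fun z : Space N => A * ‖z - x‖ ^ 2) (cocompact _) atTop := by
    refine Tendsto.const_mul_atTop hA ((tendsto_pow_atTop two_ne_zero).comp ?_)
    have := (tendsto_norm_cocompact_atTop (E := Space N)).comp
      ((Homeomorph.subRight x).isClosedEmbedding.tendsto_cocompact)
    exact this
  filter_upwards [ht.eventually_ge_atTop (B - g x)] with z hz
  have := hB z
  simp only [sub_self, norm_zero]
  linarith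

/-- The strong convexity estimate at a minimum point of a lower supported function. -/
lemma LowerSupported.strong_min {C A : ℝ} {g : Space N → ℝ} (hg : LowerSupported C g)
    {x y : Space N} (hy : ∀ z, g y + A * ‖y - x‖ ^ 2 ≤ g z + A * ‖z - x‖ ^ 2) (z : Space N) :
    g y + A * ‖y - x‖ ^ 2 + (A - C) * ‖z - y‖ ^ 2 ≤ g z + A * ‖z - x‖ ^ 2 := by
  -- first the inequality with a factor `1 - s`
  have key : ∀ s : ℝ, 0 < s → s < 1 →
      (1 - s) * ((A - C) * ‖z - y‖ ^ 2) ≤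
        g z + A * ‖z - x‖ ^ 2 - (g y + A * ‖y - x‖ ^ 2) := by
    intro s hs hs1
    set m := y + s • (z - y) with hm
    -- The supporting paraboloid at the intermediate point `m` is read at both ends of the segment.
    -- Weighting the two inequalities by `1 - s` and `s` eliminates the unknown slope; comparing `m`
    -- with the minimum and dividing by `s` leaves the claim.
    obtain ⟨q, hq⟩ := hg m
    have h1 := hq (-(s • (z - y)))
    have h2 := hq ((1 - s) • (z - y))
    have e1 : m + -(s • (z - y)) = y := by rw [hm]; abel
    have e2 : m + (1 - s) • (z - y) = z := by
      rw [hm, sub_smul, one_smul]; abel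
    rw [e1] at h1
    rw [e2] at h2
    have h3 := hy m
    have n1 : ‖-(s • (z - y))‖ ^ 2 = s ^ 2 * ‖z - y‖ ^ 2 := by
      rw [norm_neg, norm_smul, mul_pow, Real.norm_eq_abs, sq_abs]
    have n2 : ‖(1 - s) • (z - y)‖ ^ 2 = (1 - s) ^ 2 * ‖z - y‖ ^ 2 := by
      rw [norm_smul, mul_pow, Real.norm_eq_abs, sq_abs]
    rw [n1, inner_neg_right, inner_smul_right] at h1
    rw [n2, inner_smul_right] at h2
    have n3 : ‖m - x‖ ^ 2 = ‖y - x‖ ^ 2 + 2 * s * ⟪y - x, z - y⟫ + s ^ 2 * ‖z - y‖ ^ 2 := by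
      have : m - x = (y - x) + s • (z - y) := by rw [hm]; abel
      rw [this, norm_add_sq_real, inner_smul_right, norm_smul, mul_pow, Real.norm_eq_abs, sq_abs]
      ring
    have n4 : ‖z - x‖ ^ 2 = ‖y - x‖ ^ 2 + 2 * ⟪y - x, z - y⟫ + ‖z - y‖ ^ 2 := by
      have : z - x = (y - x) + (z - y) := by abel
      rw [this, norm_add_sq_real]
    rw [n3] at h3
    rw [n4]
    set P := ‖z - y‖ ^ 2
    set I := ⟪y - x, z - y⟫
    set J := ⟪q, z - y⟫
    have h5 : s * ((1 - s) * ((A - C) * P)) ≤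
        s * (g z + A * (‖y - x‖ ^ 2 + 2 * I + P) - (g y + A * ‖y - x‖ ^ 2)) := by
      nlinarith
    exact le_of_mul_le_mul_left h5 hs
  have ht : Tendsto (fun s : ℝ => (1 - s) * ((A - C) * ‖z - y‖ ^ 2)) (𝓝[>] 0)
      (𝓝 ((1 - 0) * ((A - C) * ‖z - y‖ ^ 2))) := by
    refine Tendsto.mono_left ?_ nhdsWithin_le_nhds
    exact Continuous.tendsto (by fun_prop) 0
  have := le_of_tendsto ht (by
    filter_upwards [Ioo_mem_nhdsGT (zero_lt_one' ℝ)] with s hs using key s hs.1 hs.2)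
  linarith

/-- **Interposition of a `C^{1,1}` function** between a semiconvex function and a larger
semiconcave one; the interposed function inherits the behaviour at infinity of the smaller one. -/
lemma exists_interposition {C : ℝ} (hC : 0 < C) {U V : Space N → ℝ} {L : ℝ≥0}
    (hUL : LipschitzWith L U) {R c : ℝ} (hUc : ∀ x, R < ‖x‖ → U x = c)
    (hU : LowerSupported C U) (hV : UpperSupported C V) (hUV : ∀ x, U x ≤ V x) :
    ∃ (w : Space N → ℝ) (q : Space N → Space N), HasQuadExpansion (2 * C) w q ∧
      (∀ x, U x ≤ w x) ∧ (∀ x, w x ≤ V x) ∧ ∃ R', ∀ x, R' < ‖x‖ → w x = c := by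
  have hA : 0 < 2 * C := by positivity
  obtain ⟨B, hB0, hB⟩ : ∃ B, 0 ≤ B ∧ ∀ x, |U x| ≤ B := by
    obtain ⟨B, hB⟩ := (isCompact_closedBall (0 : Space N) R).exists_bound_of_continuousOn
      hUL.continuous.continuousOn
    refine ⟨max (max B |c|) 0, le_max_right _ _, fun x => ?_⟩
    rcases lt_or_ge R ‖x‖ with h | h
    · rw [hUc x h]; exact (le_max_right _ _).trans (le_max_left _ _)
    · exact (hB x (by simpa using h)).trans ((le_max_left _ _).trans (le_max_left _ _))
  choose Z hZ using exists_max_sub_sq hUL.continuous (fun x => (abs_le.1 (hB x)).2) hA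
  -- Supremal convolution of `U`. Shifting its maximiser shows that `g` inherits both the lower
  -- paraboloids and the Lipschitz constant of `U`.
  set g : Space N → ℝ := fun y => U (Z y) - 2 * C * ‖Z y - y‖ ^ 2 with hg
  have g_ge : ∀ y z, U z - 2 * C * ‖z - y‖ ^ 2 ≤ g y := hZ
  have g_shift : ∀ y k, U (Z y + k) - U (Z y) + g y ≤ g (y + k) := fun y k => by
    have := g_ge (y + k) (Z y + k)
    rw [add_sub_add_right_eq_sub] at this
    simp only [hg] at this ⊢
    linarith
  have g_supp : LowerSupported C g := fun y => by
    obtain ⟨q, hq⟩ := hU (Z y)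
    exact ⟨q, fun k => by linarith [hq k, g_shift y k]⟩
  have g_lip : LipschitzWith L g := by
    refine LipschitzWith.of_le_add_mul L fun x y => ?_
    have h1 := g_shift x (y - x)
    rw [add_sub_cancel] at h1
    have h2 := hUL.dist_le_mul (Z x + (y - x)) (Z x)
    rw [dist_self_add_left, Real.dist_eq] at h2
    rw [dist_eq_norm, norm_sub_rev]
    linarith [(abs_le.1 h2).1]
  have g_lb : ∀ y, -B ≤ g y := fun y => by
    have := g_ge y y
    simp only [sub_self, norm_zero] at this
    linarith [(abs_le.1 (hB y)).1]
  have g_ub : ∀ y, g y ≤ B := fun y => by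
    have := (abs_le.1 (hB (Z y))).2
    have h2 : 0 ≤ 2 * C * ‖Z y - y‖ ^ 2 := by positivity
    simp only [hg]; linarith
  have ex_min : ∀ x, ∃ y, ∀ z, g y + 2 * C * ‖y - x‖ ^ 2 ≤ g z + 2 * C * ‖z - x‖ ^ 2 := fun x => by
    obtain ⟨y, hy⟩ := exists_max_sub_sq (g := fun y => - g y) g_lip.continuous.neg
      (B := B) (fun y => by linarith [g_lb y]) hA x
    exact ⟨y, fun z => by linarith [hy z]⟩
  choose Y hY using ex_min
  -- Infimal convolution of `g`. Its opening `2C` exceeds the constant `C` of the lower paraboloids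
  -- of `g`, so the minimisation is strongly convex; this yields the expansion from below, while the
  -- one from above holds for any such infimum.
  set w : Space N → ℝ := fun x => g (Y x) + 2 * C * ‖Y x - x‖ ^ 2 with hw
  -- far away both convolutions are constant
  obtain ⟨D, hD, hD'⟩ : ∃ D, 0 < D ∧ 2 * B < 2 * C * D ^ 2 := by
    refine ⟨B / C + 1, by positivity, ?_⟩
    have h1 : B = C * (B / C) := by field_simp
    have h2 : 0 ≤ B / C := by positivity
    have : B < C * (B / C + 1) ^ 2 := by
      nth_rewrite 1 [h1]
      gcongr
      nlinarith
    linarith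
  have Z_near : ∀ y, ‖Z y - y‖ ≤ D := fun y => by
    by_contra! hcon
    have h1 := g_lb y
    have h2 := (abs_le.1 (hB (Z y))).2
    have h3 : 2 * C * D ^ 2 ≤ 2 * C * ‖Z y - y‖ ^ 2 := by gcongr
    simp only [hg] at h1
    linarith
  have Y_near : ∀ x, ‖Y x - x‖ ≤ D := fun x => by
    by_contra! hcon
    have h1 := hY x x
    have h2 := g_lb (Y x)
    have h4 := g_ub x
    have h3 : 2 * C * D ^ 2 ≤ 2 * C * ‖Y x - x‖ ^ 2 := by gcongr
    simp only [sub_self, norm_zero] at h1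
    linarith
  have far : ∀ (P : ℝ) (a b : Space N), ‖a - b‖ ≤ D → P + D < ‖b‖ → P < ‖a‖ := by
    intro P a b hab hb
    have := norm_sub_norm_le b a
    rw [norm_sub_rev] at this
    linarith
  have g_const : ∀ y, R + D < ‖y‖ → g y = c := fun y hy => by
    have hy' : R < ‖y‖ := by linarith
    apply le_antisymm
    · have : U (Z y) = c := hUc _ (far R _ y (Z_near y) hy)
      have h2 : 0 ≤ 2 * C * ‖Z y - y‖ ^ 2 := by positivity
      simp only [hg]; linarith
    · have := g_ge y y
      simp only [sub_self, norm_zero, hUc y hy'] at this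
      linarith
  refine ⟨w, fun x => (2 * (2 * C)) • (x - Y x), fun x k => abs_le.2 ⟨?_, ?_⟩, fun x => ?_,
    fun x => ?_, R + D + D, fun x hx => ?_⟩
  · have h1 := g_supp.strong_min (hY x) (Y (x + k))
    set z := Y (x + k) with hz
    have e1 : w (x + k) = g z + 2 * C * ‖z - (x + k)‖ ^ 2 := rfl
    have e2 : w x = g (Y x) + 2 * C * ‖Y x - x‖ ^ 2 := rfl
    rw [e1, inner_smul_left, e2]
    have n1 : ‖z - (x + k)‖ ^ 2 = ‖z - x‖ ^ 2 - 2 * ⟪z - x, k⟫ + ‖k‖ ^ 2 := by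
      rw [← sub_sub, norm_sub_sq_real]
    have n2 : ⟪x - Y x, k⟫ = ⟪z - Y x, k⟫ - ⟪z - x, k⟫ := by
      rw [← inner_sub_left]; congr 1; abel
    -- The strong convexity gain `C‖z - Y x‖²` absorbs the cross term `4C⟪z - Y x, k⟫` by completing
    -- this square, at the cost of `4C‖k‖²`.
    have n3 : 0 ≤ ‖z - Y x - (2 : ℝ) • k‖ ^ 2 := by positivity
    rw [norm_sub_sq_real, inner_smul_right, norm_smul] at n3
    rw [n1, n2]
    simp only [conj_trivial, Real.norm_eq_abs, abs_two] at n3 ⊢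
    nlinarith
  · have h1 := hY (x + k) (Y x)
    have n1 : ‖Y x - (x + k)‖ ^ 2 = ‖Y x - x‖ ^ 2 - 2 * ⟪Y x - x, k⟫ + ‖k‖ ^ 2 := by
      rw [← sub_sub, norm_sub_sq_real]
    have n2 : ⟪x - Y x, k⟫ = - ⟪Y x - x, k⟫ := by rw [← inner_neg_left, neg_sub]
    rw [n1] at h1
    rw [inner_smul_left, n2]
    simp only [conj_trivial, hw]
    linarith
  · have := g_ge (Y x) x
    rw [norm_sub_rev] at this
    simp only [hw]
    linarith
  · obtain ⟨q, hq⟩ := hV x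
    -- The trial point minimises the value of `y ↦ g y + 2C‖y - x‖²` when `V` is replaced by its
    -- upper paraboloid at `x`; the terms linear in `Z y - x` and those in `‖q‖²` then cancel
    -- exactly.
    set y := x - (1 / (4 * C)) • q with hy
    have h1 := hY x y
    have h2 := hq (Z y - x)
    rw [add_sub_cancel] at h2
    have h3 := hUV (Z y)
    have n1 : ‖y - x‖ ^ 2 = (1 / (4 * C)) ^ 2 * ‖q‖ ^ 2 := by
      rw [hy, sub_sub_cancel_left, norm_neg, norm_smul, mul_pow, Real.norm_eq_abs, sq_abs]
    have n2 : ‖Z y - y‖ ^ 2 = ‖Z y - x‖ ^ 2 + 2 * ((1 / (4 * C)) * ⟪q, Z y - x⟫)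
        + (1 / (4 * C)) ^ 2 * ‖q‖ ^ 2 := by
      have : Z y - y = (Z y - x) + (1 / (4 * C)) • q := by rw [hy]; abel
      rw [this, norm_add_sq_real, inner_smul_right, norm_smul, mul_pow, Real.norm_eq_abs, sq_abs,
        real_inner_comm]
    have e1 : g y = U (Z y) - 2 * C * ‖Z y - y‖ ^ 2 := rfl
    rw [n1, e1, n2] at h1
    have n3 : 2 * C * (2 * ((1 / (4 * C)) * ⟪q, Z y - x⟫)) = ⟪q, Z y - x⟫ := by field_simp; ring
    have n4 : 0 ≤ C * ‖Z y - x‖ ^ 2 := by positivity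
    simp only [hw]
    linarith
  · have hY' : R + D < ‖Y x‖ := far _ _ x (Y_near x) hx
    apply le_antisymm
    · have := hY x x
      rw [g_const x (by linarith)] at this
      simpa [hw] using this
    · have h2 : 0 ≤ 2 * C * ‖Y x - x‖ ^ 2 := by positivity
      have := g_const _ hY'
      simp only [hw]
      linarith

end Interposition

/-! ### Sard argument for `C^{1,1}` functions -/

section Sard

variable {N : ℕ}

open MeasureTheory in
/-- For almost every `a` the fibre over `-a` of a Lipschitz self-map of `ℝ^N` is countable. -/
lemma exists_small_countable_fiber {q : Space N → Space N} {L : ℝ≥0} (hq : LipschitzWith L q)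
    {ε : ℝ} (hε : 0 < ε) : ∃ a : Space N, ‖a‖ < ε ∧ {x | q x + a = 0}.Countable := by
  -- Full-dimensional Hausdorff measure is both controlled under Lipschitz images and an additive
  -- Haar measure, so it serves for Rademacher's theorem and for the images of the points without
  -- derivative and of the critical points.
  set μ : Measure (Space N) := Measure.hausdorffMeasure (Module.finrank ℝ (Space N)) with hμ
  set A : Set (Space N) := {x | ¬ DifferentiableAt ℝ q x} with hA
  set B : Set (Space N) := {x | DifferentiableAt ℝ q x ∧ (fderiv ℝ q x).det = 0} with hB
  have hA0 : μ (q '' A) = 0 := by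
    have h1 : μ A = 0 := by
      have : ∀ᵐ x ∂μ, DifferentiableAt ℝ q x := hq.ae_differentiableAt
      exact this
    have h2 := hq.hausdorffMeasure_image_le (d := (Module.finrank ℝ (Space N) : ℝ))
      (by positivity) A
    rw [← hμ, h1, mul_zero] at h2
    exact le_antisymm h2 bot_le
  have hB0 : μ (q '' B) = 0 :=
    addHaar_image_eq_zero_of_det_fderivWithin_eq_zero μ
      (f' := fderiv ℝ q) (fun x hx => hx.1.hasFDerivAt.hasFDerivWithinAt) (fun x hx => hx.2)
  have hnull : μ (q '' A ∪ q '' B) = 0 := measure_union_null hA0 hB0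
  have hdense : Dense (q '' A ∪ q '' B)ᶜ :=
    Measure.dense_of_ae (μ := μ) (p := fun x => x ∈ (q '' A ∪ q '' B)ᶜ) (by
      rw [ae_iff]
      simp only [mem_compl_iff, not_not]
      exact hnull)
  obtain ⟨a, ha, haε⟩ := hdense.exists_dist_lt (0 : Space N) hε
  refine ⟨-a, by simpa [dist_eq_norm] using haε, ?_⟩
  -- Over a regular value the derivative is invertible at every point of the fibre, so each such
  -- point is isolated; a discrete subset of a separable metric space is countable.
  have hdisc : DiscreteTopology {x | q x + -a = 0} := by
    rw [discreteTopology_subtype_iff]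
    intro x hx
    have hxa : q x = a := by simpa [add_neg_eq_zero] using hx
    have hxd : DifferentiableAt ℝ q x := by
      by_contra h
      exact ha (Or.inl ⟨x, h, hxa⟩)
    have hdet : (fderiv ℝ q x).det ≠ 0 := fun h => ha (Or.inr ⟨x, ⟨hxd, h⟩, hxa⟩)
    have hev : ∀ᶠ z in 𝓝[≠] x, q z ≠ a := by
      refine hxd.hasFDerivAt.eventually_ne
        ⟨_, ((fderiv ℝ q x).toContinuousLinearEquivOfDetNeZero hdet).antilipschitz⟩
    rw [← disjoint_iff, Filter.disjoint_principal_right]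
    filter_upwards [hev] with z hz h
    exact hz (by simpa [add_neg_eq_zero] using h)
  have : Countable {x | q x + -a = 0} := TopologicalSpace.separableSpace_iff_countable.1 inferInstance
  exact this

/-- Small affine perturbations make zero a regular value. -/
lemma exists_small_affine_regular {C : ℝ} {w : Space N → ℝ} {q : Space N → Space N}
    (h : HasQuadExpansion C w q) {ε : ℝ} (hε : 0 < ε) :
    ∃ (a : Space N) (b : ℝ), ‖a‖ < ε ∧ |b| < ε ∧
      ∀ x, w x + (b + ⟪a, x⟫) = 0 → q x + a ≠ 0 := by
  -- Sard's theorem for scalar functions needs more smoothness than `C^{1,1}` in high dimension.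
  -- Tilting by a generic `a` makes the critical set itself countable, so there are only countably
  -- many critical values to avoid with `b`.
  obtain ⟨a, ha, hc⟩ := exists_small_countable_fiber h.lipschitz_slope hε
  have hc' : ((fun x => -(w x + ⟪a, x⟫)) '' {x | q x + a = 0}).Countable := hc.image _
  obtain ⟨b, hb, hbε⟩ := (hc'.dense_compl ℝ).exists_dist_lt (0 : ℝ) hε
  refine ⟨a, b, ha, by simpa [dist_eq_norm] using hbε, fun x hx hxa => hb ⟨x, hxa, ?_⟩⟩
  simp only
  linarith

end Sard

/-! ### Interposition with zero as a regular value -/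

section Separation

variable {N : ℕ}

/-- Smooth cutoff functions between a closed set and an open neighbourhood of it. -/
lemma exists_cutoff {t O : Set (Space N)} (ht : IsClosed t) (hO : IsOpen O) (htO : t ⊆ O) :
    ∃ f : Space N → ℝ, ContDiff ℝ ∞ f ∧ (∀ x, 0 ≤ f x) ∧ (∀ x, f x ≤ 1) ∧
      (∀ x, x ∈ t → f x = 1) ∧ ∀ x, x ∉ O → f x = 0 := by
  obtain ⟨f, f_diff, f_range, fs, ft⟩ := exists_contMDiff_zero_iff_one_iff_of_isClosed (n := (⊤ : ℕ∞))
    (modelWithCornersSelf ℝ (Space N)) hO.isClosed_compl ht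
    (disjoint_compl_left_iff_subset.2 htO)
  have hr : ∀ x, f x ∈ Icc (0 : ℝ) 1 := fun x => f_range ⟨x, rfl⟩
  exact ⟨f, f_diff.contDiff, fun x => (hr x).1, fun x => (hr x).2, fun x hx => (ft x).1 hx,
    fun x hx => (fs x).1 hx⟩

lemma UpperSupported.sub_const_mul {C D σ : ℝ} {V ρ : Space N → ℝ} {q : Space N → Space N}
    (hV : UpperSupported C V) (hρ : HasQuadExpansion D ρ q) (hσ : 0 ≤ σ) :
    UpperSupported (C + σ * D) (fun x => V x - σ * ρ x) := fun x => by
  obtain ⟨r, hr⟩ := hV x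
  refine ⟨r - σ • q x, fun k => ?_⟩
  have h1 := mul_le_mul_of_nonneg_left (abs_le.1 (hρ x k)).1 hσ
  rw [inner_sub_left, inner_smul_left, conj_trivial]
  linarith [hr k]

lemma LowerSupported.add_const_mul {C D σ : ℝ} {V ρ : Space N → ℝ} {q : Space N → Space N}
    (hV : LowerSupported C V) (hρ : HasQuadExpansion D ρ q) (hσ : 0 ≤ σ) :
    LowerSupported (C + σ * D) (fun x => V x + σ * ρ x) := fun x => by
  obtain ⟨r, hr⟩ := hV x
  refine ⟨r + σ • q x, fun k => ?_⟩
  have h1 := mul_le_mul_of_nonneg_left (abs_le.1 (hρ x k)).1 hσ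
  rw [inner_add_left, inner_smul_left, conj_trivial]
  linarith [hr k]

lemma LowerSupported.mono {C D : ℝ} {V : Space N → ℝ} (hV : LowerSupported C V) (h : C ≤ D) :
    LowerSupported D V := fun x => by
  obtain ⟨r, hr⟩ := hV x
  exact ⟨r, fun k => (by gcongr : _ ≤ V x + ⟪r, k⟫ - C * ‖k‖ ^ 2).trans (hr k)⟩

lemma UpperSupported.mono {C D : ℝ} {V : Space N → ℝ} (hV : UpperSupported C V) (h : C ≤ D) :
    UpperSupported D V := fun x => by
  obtain ⟨r, hr⟩ := hV x
  exact ⟨r, fun k => (hr k).trans (by gcongr)⟩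

lemma exists_norm_gt {p : Space N} (hp : p ≠ 0) (R : ℝ) : ∃ x : Space N, R < ‖x‖ := by
  have hp' : 0 < ‖p‖ := norm_pos_iff.2 hp
  refine ⟨((|R| + 1) / ‖p‖) • p, ?_⟩
  rw [norm_smul, Real.norm_of_nonneg (by positivity), div_mul_cancel₀ _ hp'.ne']
  linarith [le_abs_self R]

/-- **Separation.** If all points where a semiconvex `U` touches a larger semiconcave `V` have the
same nonzero slope `p`, a `C^{1,1}` function with regular compact zero level set fits in between. -/
lemma exists_regular_interposition {C : ℝ} (hC : 0 < C) {U V : Space N → ℝ} {L : ℝ≥0}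
    (hUL : LipschitzWith L U) (hVc : Continuous V) {R cU cV : ℝ} {p : Space N} (hp : p ≠ 0)
    (hUR : ∀ x, R < ‖x‖ → U x = cU) (hVR : ∀ x, R < ‖x‖ → V x = cV)
    (hU : LowerSupported C U) (hV : UpperSupported C V) (hUV : ∀ x, U x ≤ V x)
    (htouch : ∀ x, U x = V x → ∀ k, U (x + k) ≤ U x + ⟪p, k⟫ + C * ‖k‖ ^ 2) :
    ∃ (D : ℝ) (w : Space N → ℝ) (q : Space N → Space N), HasQuadExpansion D w q ∧
      (∀ x, U x ≤ w x) ∧ (∀ x, w x ≤ V x) ∧ (∀ x, w x = 0 → q x ≠ 0) ∧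
      (∀ x, U x = V x → q x = p) ∧ ∃ R' c, c ≠ 0 ∧ ∀ x, R' < ‖x‖ → w x = c := by
  have hp' : 0 < ‖p‖ := norm_pos_iff.2 hp
  -- At a touching point the upper paraboloid of slope `p` fixes the slope of every lower one.
  have hlow : ∀ x, U x = V x → ∀ k, U x + ⟪p, k⟫ - C * ‖k‖ ^ 2 ≤ U (x + k) := fun x hx k => by
    obtain ⟨q, hq⟩ := hU x
    have : q = p := slope_unique one_pos fun k _ => by
      have := (hq k).trans (htouch x hx k)
      rw [add_sub_assoc, add_assoc] at this
      exact le_of_add_le_add_left this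
    exact this ▸ hq k
  -- the constants at infinity are different
  have hnt : ∀ x, R < ‖x‖ → U x ≠ V x := fun x hx hxV => hp <| by
    have hr : 0 < ‖x‖ - R := by linarith
    refine eq_zero_of_inner_le_sq (C := C) hr fun k hk => ?_
    have h1 := hlow x hxV k
    have h2 : R < ‖x + k‖ := by
      have := norm_sub_norm_le x (-k)
      rw [sub_neg_eq_add, norm_neg] at this
      linarith
    rw [hUR x hx, hUR _ h2] at h1
    linarith
  have hcc : cU < cV := by
    obtain ⟨x, hx⟩ := exists_norm_gt hp R
    have h1 := hnt x hx
    have h2 := hUV x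
    rw [hUR x hx, hVR x hx] at h1 h2
    exact lt_of_le_of_ne h2 h1
  set T : Set (Space N) := {x | U x = V x} with hT
  have hTc : IsClosed T := isClosed_eq hUL.continuous hVc
  have hTR : T ⊆ Metric.closedBall 0 R := fun x hx => by
    by_contra h
    exact hnt x (by simpa using h) hx
  -- The interposed slope will be `12(C + 1)`-Lipschitz and equal to `p` on `T`; within distance
  -- `2r` of `T` it changes by at most `24/100 ‖p‖`, hence stays above `‖p‖ / 2`.
  set r : ℝ := ‖p‖ / (100 * (C + 1)) with hr
  have hr0 : 0 < r := by positivity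
  -- the cutoff around the touching set
  obtain ⟨ρ, hρ, hρ0, hρ1, hρT, hρO⟩ := exists_cutoff (t := Metric.cthickening r T)
    (O := Metric.thickening (2 * r) T) Metric.isClosed_cthickening Metric.isOpen_thickening
    (Metric.cthickening_subset_thickening' (by linarith) (by linarith) T)
  have hfar : ∀ x, R + 2 * r < ‖x‖ → x ∉ Metric.thickening (2 * r) T := fun x hx hxT => by
    obtain ⟨z, hz, hxz⟩ := Metric.mem_thickening_iff.1 hxT
    have h1 : ‖z‖ ≤ R := by simpa using hTR hz
    rw [dist_eq_norm] at hxz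
    linarith [norm_sub_norm_le x z]
  have hρfar : ∀ x, R + 2 * r < ‖x‖ → ρ x = 0 := fun x hx => hρO x (hfar x hx)
  set ρ₀ : Space N → ℝ := fun x => 1 - ρ x with hρ₀
  have hρ₀d : ContDiff ℝ ∞ ρ₀ := contDiff_const.sub hρ
  obtain ⟨Cρ, hCρ⟩ := exists_hasQuadExpansion (w := ρ₀) (hρ₀d.of_le (by norm_cast))
    (R := R + 2 * r) (c := 1) (fun x hx => by simp [hρ₀, hρfar x hx])
  obtain ⟨Lρ, hLρ⟩ : ∃ L' : ℝ≥0, LipschitzWith L' ρ₀ := by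
    have hcs : HasCompactSupport ρ :=
      HasCompactSupport.intro (isCompact_closedBall (0 : Space N) (R + 2 * r)) fun x hx =>
        hρfar x (by simpa using hx)
    obtain ⟨L', hL'⟩ := ContDiff.lipschitzWith_of_hasCompactSupport hcs hρ (by norm_num)
    refine ⟨L', LipschitzWith.of_dist_le_mul fun x y => ?_⟩
    have := hL'.dist_le_mul x y
    rwa [Real.dist_eq, hρ₀, sub_sub_sub_cancel_left, abs_sub_comm, ← Real.dist_eq]
  -- the gap away from the touching set
  obtain ⟨m, hm, hmgap⟩ : ∃ m : ℝ, 0 < m ∧ ∀ x, x ∉ Metric.thickening r T → m ≤ V x - U x := by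
    have hK : IsCompact (Metric.closedBall (0 : Space N) R \ Metric.thickening r T) :=
      (isCompact_closedBall _ _).diff Metric.isOpen_thickening
    have hpos : ∀ x ∈ Metric.closedBall (0 : Space N) R \ Metric.thickening r T,
        0 < V x - U x := fun x hx => by
      have h1 : U x ≠ V x := fun h => hx.2 (Metric.self_subset_thickening hr0 T h)
      have := lt_of_le_of_ne (hUV x) h1
      linarith
    obtain ⟨m, hm, hmK⟩ : ∃ m : ℝ, 0 < m ∧
        ∀ x ∈ Metric.closedBall (0 : Space N) R \ Metric.thickening r T, m ≤ V x - U x := by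
      rcases (Metric.closedBall (0 : Space N) R \ Metric.thickening r T).eq_empty_or_nonempty
        with h | h
      · exact ⟨1, one_pos, by simp [h]⟩
      · obtain ⟨z, hz, hmin⟩ := hK.exists_isMinOn h (hVc.sub hUL.continuous).continuousOn
        exact ⟨_, hpos z hz, fun x hx => hmin hx⟩
    refine ⟨min m (cV - cU), lt_min hm (by linarith), fun x hx => ?_⟩
    rcases lt_or_ge R ‖x‖ with h | h
    · rw [hUR x h, hVR x h]; exact min_le_right _ _
    · exact (min_le_left _ _).trans (hmK x ⟨by simpa using h, hx⟩)
  -- Three demands: `2σ ≤ m` keeps the shrunken pair ordered, `σ Cρ ≤ 1` raises the semiconvexity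
  -- constants by at most one, and `cU + σ ≠ 0` keeps zero away from the value at infinity.
  obtain ⟨σ, hσ, hσm, hσC, hσc⟩ : ∃ σ : ℝ, 0 < σ ∧ 2 * σ ≤ m ∧ σ * Cρ ≤ 1 ∧ cU + σ ≠ 0 := by
    set s : ℝ := min (m / 2) (1 / (Cρ + 1)) with hs
    have hs0 : 0 < s := lt_min (by linarith) (by positivity)
    have hs1 : s ≤ m / 2 := min_le_left _ _
    have hs2 : s * Cρ ≤ 1 := by
      calc s * Cρ ≤ 1 / (Cρ + 1) * Cρ := by gcongr; exact min_le_right _ _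
        _ ≤ 1 := by rw [one_div_mul_eq_div, div_le_one (by positivity)]; linarith
    by_cases h : cU + s = 0
    · refine ⟨s / 2, by linarith, by linarith, ?_, by linarith⟩
      have : 0 ≤ s * Cρ := by positivity
      linarith
    · exact ⟨s, hs0, by linarith, hs2, h⟩
  have hρ₀0 : ∀ x, 0 ≤ ρ₀ x := fun x => by simp only [hρ₀]; linarith [hρ1 x]
  have hρ₀1 : ∀ x, ρ₀ x ≤ 1 := fun x => by simp only [hρ₀]; linarith [hρ0 x]
  -- Interposing inside a gap shrunk by `σ ρ₀` leaves `w` free to move by `σ ρ₀` on either side,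
  -- while near `T`, where `ρ₀ = 0`, nothing is lost.
  obtain ⟨w, q, hw, hUw, hwV, R₃, hwR⟩ := exists_interposition (C := C + 1) (by linarith)
    (U := fun x => U x + σ * ρ₀ x) (V := fun x => V x - σ * ρ₀ x) (L := L + (Real.toNNReal σ) * Lρ)
    (R := max R (R + 2 * r)) (c := cU + σ)
    (hUL.add (by
      refine LipschitzWith.of_dist_le_mul fun x y => ?_
      have h1 := hLρ.dist_le_mul x y
      rw [Real.dist_eq] at h1 ⊢
      rw [← mul_sub, abs_mul, abs_of_pos hσ, NNReal.coe_mul, Real.coe_toNNReal _ hσ.le, mul_assoc]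
      gcongr))
    (fun x hx => by
      rw [hUR x (lt_of_le_of_lt (le_max_left _ _) hx)]
      simp [hρ₀, hρfar x (lt_of_le_of_lt (le_max_right _ _) hx)])
    ((hU.add_const_mul hCρ hσ.le).mono (by linarith))
    ((hV.sub_const_mul hCρ hσ.le).mono (by linarith))
    (fun x => by
      by_cases hx : x ∈ Metric.thickening r T
      · have : ρ x = 1 := hρT x (Metric.thickening_subset_cthickening _ _ hx)
        simpa [hρ₀, this] using hUV x
      · have h1 := hmgap x hx
        have h2 : σ * ρ₀ x ≤ σ * 1 := by gcongr; exact hρ₀1 x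
        linarith)
  have hwT : ∀ x, U x = V x → w x = U x ∧ q x = p := fun x hx => by
    have h1 := hUw x
    have h2 := hwV x
    have h3 : 0 ≤ σ * ρ₀ x := mul_nonneg hσ.le (hρ₀0 x)
    have h4 : w x = U x := by linarith
    refine ⟨h4, hw.slope_eq (D := C) fun k => ?_⟩
    have h5 := hlow x hx k
    have h6 := hUw (x + k)
    have h7 : 0 ≤ σ * ρ₀ (x + k) := mul_nonneg hσ.le (hρ₀0 _)
    linarith
  have hqO : ∀ x ∈ Metric.thickening (2 * r) T, ‖p‖ / 2 ≤ ‖q x‖ := fun x hx => by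
    obtain ⟨z, hz, hxz⟩ := Metric.mem_thickening_iff.1 hx
    have h1 := hw.norm_slope_sub_le z (x - z)
    rw [add_sub_cancel, (hwT z hz).2, ← dist_eq_norm x z] at h1
    have h2 : 6 * (2 * (C + 1)) * dist x z ≤ 6 * (2 * (C + 1)) * (2 * r) := by gcongr
    have h3 : 6 * (2 * (C + 1)) * (2 * r) = 24 / 100 * ‖p‖ := by rw [hr]; field_simp; norm_num
    have h4 := norm_sub_norm_le p (q x)
    rw [norm_sub_rev] at h4
    linarith
  -- the compactly supported perturbation
  set R₄ : ℝ := max R₃ 0 with hR₄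
  have hR₄0 : 0 ≤ R₄ := le_max_right _ _
  obtain ⟨χ, hχ, hχ0, hχ1, hχT, hχO⟩ := exists_cutoff (t := Metric.closedBall (0 : Space N) R₄)
    (O := Metric.ball 0 (R₄ + 1)) Metric.isClosed_closedBall Metric.isOpen_ball
    (Metric.closedBall_subset_ball (by linarith))
  set ζ : Space N → ℝ := fun x => ρ₀ x * χ x with hζ
  have hζd : ContDiff ℝ ∞ ζ := hρ₀d.mul hχ
  have hζ0 : ∀ x, 0 ≤ ζ x := fun x => mul_nonneg (hρ₀0 x) (hχ0 x)
  have hζρ : ∀ x, ζ x ≤ ρ₀ x := fun x => mul_le_of_le_one_right (hρ₀0 x) (hχ1 x)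
  have hζ1 : ∀ x, ζ x ≤ 1 := fun x => (hζρ x).trans (hρ₀1 x)
  have hζfar : ∀ x, R₄ + 1 ≤ ‖x‖ → ζ x = 0 := fun x hx => by
    simp [hζ, hχO x (by simpa using hx)]
  obtain ⟨G, hG0, hG⟩ : ∃ G : ℝ, 0 ≤ G ∧ ∀ x, ‖x‖ ≤ R₄ → ‖fderiv ℝ ζ x‖ ≤ G := by
    obtain ⟨G, hG⟩ := (isCompact_closedBall (0 : Space N) R₄).exists_bound_of_continuousOn
      (hζd.continuous_fderiv (by norm_num)).continuousOn
    exact ⟨max G 0, le_max_right _ _, fun x hx => (hG x (by simpa using hx)).trans (le_max_left _ _)⟩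
  set M : ℝ := R₄ + 2 with hM
  have hM0 : 0 < M := by positivity
  set μ : ℝ := min (min σ (|cU + σ|)) (‖p‖ / 4) with hμ
  have hμ0 : 0 < μ := lt_min (lt_min hσ (abs_pos.2 hσc)) (by positivity)
  -- Makes the affine function at most `μ / 2` on the ball of radius `R₄ + 1`, and the gradient of
  -- its cut-off product at most `μ` on the ball of radius `R₄`.
  set ε : ℝ := μ / (2 * M * (G + 1)) with hε
  have hε0 : 0 < ε := by positivity
  have hεM : ε * M ≤ μ / 2 := by
    have : ε * M * (G + 1) = μ / 2 := by rw [hε]; field_simp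
    have h2 : 0 ≤ ε * M := by positivity
    nlinarith
  have hεG : ε * M * G + ε ≤ μ := by
    have h1 : ε * M * (G + 1) = μ / 2 := by rw [hε]; field_simp
    have h2 : ε * 1 ≤ ε * M := by gcongr; linarith
    have h3 : 0 ≤ ε * M * G := by positivity
    linarith
  obtain ⟨a, b, ha, hb, hab⟩ := exists_small_affine_regular hw hε0
  set π : Space N → ℝ := fun x => ζ x * (b + ⟪a, x⟫) with hπ
  have hπd : ContDiff ℝ ∞ π := hζd.mul (contDiff_const.add (contDiff_const.inner ℝ contDiff_id))
  have haff : ∀ x, ‖x‖ ≤ R₄ + 1 → |b + ⟪a, x⟫| ≤ ε * M := fun x hx => by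
    have h1 : |⟪a, x⟫| ≤ ε * (R₄ + 1) := (abs_real_inner_le_norm a x).trans (by gcongr)
    calc _ ≤ |b| + |⟪a, x⟫| := abs_add_le _ _
      _ ≤ ε + ε * (R₄ + 1) := by gcongr
      _ = ε * M := by rw [hM]; ring
  have hπb : ∀ x, |π x| ≤ ρ₀ x * (μ / 2) := fun x => by
    rcases le_or_gt (R₄ + 1) ‖x‖ with h | h
    · have h1 := hρ₀0 x
      simp only [hπ, hζfar x h, zero_mul, abs_zero]
      positivity
    · simp only [hπ]
      rw [abs_mul, abs_of_nonneg (hζ0 x)]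
      exact mul_le_mul (hζρ x) ((haff x h.le).trans hεM) (abs_nonneg _) (hρ₀0 x)
  have hπσ : ∀ x, |π x| ≤ σ * ρ₀ x := fun x => (hπb x).trans (by
    rw [mul_comm]
    have : μ ≤ σ := (min_le_left _ _).trans (min_le_left _ _)
    have := hρ₀0 x
    gcongr
    linarith)
  have hπfar : ∀ x, R₄ + 1 < ‖x‖ → π x = 0 := fun x hx => by simp [hπ, hζfar x hx.le]
  obtain ⟨Cπ, hCπ⟩ := exists_hasQuadExpansion (w := π) (hπd.of_le (by norm_cast))
    (R := R₄ + 1) (c := 0) hπfar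
  have hπder : ∀ x, innerSL ℝ (gradient π x) =
      ζ x • innerSL ℝ a + (b + ⟪a, x⟫) • fderiv ℝ ζ x := fun x => by
    have h1 := hCπ.hasFDerivAt x
    have h2 : HasFDerivAt (fun x => b + ⟪a, x⟫) (innerSL ℝ a) x :=
      ((innerSL ℝ a).hasFDerivAt).const_add b
    exact h1.unique (((hζd.differentiable (by norm_num)) x).hasFDerivAt.mul h2)
  have hgrad : ∀ x, U x = V x → gradient π x = 0 := fun x hx => by
    refine eq_zero_of_inner_le_sq (C := Cπ) (r := r) hr0 fun k hk => ?_
    have h1 : ∀ z, dist z x < r → π z = 0 := fun z hz => by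
      have : ρ z = 1 := hρT z (Metric.thickening_subset_cthickening _ _
        (Metric.mem_thickening_iff.2 ⟨x, hx, hz⟩))
      simp [hπ, hζ, hρ₀, this]
    have h2 := (abs_le.1 (hCπ x k)).1
    rw [h1 x (by simpa using hr0), h1 (x + k) (by simpa [dist_eq_norm] using hk)] at h2
    linarith
  refine ⟨_, fun x => w x + π x, fun x => q x + gradient π x, hw.add hCπ, fun x => ?_,
    fun x => ?_, fun x hx => ?_, fun x hx => ?_, R₄ + 1, cU + σ, hσc, fun x hx => ?_⟩
  · linarith [hUw x, (abs_le.1 (hπσ x)).1]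
  · linarith [hwV x, (abs_le.1 (hπσ x)).2]
  -- No critical zero in any of three regions: far away the value is close to `cU + σ ≠ 0`; near `T`
  -- the slope of `w` dominates the perturbation; elsewhere the perturbation is exactly affine to
  -- first order and the choice of `a`, `b` applies.
  · rcases lt_or_ge R₄ ‖x‖ with h | h
    · exfalso
      have h1 := hwR x (lt_of_le_of_lt (le_max_left _ _) h)
      have h2 := hπb x
      have h3 : ρ₀ x * (μ / 2) ≤ 1 * (μ / 2) := by gcongr; exact hρ₀1 x
      have h4 : π x = -(cU + σ) := by linarith
      have h5 : μ ≤ |cU + σ| := (min_le_left _ _).trans (min_le_right _ _)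
      rw [h4, abs_neg] at h2
      linarith
    · by_cases hxO : x ∈ Metric.thickening (2 * r) T
      · intro h0
        have h1 := hqO x hxO
        have h2 : ‖q x‖ = ‖gradient π x‖ := by rw [eq_neg_of_add_eq_zero_left h0, norm_neg]
        have h3 : ‖gradient π x‖ ≤ ε * M * G + ε := by
          rw [← innerSL_apply_norm ℝ (gradient π x), hπder x]
          refine (norm_add_le _ _).trans ?_
          rw [norm_smul, norm_smul, innerSL_apply_norm, add_comm, Real.norm_eq_abs,
            Real.norm_eq_abs, abs_of_nonneg (hζ0 x)]
          have h4 := haff x (by linarith)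
          have h5 := hG x h
          have h6 : ζ x * ‖a‖ ≤ 1 * ε := mul_le_mul (hζ1 x) ha.le (norm_nonneg _) zero_le_one
          have h7 : |b + ⟪a, x⟫| * ‖fderiv ℝ ζ x‖ ≤ ε * M * G := by gcongr
          linarith
        have h4 : μ ≤ ‖p‖ / 4 := min_le_right _ _
        linarith
      · have h1 : ρ₀ x = 1 := by simp [hρ₀, hρO x hxO]
        have h2 : ζ x = 1 := by simp [hζ, h1, hχT x (by simpa using h)]
        -- The cutoff attains its maximal value one at `x`, so its derivative vanishes even if `x`
        -- is not interior to the plateau.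
        have h3 : fderiv ℝ ζ x = 0 := by
          apply IsLocalMax.fderiv_eq_zero
          exact Eventually.of_forall fun z => by rw [h2]; exact hζ1 z
        have h4 : gradient π x = a := by
          have := hπder x
          rw [h2, h3, one_smul, smul_zero, add_zero] at this
          refine ext_inner_right ℝ fun v => ?_
          simpa using congrArg (fun l : Space N →L[ℝ] ℝ => l v) this
        simp only [h4]
        refine hab x ?_
        have : π x = b + ⟪a, x⟫ := by simp [hπ, h2]
        rw [← this]; exact hx
  · simp only [(hwT x hx).2, hgrad x hx, add_zero]
  · simp only [hwR x (lt_of_le_of_lt (le_max_left _ _) (by linarith : R₄ < ‖x‖)), hπfar x hx, add_zero]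

end Separation

/-! ### Orthogonal decomposition along an axis -/

section Horiz

variable {N : ℕ}

lemma horiz_sub (ν y z : Space N) : horiz ν (y - z) = horiz ν y - horiz ν z := by
  simp only [horiz, inner_sub_right, sub_smul]; abel

lemma inner_horiz_comm (ν y z : Space N) : ⟪y, horiz ν z⟫ = ⟪horiz ν y, z⟫ := by
  simp only [horiz, inner_sub_left, inner_sub_right, inner_smul_left, inner_smul_right,
    conj_trivial, real_inner_comm ν y]
  ring

lemma horiz_add_smul (ν y : Space N) : horiz ν y + ⟪ν, y⟫ • ν = y := by
  simp [horiz]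

lemma inner_horiz_self {ν : Space N} (hν : ‖ν‖ = 1) (y : Space N) : ⟪ν, horiz ν y⟫ = 0 := by
  simp [horiz, inner_sub_right, inner_smul_right, hν]

lemma horiz_horiz {ν : Space N} (hν : ‖ν‖ = 1) (y : Space N) :
    horiz ν (horiz ν y) = horiz ν y := by
  rw [horiz, inner_horiz_self hν, zero_smul, sub_zero]

lemma norm_sq_eq_horiz {ν : Space N} (hν : ‖ν‖ = 1) (y : Space N) :
    ‖y‖ ^ 2 = ‖horiz ν y‖ ^ 2 + ⟪ν, y⟫ ^ 2 := by
  nth_rewrite 1 [← horiz_add_smul ν y]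
  rw [norm_add_sq_real, inner_smul_right, real_inner_comm ν (horiz ν y), inner_horiz_self hν,
    norm_smul, hν, mul_one, Real.norm_eq_abs, sq_abs]
  ring

lemma norm_horiz_le {ν : Space N} (hν : ‖ν‖ = 1) (y : Space N) : ‖horiz ν y‖ ≤ ‖y‖ := by
  have := norm_sq_eq_horiz hν y
  exact le_of_sq_le_sq (by nlinarith [sq_nonneg ⟪ν, y⟫]) (norm_nonneg _)

end Horiz

/-! ### Regular level sets are `C^{1,1}` hypersurfaces -/

section LevelSets

variable {N : ℕ} {D : ℝ} {w : Space N → ℝ} {q : Space N → Space N}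

/-- A function with quadratic expansions takes both signs near a regular zero. -/
lemma HasQuadExpansion.sign_near_zero (h : HasQuadExpansion D w q) {x : Space N} (hx : w x = 0)
    (hq : q x ≠ 0) : x ∈ closure {y | 0 < w y} ∧ x ∈ closure {y | w y < 0} := by
  have hq' : 0 < ‖q x‖ ^ 2 := by positivity
  have hD : 0 ≤ D := h.nonneg_of_ne hq
  have key : ∀ σ : ℝ, σ ^ 2 = 1 → ∀ t : ℝ, 0 < t → D * t < 1 →
      0 < σ * w (x + (σ * t) • q x) := fun σ hσ t ht htD => by
    have h1 := abs_le.1 (h x ((σ * t) • q x))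
    rw [hx, inner_smul_right, real_inner_self_eq_norm_sq, norm_smul, mul_pow, Real.norm_eq_abs,
      sq_abs, mul_pow, hσ, one_mul] at h1
    have h2 : 0 < t * (1 - D * t) * ‖q x‖ ^ 2 := by
      have : 0 < 1 - D * t := by linarith
      positivity
    have h3 : σ = 1 ∨ σ = -1 := sq_eq_one_iff.1 hσ
    rcases h3 with rfl | rfl <;> linarith
  have hsmall : ∀ᶠ t : ℝ in 𝓝[>] 0, D * t < 1 := by
    refine Filter.Eventually.filter_mono nhdsWithin_le_nhds ?_
    have : Tendsto (fun t : ℝ => D * t) (𝓝 0) (𝓝 (D * 0)) := Continuous.tendsto (by fun_prop) 0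
    exact this.eventually_lt_const (by simp)
  have hlim : ∀ σ : ℝ, Tendsto (fun t : ℝ => x + (σ * t) • q x) (𝓝[>] 0) (𝓝 x) := fun σ => by
    have : Tendsto (fun t : ℝ => x + (σ * t) • q x) (𝓝 0) (𝓝 (x + (σ * 0) • q x)) :=
      Continuous.tendsto (by fun_prop) 0
    rw [mul_zero, zero_smul, add_zero] at this
    exact this.mono_left nhdsWithin_le_nhds
  refine ⟨mem_closure_of_tendsto (hlim 1) ?_, mem_closure_of_tendsto (hlim (-1)) ?_⟩
  · filter_upwards [hsmall, self_mem_nhdsWithin] with t h1 h2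
    simpa using key 1 (by norm_num) t h2 h1
  · filter_upwards [hsmall, self_mem_nhdsWithin] with t h1 h2
    have := key (-1) (by norm_num) t h2 h1
    simpa using this

/-- Regularity excludes zeros at which `w` is locally nonpositive, the only possible points of
difference between the two sets. -/
lemma HasQuadExpansion.closure_pos (h : HasQuadExpansion D w q) (hq : ∀ x, w x = 0 → q x ≠ 0) :
    closure {x | 0 < w x} = {x | 0 ≤ w x} := by
  refine subset_antisymm (closure_lt_subset_le continuous_const h.continuous) fun x hx => ?_
  rcases (show 0 ≤ w x from hx).eq_or_lt with h0 | h0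
  · exact (h.sign_near_zero h0.symm (hq x h0.symm)).1
  · exact subset_closure h0

lemma HasQuadExpansion.interior_nonneg (h : HasQuadExpansion D w q)
    (hq : ∀ x, w x = 0 → q x ≠ 0) : interior {x | 0 ≤ w x} ⊆ {x | 0 < w x} := fun x hx => by
  have hx' : x ∈ {x | 0 ≤ w x} := interior_subset hx
  rcases (show 0 ≤ w x from hx').eq_or_lt with h0 | h0
  · have h1 := (h.sign_near_zero h0.symm (hq x h0.symm)).2
    obtain ⟨y, hy, hy'⟩ := mem_closure_iff.1 h1 _ isOpen_interior hx
    have hy2 : y ∈ {x | 0 ≤ w x} := interior_subset hy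
    exact absurd (show 0 ≤ w y from hy2) (not_le.2 hy')
  · exact h0

lemma HasQuadExpansion.mem_frontier (h : HasQuadExpansion D w q) {x : Space N} (hx : w x = 0)
    (hq : q x ≠ 0) : x ∈ frontier {x | 0 ≤ w x} := by
  rw [frontier_eq_closure_inter_closure]
  refine ⟨subset_closure hx.ge, ?_⟩
  convert (h.sign_near_zero hx hq).2 using 2
  ext y; simp

/-- Lipschitz estimate for a quotient of a vector by a scalar. -/
lemma norm_inv_smul_sub_le {m e a a' : ℝ} {b b' : Space N} (hm : 0 < m) (ha : m / 2 ≤ a)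
    (ha' : m / 2 ≤ a') (hb : ‖b‖ ≤ 3 / 2 * m) (hbb : ‖b' - b‖ ≤ e) (haa : |a - a'| ≤ e) :
    ‖(1 / a') • b' - (1 / a) • b‖ ≤ 8 / m * e := by
  have h1 : 0 < a := by linarith
  have h2 : 0 < a' := by linarith
  have he : 0 ≤ e := (norm_nonneg _).trans hbb
  have e1 : (1 / a') • b' - (1 / a) • b = (1 / a') • (b' - b) + ((a - a') / (a' * a)) • b := by
    have e3 : (a - a') / (a' * a) = 1 / a' - 1 / a := by field_simp
    rw [e3, smul_sub, sub_smul]; abel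
  have i1 : 1 / a' ≤ 2 / m := by
    rw [div_le_div_iff₀ h2 hm]; linarith
  have i2 : 1 / (a' * a) ≤ 4 / m ^ 2 := by
    rw [div_le_div_iff₀ (by positivity) (by positivity)]
    have := mul_le_mul ha' ha (by positivity) h2.le
    nlinarith
  rw [e1]
  refine (norm_add_le _ _).trans ?_
  rw [norm_smul, norm_smul, Real.norm_of_nonneg (by positivity), Real.norm_eq_abs, abs_div,
    abs_of_pos (mul_pos h2 h1), div_eq_mul_one_div |a - a'|]
  calc _ ≤ 2 / m * e + e * (4 / m ^ 2) * (3 / 2 * m) := by gcongr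
    _ = _ := by field_simp; ring

/-- A function with quadratic expansions and Lipschitz slope on a ball is of class `C^{1,1}`. -/
lemma isCHolderOn_one_one {g : Space N → ℝ} {G : Space N → Space N} {r A B : ℝ}
    (hA : 0 ≤ A)
    (expand : ∀ y y', ‖y‖ < r → ‖y'‖ < r → |g y' - g y - ⟪G y, y' - y⟫| ≤ B * ‖y' - y‖ ^ 2)
    (Glip : ∀ y y', ‖y‖ < r → ‖y'‖ < r → ‖G y' - G y‖ ≤ A * ‖y' - y‖) :
    IsCHolderOn 1 1 g (Metric.ball 0 r) := by
  have hasD : ∀ y, ‖y‖ < r → HasFDerivAt g (innerSL ℝ (G y)) y := fun y hy => by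
    refine HasFDerivAt.of_isLittleO ?_
    refine Asymptotics.IsBigO.trans_isLittleO (g := fun y' : Space N => ‖y' - y‖ ^ 2) ?_ ?_
    · refine Asymptotics.IsBigO.of_bound B ?_
      filter_upwards [(isOpen_lt continuous_norm continuous_const).mem_nhds hy] with y' hy'
      simpa [Real.norm_eq_abs] using expand y y' hy hy'
    · have h1 : (fun k : Space N => ‖k‖ ^ 2) =o[𝓝 0] fun k => k :=
        Asymptotics.isLittleO_norm_pow_id one_lt_two
      have h2 : Tendsto (fun y' : Space N => y' - y) (𝓝 y) (𝓝 0) := by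
        have : Continuous fun y' : Space N => y' - y := by fun_prop
        simpa using this.tendsto y
      exact h1.comp_tendsto h2
  have fd : ∀ y, ‖y‖ < r → fderiv ℝ g y = innerSL ℝ (G y) := fun y hy => (hasD y hy).fderiv
  have fdlip : LipschitzOnWith (Real.toNNReal A) (fderiv ℝ g) (Metric.ball 0 r) := by
    refine LipschitzOnWith.of_dist_le_mul fun y' hy' y hy => ?_
    have hy1 : ‖y‖ < r := by simpa using hy
    have hy2 : ‖y'‖ < r := by simpa using hy'
    rw [fd y hy1, fd y' hy2, dist_eq_norm, ← map_sub, innerSL_apply_norm,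
      Real.coe_toNNReal _ hA, dist_eq_norm]
    exact Glip y y' hy1 hy2
  refine ⟨?_, Real.toNNReal A, ?_⟩
  · rw [show ((1 : ℕ) : ℕ∞ω) = 0 + 1 from by norm_num,
      contDiffOn_succ_iff_fderiv_of_isOpen Metric.isOpen_ball]
    refine ⟨fun y hy => (hasD y (by simpa using hy)).differentiableAt.differentiableWithinAt,
      by simp, ?_⟩
    rw [contDiffOn_zero]
    exact fdlip.continuousOn
  · refine LipschitzOnWith.holderOnWith (LipschitzOnWith.of_dist_le_mul fun y' hy' y hy => ?_)
    refine le_trans ?_ (fdlip.dist_le_mul y' hy' y hy)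
    rw [dist_eq_norm, dist_eq_norm]
    refine ContinuousMultilinearMap.opNorm_le_bound (norm_nonneg _) fun v => ?_
    simp only [sub_apply, iteratedFDeriv_one_apply,
      Fin.prod_univ_one]
    exact ContinuousLinearMap.le_opNorm (fderiv ℝ g y' - fderiv ℝ g y) (v 0)

/-- Local graph representation of a regular level set. -/
lemma HasQuadExpansion.exists_graph (h : HasQuadExpansion D w q) {x : Space N} (hx : w x = 0)
    (hqx : q x ≠ 0) : ∃ (c ν : Space N) (r s : ℝ) (g : Space N → ℝ),
    ‖ν‖ = 1 ∧ x ∈ cylinder c ν r s ∧ IsGraphFun 1 1 r s g ∧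
    ∀ y ∈ cylinder c ν r s, y ∈ {z | 0 < w z} ↔ ⟪ν, y - c⟫ < g (horiz ν (y - c)) := by
  wlog hD : 1 ≤ D generalizing D
  · exact this (h.mono (le_max_left D 1)) (le_max_right _ _)
  set m := ‖q x‖ with hm
  have hm0 : 0 < m := norm_pos_iff.2 hqx
  set ν : Space N := -((1 / m) • q x) with hν
  have hν1 : ‖ν‖ = 1 := by
    rw [hν, norm_neg, norm_smul, Real.norm_of_nonneg (by positivity), ← hm]; field_simp
  have hqν : ⟪q x, ν⟫ = -m := by
    rw [hν, inner_neg_right, inner_smul_right, real_inner_self_eq_norm_sq, ← hm]; field_simp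
  -- With this height the slope varies by at most `m / 2` on the ball of radius `2s`, so `w`
  -- decreases strictly along `ν`. The radius `s / 8` below is small enough that horizontal moves,
  -- worth at most `m s / 4`, cannot change the sign of `w` at the top and bottom.
  set s : ℝ := m / (24 * D) with hs
  have hs0 : 0 < s := by positivity
  have hDs : D * s = m / 24 := by rw [hs]; field_simp
  set r : ℝ := s / 8 with hr
  have hr0 : 0 < r := by positivity
  -- bounds for the slope in the cylinder
  have near : ∀ z, ‖z - x‖ ≤ 2 * s → ‖q z - q x‖ ≤ m / 2 := fun z hz => by
    have h1 := h.norm_slope_sub_le x (z - x)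
    rw [add_sub_cancel] at h1
    have h2 : 6 * D * ‖z - x‖ ≤ 6 * D * (2 * s) := by gcongr
    linarith
  have nearν : ∀ z, ‖z - x‖ ≤ 2 * s → m / 2 ≤ -⟪q z, ν⟫ := fun z hz => by
    have h1 : ⟪q z, ν⟫ = ⟪q z - q x, ν⟫ - m := by rw [inner_sub_left, hqν]; ring
    have h2 := real_inner_le_norm (q z - q x) ν
    rw [hν1, mul_one] at h2
    linarith [near z hz]
  have nearn : ∀ z, ‖z - x‖ ≤ 2 * s → ‖q z‖ ≤ 3 / 2 * m := fun z hz => by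
    have := norm_sub_norm_le (q z) (q x)
    linarith [near z hz]
  have mem : ∀ (y : Space N) (t : ℝ), ‖y‖ < r → |t| ≤ s →
      ‖x + horiz ν y + t • ν - x‖ ≤ 2 * s := fun y t hy ht => by
    have e : x + horiz ν y + t • ν - x = horiz ν y + t • ν := by abel
    rw [e]
    refine (norm_add_le _ _).trans ?_
    rw [norm_smul, hν1, mul_one, Real.norm_eq_abs]
    linarith [norm_horiz_le hν1 y]
  have decr : ∀ (y : Space N) (t τ : ℝ), ‖y‖ < r → |t| ≤ s → |t + τ| ≤ s → 0 ≤ τ →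
      w (x + horiz ν y + (t + τ) • ν) ≤ w (x + horiz ν y + t • ν) - m / 4 * τ :=
    fun y t τ hy ht htτ hτ => by
    have h1 := (abs_le.1 (h (x + horiz ν y + t • ν) (τ • ν))).2
    have h2 := nearν _ (mem y t hy ht)
    have h3 : τ ≤ 2 * s := by linarith [(abs_le.1 ht).1, (abs_le.1 htτ).2]
    rw [inner_smul_right, norm_smul, hν1, mul_one, Real.norm_of_nonneg hτ, add_assoc _ _ (τ • ν),
      ← add_smul] at h1
    have h4 : D * τ ^ 2 ≤ (m / 12) * τ := by
      have : D * τ ≤ D * (2 * s) := by gcongr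
      nlinarith
    nlinarith
  have horizontal : ∀ (z k : Space N), ‖z - x‖ ≤ 2 * s → ‖k‖ ≤ 2 * r →
      |w (z + k) - w z| ≤ 2 * m * ‖k‖ := fun z k hz hk => by
    have h1 := abs_le.1 (h z k)
    have h2 := abs_le.1 (abs_real_inner_le_norm (q z) k)
    have h3 : ‖q z‖ * ‖k‖ ≤ 3 / 2 * m * ‖k‖ := by gcongr; exact nearn z hz
    have h4 : D * ‖k‖ ^ 2 ≤ m / 2 * ‖k‖ := by
      have : D * ‖k‖ ≤ D * (2 * r) := by gcongr
      have h5 : D * (2 * r) = m / 96 := by rw [hr]; linarith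
      nlinarith [norm_nonneg k]
    exact abs_le.2 ⟨by linarith, by linarith⟩
  have ends : ∀ y : Space N, ‖y‖ < r → 0 < w (x + horiz ν y + (-s) • ν) ∧
      w (x + horiz ν y + s • ν) < 0 := fun y hy => by
    have hy0 : ‖(0 : Space N)‖ < r := by simpa using hr0
    have hz0 : horiz ν (0 : Space N) = 0 := by simp [horiz]
    have hk : ‖horiz ν y‖ ≤ r := (norm_horiz_le hν1 y).trans hy.le
    have habs : |s| = s := abs_of_pos hs0
    have habs' : |-s| = s := by rw [abs_neg, habs]
    have hms : 0 < m * s := by positivity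
    have h5 : 2 * m * ‖horiz ν y‖ ≤ 2 * m * r := by gcongr
    have h6 : 2 * m * r = m * s / 4 := by rw [hr]; ring
    have q1 := (abs_le.1 (h x ((-s) • ν))).1
    have q2 := (abs_le.1 (h x (s • ν))).2
    rw [inner_smul_right, hqν, hx, norm_smul, hν1, mul_one, Real.norm_eq_abs, sq_abs] at q1 q2
    have h7 : D * s ^ 2 = m * s / 24 := by rw [pow_two, ← mul_assoc, hDs]; ring
    have e : ∀ t : ℝ, x + horiz ν y + t • ν = (x + t • ν) + horiz ν y := fun t => by abel
    have z1 := mem 0 (-s) hy0 habs'.le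
    have z2 := mem 0 s hy0 habs.le
    rw [hz0, add_zero] at z1 z2
    have g1 := (abs_le.1 (horizontal (x + (-s) • ν) (horiz ν y) z1 (by linarith))).1
    have g2 := (abs_le.1 (horizontal (x + s • ν) (horiz ν y) z2 (by linarith))).2
    rw [e, e]
    constructor <;> nlinarith
  -- Implicit function theorem by hand: the sign change on each vertical segment gives the height,
  -- and the strict decrease `decr` later gives the Lipschitz bound and the subgraph description.
  have ex : ∀ y : Space N, ∃ t : ℝ, ‖y‖ < r → |t| < s ∧ w (x + horiz ν y + t • ν) = 0 := fun y => by
    by_cases hy : ‖y‖ < r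
    · obtain ⟨e1, e2⟩ := ends y hy
      have hc : Continuous fun t : ℝ => w (x + horiz ν y + t • ν) :=
        h.continuous.comp (by fun_prop)
      obtain ⟨t, ht, ht0⟩ := intermediate_value_Ioo' (a := -s) (b := s) (by linarith)
        hc.continuousOn ⟨e2, e1⟩
      exact ⟨t, fun _ => ⟨abs_lt.2 ⟨ht.1, ht.2⟩, ht0⟩⟩
    · exact ⟨0, fun hy' => absurd hy' hy⟩
  choose g hg using ex
  set P : Space N → Space N := fun y => x + horiz ν y + g y • ν with hP
  have Pmem : ∀ y, ‖y‖ < r → ‖P y - x‖ ≤ 2 * s := fun y hy => mem y _ hy (hg y hy).1.le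
  have gle : ∀ y y', ‖y‖ < r → ‖y'‖ < r → g y' - g y ≤ 8 * ‖y' - y‖ := fun y y' hy hy' => by
    rcases le_total (g y') (g y) with hle | hle
    · have := norm_nonneg (y' - y); linarith
    · have h1 := decr y' (g y) (g y' - g y) hy' (hg y hy).1.le
        (by rw [add_sub_cancel]; exact (hg y' hy').1.le) (by linarith)
      rw [add_sub_cancel, (hg y' hy').2] at h1
      have h2 : ‖horiz ν (y' - y)‖ ≤ ‖y' - y‖ := norm_horiz_le hν1 _
      have h3 : ‖y' - y‖ ≤ 2 * r := (norm_sub_le _ _).trans (by linarith)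
      have h4 := (abs_le.1 (horizontal (P y) (horiz ν (y' - y)) (Pmem y hy) (h2.trans h3))).2
      have e : P y + horiz ν (y' - y) = x + horiz ν y' + g y • ν := by
        rw [hP, horiz_sub]; simp only; abel
      have e0 : w (P y) = 0 := (hg y hy).2
      rw [e, e0, sub_zero] at h4
      have h5 : 2 * m * ‖horiz ν (y' - y)‖ ≤ 2 * m * ‖y' - y‖ := by gcongr
      have h6 : m * (g y' - g y) ≤ m * (8 * ‖y' - y‖) := by linarith
      exact le_of_mul_le_mul_left h6 hm0
  have gabs : ∀ y y', ‖y‖ < r → ‖y'‖ < r → |g y' - g y| ≤ 8 * ‖y' - y‖ := fun y y' hy hy' => by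
    have h1 := gle y y' hy hy'
    have h2 := gle y' y hy' hy
    rw [norm_sub_rev] at h2
    exact abs_le.2 ⟨by linarith, h1⟩
  have step : ∀ y y', P y' - P y = horiz ν (y' - y) + (g y' - g y) • ν := fun y y' => by
    rw [horiz_sub, sub_smul]; simp only [hP]; abel
  have Plip : ∀ y y', ‖y‖ < r → ‖y'‖ < r → ‖P y' - P y‖ ≤ 9 * ‖y' - y‖ := fun y y' hy hy' => by
    rw [step]
    refine (norm_add_le _ _).trans ?_
    rw [norm_smul, hν1, mul_one, Real.norm_eq_abs]
    linarith [gabs y y' hy hy', norm_horiz_le hν1 (y' - y)]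
  -- the gradient of the graph function
  set a : Space N → ℝ := fun y => -⟪q (P y), ν⟫ with ha
  set G : Space N → Space N := fun y => (1 / a y) • horiz ν (q (P y)) with hG
  have a_ge : ∀ y, ‖y‖ < r → m / 2 ≤ a y := fun y hy => nearν _ (Pmem y hy)
  have a_pos : ∀ y, ‖y‖ < r → 0 < a y := fun y hy => by linarith [a_ge y hy]
  have expand : ∀ y y', ‖y‖ < r → ‖y'‖ < r →
      |g y' - g y - ⟪G y, y' - y⟫| ≤ 162 * D / m * ‖y' - y‖ ^ 2 := fun y y' hy hy' => by
    have h1 := h (P y) (P y' - P y)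
    have e0 : w (P y) = 0 := (hg y hy).2
    have e1 : w (P y') = 0 := (hg y' hy').2
    rw [add_sub_cancel, e0, e1, sub_zero, zero_sub, abs_neg] at h1
    have h2 : ⟪q (P y), P y' - P y⟫ = a y * (⟪G y, y' - y⟫ - (g y' - g y)) := by
      rw [step, inner_add_right, inner_smul_right, inner_horiz_comm, mul_sub, hG]
      simp only
      rw [inner_smul_left, conj_trivial, ← mul_assoc, mul_one_div_cancel (a_pos y hy).ne']
      simp only [ha]; ring
    rw [h2, abs_mul, abs_of_pos (a_pos y hy), abs_sub_comm] at h1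
    have h3 : ‖P y' - P y‖ ^ 2 ≤ (9 * ‖y' - y‖) ^ 2 := by gcongr; exact Plip y y' hy hy'
    have h4 : m / 2 * |g y' - g y - ⟪G y, y' - y⟫| ≤ D * (9 * ‖y' - y‖) ^ 2 :=
      calc _ ≤ a y * |g y' - g y - ⟪G y, y' - y⟫| := by gcongr; exact a_ge y hy
        _ ≤ D * ‖P y' - P y‖ ^ 2 := h1
        _ ≤ _ := by gcongr
    rw [div_mul_eq_mul_div, le_div_iff₀ hm0]
    linarith
  have Glip : ∀ y y', ‖y‖ < r → ‖y'‖ < r → ‖G y' - G y‖ ≤ 8 / m * (54 * D) * ‖y' - y‖ :=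
    fun y y' hy hy' => by
    have h1 : ‖q (P y') - q (P y)‖ ≤ 54 * D * ‖y' - y‖ := by
      have h2 := h.norm_slope_sub_le (P y) (P y' - P y)
      rw [add_sub_cancel] at h2
      have h3 : 6 * D * ‖P y' - P y‖ ≤ 6 * D * (9 * ‖y' - y‖) := by
        gcongr; exact Plip y y' hy hy'
      linarith
    rw [mul_assoc]
    refine norm_inv_smul_sub_le hm0 (a_ge y hy) (a_ge y' hy')
      ((norm_horiz_le hν1 _).trans (nearn _ (Pmem y hy))) ?_ ?_
    · rw [← horiz_sub]
      exact (norm_horiz_le hν1 _).trans h1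
    · have e2 : a y - a y' = ⟪q (P y') - q (P y), ν⟫ := by
        rw [inner_sub_left]; simp only [ha]; ring
      rw [e2]
      refine (abs_real_inner_le_norm _ _).trans ?_
      rwa [hν1, mul_one]
  refine ⟨x, ν, r, s, g, hν1, ?_, ⟨isCHolderOn_one_one (by positivity) expand Glip, fun y hy => ?_⟩,
    fun y hy => ?_⟩
  · simp only [cylinder, mem_ofPred_eq, sub_self, inner_zero_right, abs_zero]
    exact ⟨by simpa [horiz] using hr0, hs0⟩
  · exact (hg y (by simpa using hy)).1
  · obtain ⟨hy1, hy2⟩ := hy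
    set e := y - x with he
    have hg' := hg (horiz ν e) hy1
    rw [horiz_horiz hν1] at hg'
    have hye : y = x + horiz ν e + ⟪ν, e⟫ • ν := by rw [add_assoc, horiz_add_smul, he]; abel
    have dec := fun t τ => decr (horiz ν e) t τ hy1
    rw [horiz_horiz hν1] at dec
    change 0 < w y ↔ _
    constructor
    · intro hwy
      by_contra! hcon
      have := dec (g (horiz ν e)) (⟪ν, e⟫ - g (horiz ν e)) hg'.1.le
        (by rw [add_sub_cancel]; exact hy2.le) (by linarith)
      rw [add_sub_cancel, ← hye, hg'.2] at this
      have h2 : 0 ≤ m / 4 * (⟪ν, e⟫ - g (horiz ν e)) := mul_nonneg (by positivity) (by linarith)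
      linarith
    · intro hlt
      have := dec ⟪ν, e⟫ (g (horiz ν e) - ⟪ν, e⟫) hy2.le
        (by rw [add_sub_cancel]; exact hg'.1.le) (by linarith)
      rw [add_sub_cancel, ← hye, hg'.2] at this
      have h2 : 0 < m / 4 * (g (horiz ν e) - ⟪ν, e⟫) := mul_pos (by positivity) (by linarith)
      linarith

/-- Regular superlevel sets with compact boundary are of class `C^{1,1}`. -/
lemma HasQuadExpansion.mem_regularSets (h : HasQuadExpansion D w q)
    (hq : ∀ x, w x = 0 → q x ≠ 0) {R c : ℝ} (hc : c ≠ 0) (hw : ∀ x, R < ‖x‖ → w x = c) :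
    {x | 0 ≤ w x} ∈ RegularSets N 1 1 := by
  have hfr : frontier {x | 0 < w x} ⊆ {x | w x = 0} := fun x hx =>
    (frontier_lt_subset_eq continuous_const h.continuous hx).symm
  refine ⟨{x | 0 < w x}, ⟨isOpen_lt continuous_const h.continuous, fun x hx =>
    h.exists_graph (hfr hx) (hq x (hfr hx))⟩, ?_, (h.closure_pos hq).symm⟩
  refine (isCompact_closedBall (0 : Space N) R).of_isClosed_subset isClosed_frontier fun x hx => ?_
  by_contra hcon
  exact hc ((hw x (by simpa using hcon)).symm.trans (hfr hx))

end LevelSets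

/-! ### Translation of regular sets and jets; scalar second order terms -/

section Translation

variable {N ℓ : ℕ} {β : ℝ≥0}

lemma mem_cylinder_sub {c ν y v : Space N} {r s : ℝ} :
    y ∈ cylinder (c + v) ν r s ↔ y - v ∈ cylinder c ν r s := by
  simp only [cylinder, mem_ofPred_eq, sub_sub, add_comm v c]

lemma IsOpenOfClass.translate {U : Set (Space N)} (hU : IsOpenOfClass ℓ β U) (v : Space N) :
    IsOpenOfClass ℓ β ((fun z => z + v) '' U) := by
  refine ⟨(Homeomorph.addRight v).isOpenMap _ hU.1, fun x hx => ?_⟩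
  have hx' : x - v ∈ frontier U := by
    have h1 : x ∈ (Homeomorph.addRight v) '' frontier U := by
      rw [Homeomorph.image_frontier]; exact hx
    obtain ⟨z, hz, rfl⟩ := h1
    simpa using hz
  obtain ⟨c, ν, r, s, h, hν, hxc, hh, hU'⟩ := hU.2 _ hx'
  refine ⟨c + v, ν, r, s, h, hν, mem_cylinder_sub.2 hxc, hh, fun y hy => ?_⟩
  have := hU' _ (mem_cylinder_sub.1 hy)
  rw [sub_sub, add_comm v c] at this
  rw [← this, image_add_right]
  simp [sub_eq_add_neg]

lemma RegularSets.translate {E : Set (Space N)} (hE : E ∈ RegularSets N ℓ β) (v : Space N) :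
    (fun z => z + v) '' E ∈ RegularSets N ℓ β := by
  obtain ⟨U, hU, hc, rfl⟩ := hE
  refine ⟨_, hU.translate v, ?_, ?_⟩
  · have : frontier ((fun z => z + v) '' U) = (Homeomorph.addRight v) '' frontier U := by
      rw [Homeomorph.image_frontier]; rfl
    rw [this]
    exact hc.image (Homeomorph.addRight v).continuous
  · exact (Homeomorph.addRight v).image_closure U

lemma RegularSets.isClosed {E : Set (Space N)} (hE : E ∈ RegularSets N ℓ β) : IsClosed E := by
  obtain ⟨U, -, -, rfl⟩ := hE
  exact isClosed_closure

lemma IsSuperjet.translate {E : Set (Space N)} {x p : Space N} {X : Space N →L[ℝ] Space N}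
    (h : IsSuperjet E x p X) (v : Space N) :
    IsSuperjet ((fun z => z + v) '' E) (x + v) p X := by
  obtain ⟨hx, hX, hj⟩ := h
  refine ⟨?_, hX, fun δ hδ => ?_⟩
  · have : frontier ((fun z => z + v) '' E) = (Homeomorph.addRight v) '' frontier E := by
      rw [Homeomorph.image_frontier]; rfl
    rw [this]
    exact ⟨x, hx, rfl⟩
  · have ht : Tendsto (fun y : Space N => y - v) (𝓝 (x + v)) (𝓝 x) := by
      have : Continuous fun y : Space N => y - v := by fun_prop
      simpa using this.tendsto (x + v)
    filter_upwards [ht.eventually (hj δ hδ)] with y hy hyE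
    have h1 : y - v ∈ E := by
      rw [image_add_right] at hyE
      simpa [sub_eq_add_neg] using hyE
    have h2 := hy h1
    rwa [sub_sub, add_comm v x] at h2

lemma IsSubjet.translate {E : Set (Space N)} {x p : Space N} {X : Space N →L[ℝ] Space N}
    (h : IsSubjet E x p X) (v : Space N) :
    IsSubjet ((fun z => z + v) '' E) (x + v) p X := by
  have h1 := IsSuperjet.translate h v
  rwa [image_compl_eq (f := fun z => z + v) (Homeomorph.addRight v).bijective] at h1

/-- Multiples of the identity, as operators on `ℝ^N`. -/
abbrev scalarOp (N : ℕ) (A : ℝ) : Space N →L[ℝ] Space N := A • ContinuousLinearMap.id ℝ (Space N)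

lemma scalarOp_isSymmetric (A : ℝ) : (scalarOp N A : Space N →ₗ[ℝ] Space N).IsSymmetric :=
  fun x y => by simp [inner_smul_left, inner_smul_right]

lemma neg_scalarOp (A : ℝ) : -scalarOp N A = scalarOp N (-A) := (neg_smul _ _).symm

/-- A wider paraboloid imposes less on the set. This lets one large scalar operator fit both the
interposed set and the test functions. -/
lemma IsSuperjet.mono_scalarOp {E : Set (Space N)} {x p : Space N} {A B : ℝ}
    (h : IsSuperjet E x p (scalarOp N A)) (hAB : A ≤ B) : IsSuperjet E x p (scalarOp N B) := by
  refine ⟨h.1, scalarOp_isSymmetric B, fun δ hδ => ?_⟩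
  filter_upwards [h.2.2 δ hδ] with y hy hyE
  have h1 := hy hyE
  simp only [scalarOp, smul_apply, ContinuousLinearMap.id_apply,
    inner_smul_left, conj_trivial, real_inner_self_eq_norm_sq] at h1 ⊢
  have : A * ‖y - x‖ ^ 2 ≤ B * ‖y - x‖ ^ 2 := by gcongr
  linarith

lemma IsSubjet.mono_scalarOp {E : Set (Space N)} {x p : Space N} {A B : ℝ}
    (h : IsSubjet E x p (scalarOp N B)) (hAB : A ≤ B) : IsSubjet E x p (scalarOp N A) := by
  unfold IsSubjet at h ⊢
  rw [neg_scalarOp] at h ⊢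
  exact h.mono_scalarOp (by linarith)

end Translation

/-! ### The interposed set and its jets -/

section InterposedSet

variable {N : ℕ}

/-- The interposed regular set between superlevel sets of a semiconvex and a larger semiconcave
function, with its second order jets at the origin. -/
lemma exists_interposed_set {C : ℝ} (hC : 0 < C) {U V : Space N → ℝ} {L : ℝ≥0}
    (hUL : LipschitzWith L U) (hVc : Continuous V) {R cU cV : ℝ} {p : Space N} (hp : p ≠ 0)
    (hUR : ∀ x, R < ‖x‖ → U x = cU) (hVR : ∀ x, R < ‖x‖ → V x = cV)
    (hU : LowerSupported C U) (hV : UpperSupported C V) (hUV : ∀ x, U x ≤ V x)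
    (htouch : ∀ x, U x = V x → ∀ k, U (x + k) ≤ U x + ⟪p, k⟫ + C * ‖k‖ ^ 2)
    (hU0 : U 0 = 0) (hV0 : V 0 = 0) :
    ∃ S ∈ RegularSets N 1 1, {x | 0 ≤ U x} ⊆ S ∧ interior S ⊆ {x | 0 < V x} ∧
      0 ∈ frontier S ∧ ∃ A₀ : ℝ, ∀ A ≥ A₀, IsSuperjet S 0 p (scalarOp N A) ∧
        IsSubjet S 0 p (scalarOp N (-A)) := by
  obtain ⟨D, w, q, hw, hUw, hwV, hreg, hq, R', c, hc, hR'⟩ :=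
    exists_regular_interposition hC hUL hVc hp hUR hVR hU hV hUV htouch
  have hw0 : w 0 = 0 := le_antisymm (hV0 ▸ hwV 0) (hU0 ▸ hUw 0)
  have hq0 : q 0 = p := hq 0 (by rw [hU0, hV0])
  have hfr : (0 : Space N) ∈ frontier {x | 0 ≤ w x} := hw.mem_frontier hw0 (hq0 ▸ hp)
  have hexp : ∀ k, |w k - ⟪p, k⟫| ≤ D * ‖k‖ ^ 2 := fun k => by
    have := hw 0 k
    rwa [zero_add, hw0, sub_zero, hq0] at this
  refine ⟨{x | 0 ≤ w x}, hw.mem_regularSets hreg hc hR', fun x hx => le_trans hx (hUw x),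
    fun x hx => lt_of_lt_of_le (hw.interior_nonneg hreg hx) (hwV x), hfr, 2 * D, fun A hA => ?_⟩
  have hA' : ∀ k : Space N, 2 * (D * ‖k‖ ^ 2) ≤ A * ‖k‖ ^ 2 := fun k => by
    have : 2 * D * ‖k‖ ^ 2 ≤ A * ‖k‖ ^ 2 := by gcongr
    linarith
  refine ⟨⟨hfr, scalarOp_isSymmetric A, fun δ hδ => Eventually.of_forall fun x hx => ?_⟩, ?_⟩
  · have h1 := (abs_le.1 (hexp x)).2
    have h2 : 0 ≤ w x := hx
    have h3 : 0 ≤ δ * ‖x‖ ^ 2 := by positivity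
    simp only [scalarOp, smul_apply, ContinuousLinearMap.id_apply, sub_zero,
      inner_smul_left, conj_trivial, real_inner_self_eq_norm_sq]
    rw [real_inner_comm]
    linarith [hA' x]
  · rw [IsSubjet, neg_scalarOp, neg_neg]
    refine ⟨by rwa [frontier_compl], scalarOp_isSymmetric A,
      fun δ hδ => Eventually.of_forall fun x hx => ?_⟩
    have h1 := (abs_le.1 (hexp x)).1
    have h2 : w x < 0 := not_le.1 hx
    have h3 : 0 ≤ δ * ‖x‖ ^ 2 := by positivity
    simp only [scalarOp, smul_apply, ContinuousLinearMap.id_apply, sub_zero,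
      inner_smul_left, conj_trivial, real_inner_self_eq_norm_sq]
    rw [inner_neg_right, real_inner_comm]
    linarith [hA' x]

end InterposedSet

/-! ### Test functions and the comparison of time slopes -/

section TestFunctions

variable {N ℓ : ℕ} {β : ℝ≥0}

/-- `Θ` touches `u` from above at `z` on the time interval `[a, b]`, and is itself touched from
above at `z` by a paraboloid with slope `(p, c)` and opening `C`. -/
structure IsUpperTest (T : ℝ) (u Θ : Space N × ℝ → ℝ) (z : Space N × ℝ) (p : Space N)
    (c C a b : ℝ) : Prop where
  a_nonneg : 0 ≤ a
  b_le : b ≤ T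
  mem : z.2 ∈ Ioo a b
  cont : Continuous Θ
  const : ConstOutsideCompact Θ (Icc a b)
  le : ∀ x, ∀ t ∈ Icc a b, u (x, t) ≤ Θ (x, t)
  eq : u z = Θ z
  quad : ∀ x, ∀ t ∈ Icc a b,
    Θ (x, t) ≤ Θ z + ⟪p, x - z.1⟫ + c * (t - z.2) + C * (‖x - z.1‖ ^ 2 + (t - z.2) ^ 2)

/-- The reference paraboloid. -/
noncomputable def paraboloid (p x₀ : Space N) (C K : ℝ) (y : Space N) : ℝ :=
  K + ⟪p, y - x₀⟫ + C * ‖y - x₀‖ ^ 2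

lemma hasQuadExpansion_paraboloid (p x₀ : Space N) (C K : ℝ) :
    HasQuadExpansion |C| (paraboloid p x₀ C K) (fun y => p + (2 * C) • (y - x₀)) := fun y k => by
  have h1 : ‖y + k - x₀‖ ^ 2 = ‖y - x₀‖ ^ 2 + 2 * ⟪y - x₀, k⟫ + ‖k‖ ^ 2 := by
    rw [add_sub_right_comm, norm_add_sq_real]
  have h2 : paraboloid p x₀ C K (y + k) - paraboloid p x₀ C K y -
      ⟪p + (2 * C) • (y - x₀), k⟫ = C * ‖k‖ ^ 2 := by
    simp only [paraboloid]
    rw [h1, add_sub_right_comm y k, inner_add_right, inner_add_left, inner_smul_left, conj_trivial]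
    ring
  rw [h2, abs_mul, abs_of_nonneg (by positivity : 0 ≤ ‖k‖ ^ 2)]

lemma gradient_paraboloid (p x₀ : Space N) (C K : ℝ) (y : Space N) :
    gradient (paraboloid p x₀ C K) y = p + (2 * C) • (y - x₀) :=
  HasGradientAt.gradient (hasGradientAt_iff_hasFDerivAt.2
    ((hasQuadExpansion_paraboloid p x₀ C K).hasFDerivAt y))

lemma spaceGrad_of_eventuallyEq {φ : Space N × ℝ → ℝ} {z : Space N × ℝ} {p x₀ : Space N} {C K : ℝ}
    (h : (fun y => φ (y, z.2)) =ᶠ[𝓝 z.1] paraboloid p x₀ C K) :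
    spaceGrad φ z = p + (2 * C) • (z.1 - x₀) := by
  rw [spaceGrad, ← gradient_paraboloid p x₀ C K]
  exact h.gradient_eq

lemma spaceHess_of_eventuallyEq {φ : Space N × ℝ → ℝ} {z : Space N × ℝ} {p x₀ : Space N} {C K : ℝ}
    (h : (fun y => φ (y, z.2)) =ᶠ[𝓝 z.1] paraboloid p x₀ C K) :
    spaceHess φ z = scalarOp N (2 * C) := by
  have h1 : (fun y => gradient (fun y' => φ (y', z.2)) y) =ᶠ[𝓝 z.1]
      fun y => p + (2 * C) • (y - x₀) := by
    filter_upwards [h.eventuallyEq_nhds] with y hy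
    rw [← gradient_paraboloid p x₀ C K]
    exact hy.gradient_eq
  rw [spaceHess, h1.fderiv_eq]
  have h2 : HasFDerivAt (fun y : Space N => p + (2 * C) • (y - x₀)) (scalarOp N (2 * C)) z.1 :=
    (((hasFDerivAt_id z.1).sub_const x₀).const_smul (2 * C)).const_add p
  exact h2.fderiv

lemma spaceGrad_neg (φ : Space N × ℝ → ℝ) (z : Space N × ℝ) :
    spaceGrad (fun w => -φ w) z = -spaceGrad φ z := by
  simp only [spaceGrad, gradient]
  rw [fderiv_fun_neg, map_neg]

lemma spaceHess_neg (φ : Space N × ℝ → ℝ) (z : Space N × ℝ) :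
    spaceHess (fun w => -φ w) z = -spaceHess φ z := by
  simp only [spaceHess, gradient]
  simp only [fderiv_fun_neg, map_neg]

lemma timeDeriv_neg (φ : Space N × ℝ → ℝ) (z : Space N × ℝ) :
    timeDeriv (fun w => -φ w) z = -timeDeriv φ z := by
  simp only [timeDeriv, deriv.fun_neg]

lemma ConstOutsideCompact.neg {φ : Space N × ℝ → ℝ} {A : Set ℝ} (h : ConstOutsideCompact φ A) :
    ConstOutsideCompact (fun w => -φ w) A := by
  obtain ⟨K, hK, hc⟩ := h
  refine ⟨K, hK, fun t ht => ?_⟩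
  obtain ⟨c, hc⟩ := hc t ht
  exact ⟨-c, fun x hx => congrArg Neg.neg (hc x hx)⟩

lemma IsAdmissible.neg {κ : Space N → Set (Space N) → ℝ} {T a b : ℝ}
    {φ : Space N × ℝ → ℝ} {z : Space N × ℝ} (h : IsAdmissible κ T a b φ z) :
    IsAdmissible κ T a b (fun w => -φ w) z := by
  obtain ⟨h1, h2, h3, h4, h5, h6, h7⟩ := h
  refine ⟨h1, h2, h3, h4.neg, h5.neg, h6.neg, fun h0 => ?_⟩
  rw [spaceGrad_neg, neg_eq_zero] at h0
  obtain ⟨f, η, hf, hη, hb⟩ := h7 h0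
  refine ⟨f, η, hf, hη, fun x t ht => ?_⟩
  rw [timeDeriv_neg, ← abs_neg]
  convert hb x t ht using 2
  ring

/-- A test function which is a paraboloid near `z` and whose superlevel set at `z` is only slightly
larger than that of `Θ`. -/
lemma IsUpperTest.exists_admissible {T : ℝ} {u Θ : Space N × ℝ → ℝ} {z : Space N × ℝ} {p : Space N}
    {c C a b : ℝ} (h : IsUpperTest T u Θ z p c C a b) (hp : p ≠ 0)
    (κ : Space N → Set (Space N) → ℝ) {r : ℝ} (hr : 0 < r) :
    ∃ φ : Space N × ℝ → ℝ, IsAdmissible κ T a b φ z ∧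
      (∀ x, ∀ t ∈ Icc a b, u (x, t) ≤ φ (x, t)) ∧ φ z = u z ∧
      spaceGrad φ z = p ∧ spaceHess φ z = scalarOp N (2 * C) ∧ timeDeriv φ z = c ∧
      ∀ y, φ z ≤ φ (y, z.2) → Θ z ≤ Θ (y, z.2) ∨
        (‖y - z.1‖ < r ∧ 0 ≤ ⟪p, y - z.1⟫ + C * ‖y - z.1‖ ^ 2) := by
  obtain ⟨χ, hχ, hχ0, hχ1, hχT, hχO⟩ := exists_cutoff (t := Metric.closedBall z.1 (r / 2))
    (O := Metric.ball z.1 r) Metric.isClosed_closedBall Metric.isOpen_ball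
    (Metric.closedBall_subset_ball (by linarith))
  set Q : Space N × ℝ → ℝ := fun w =>
    Θ z + ⟪p, w.1 - z.1⟫ + c * (w.2 - z.2) + C * (‖w.1 - z.1‖ ^ 2 + (w.2 - z.2) ^ 2) with hQ
  -- A spatial interpolation from `Θ` to its upper paraboloid `Q`. Since `u ≤ Θ ≤ Q`, it stays above
  -- `u`; it is a quadratic polynomial near `z`, hence of class `C²` there even though `Θ` need not
  -- be.
  set φ : Space N × ℝ → ℝ := fun w => Θ w + χ w.1 * (Q w - Θ w) with hφ
  have hQd : ContDiff ℝ 2 Q := by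
    have h1 : ContDiff ℝ 2 fun w : Space N × ℝ => w.1 - z.1 := contDiff_fst.sub contDiff_const
    have h2 : ContDiff ℝ 2 fun w : Space N × ℝ => w.2 - z.2 := contDiff_snd.sub contDiff_const
    exact ((contDiff_const.add (contDiff_const.inner ℝ h1)).add (contDiff_const.mul h2)).add
      (contDiff_const.mul ((h1.norm_sq ℝ).add (h2.pow 2)))
  have hφQ : ∀ y t, dist y z.1 ≤ r / 2 → φ (y, t) = Q (y, t) := fun y t hy => by
    simp [hφ, hχT y hy]
  have hnear : ∀ᶠ y in 𝓝 z.1, dist y z.1 ≤ r / 2 := Metric.closedBall_mem_nhds _ (by linarith)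
  have hφz : φ z = Θ z := by
    have : φ (z.1, z.2) = Q (z.1, z.2) := hφQ _ _ (by simp; linarith)
    simpa [hQ] using this
  have hsp : (fun y => φ (y, z.2)) =ᶠ[𝓝 z.1] paraboloid p z.1 C (Θ z) := by
    filter_upwards [hnear] with y hy
    rw [hφQ y _ hy]
    simp [hQ, paraboloid]
  have hgrad : spaceGrad φ z = p := by
    rw [spaceGrad_of_eventuallyEq hsp]; simp
  have hQc : Continuous Q := hQd.continuous
  have hφc : Continuous φ := by
    have := h.cont
    have := hχ.continuous
    fun_prop
  refine ⟨φ, ⟨h.a_nonneg, h.b_le, h.mem, hφc.continuousOn, ?_, ?_, fun h0 => ?_⟩, fun x t ht => ?_,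
    hφz.trans h.eq.symm, hgrad, spaceHess_of_eventuallyEq hsp, ?_, fun y hy => ?_⟩
  · refine hQd.contDiffAt.congr_of_eventuallyEq ?_
    have : ∀ᶠ w in 𝓝 z, dist w.1 z.1 ≤ r / 2 := continuous_fst.tendsto z |>.eventually hnear
    filter_upwards [this] with w hw using hφQ w.1 w.2 hw
  · obtain ⟨K, hK, hc⟩ := h.const
    refine ⟨K ∪ Metric.closedBall z.1 r, hK.union (isCompact_closedBall _ _), fun t ht => ?_⟩
    obtain ⟨k, hk⟩ := hc t ht
    refine ⟨k, fun x hx => ?_⟩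
    rw [mem_union, not_or] at hx
    simp [hφ, hk x hx.1, hχO x (fun h => hx.2 (Metric.ball_subset_closedBall h))]
  · exact absurd (hgrad.symm.trans h0) hp
  · have h1 := h.le x t ht
    have h2 : 0 ≤ Q (x, t) - Θ (x, t) := sub_nonneg.2 (h.quad x t ht)
    have h3 := mul_nonneg (hχ0 x) h2
    simp only [hφ]; linarith
  · have h1 : (fun s => φ (z.1, s)) = fun s => Θ z + c * (s - z.2) + C * (s - z.2) ^ 2 := by
      funext s
      rw [hφQ _ _ (by simp; linarith)]
      simp [hQ]
    rw [timeDeriv, h1]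
    have h2 : HasDerivAt (fun s => Θ z + c * (s - z.2) + C * (s - z.2) ^ 2)
        (c * 1 + C * (2 * (z.2 - z.2) ^ 1 * 1)) z.2 := by
      have h3 := (hasDerivAt_id z.2).sub_const z.2
      exact ((h3.const_mul c).const_add (Θ z)).add ((h3.pow 2).const_mul C)
    rw [h2.deriv]; simp
  · by_contra! hcon
    obtain ⟨h1, h2⟩ := hcon
    rw [hφz] at hy
    by_cases hyr : ‖y - z.1‖ < r
    · have h3 := h2 hyr
      have h4 : Q (y, z.2) < Θ z := by simp only [hQ, sub_self]; linarith
      -- A convex combination of `Θ` and `Q` can reach `Θ z` only if one of the two does, which is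
      -- why the superlevel set grows only inside the small ball.
      have h5 : φ (y, z.2) = (1 - χ y) * Θ (y, z.2) + χ y * Q (y, z.2) := by simp only [hφ]; ring
      have h6 : (1 - χ y) * Θ (y, z.2) ≤ (1 - χ y) * Θ z := by
        have := hχ1 y; gcongr
      have h7 : χ y * Q (y, z.2) ≤ χ y * Θ z := by
        have := hχ0 y; gcongr
      rcases (hχ0 y).eq_or_lt with h8 | h8
      · rw [h5, ← h8] at hy
        linarith
      · have : χ y * Q (y, z.2) < χ y * Θ z := by gcongr
        linarith
    · have : φ (y, z.2) = Θ (y, z.2) := by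
        simp [hφ, hχO y (by simpa [dist_eq_norm] using hyr)]
      linarith

/-- The viscosity inequality for a subsolution at a noncritical point, in terms of a single
competitor of the lower curvature. -/
lemma IsUpperTest.sub_ineq {κ : Space N → Set (Space N) → ℝ} {T : ℝ} {u Θ : Space N × ℝ → ℝ}
    (hu : IsSubsolution ℓ β κ T u) {z : Space N × ℝ} {p : Space N} {c C a b : ℝ}
    (h : IsUpperTest T u Θ z p c C a b) (hp : p ≠ 0) {E : Set (Space N)}
    (hE : E ∈ RegularSets N ℓ β) (hsub : {y | Θ z ≤ Θ (y, z.2)} ⊆ E)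
    (hjet : IsSubjet E z.1 p (scalarOp N (2 * C + 2))) : c + ‖p‖ * κ z.1 E ≤ 0 := by
  obtain ⟨r, hr, hball⟩ := Metric.eventually_nhds_iff.1 (hjet.2.2 1 one_pos)
  obtain ⟨φ, hadm, hle, hφz, hg, hH, ht, hlev⟩ := h.exists_admissible hp κ hr
  have hmax : IsMaxOn (fun w => u w - φ w) (univ ×ˢ Icc a b) z := fun w hw => by
    have := hle w.1 w.2 hw.2
    simp only [mem_ofPred_eq, hφz, sub_self]
    linarith
  have key := (hu.2.2 a b φ z hadm hmax).2 (by rwa [hg])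
  rw [hg, hH, ht] at key
  have hmem : z.1 ∈ E := by
    have h1 : z.1 ∈ frontier E := by simpa [frontier_compl] using hjet.1
    exact (RegularSets.isClosed hE).frontier_subset h1
  have hlow : (κ z.1 E : EReal) ≤ lowerCurvature ℓ β κ z.1 p (scalarOp N (2 * C))
      {y | φ z ≤ φ (y, z.2)} := by
    -- The excess `2` in the second order term of `E` beats the tolerance `δ = 1`: a point outside
    -- `E` near `z.1` has `⟪p, y - z.1⟫ ≤ -(C + 1/2)‖y - z.1‖²`, whereas the added points have at
    -- least `-C‖y - z.1‖²`. So the enlarged superlevel set remains inside `E`.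
    refine le_sSup ⟨E, hE, fun y hy => ?_, hjet.mono_scalarOp (by linarith), rfl⟩
    rcases hlev y hy with h1 | ⟨h1, h2⟩
    · exact hsub h1
    · by_contra hyE
      have h3 := hball (by rwa [dist_eq_norm]) hyE
      simp only [scalarOp, neg_apply, smul_apply,
        ContinuousLinearMap.id_apply, inner_neg_left, inner_neg_right, inner_smul_left,
        conj_trivial, real_inner_self_eq_norm_sq] at h3
      rw [real_inner_comm] at h3
      have h4 : ‖y - z.1‖ ^ 2 ≤ 0 := by nlinarith
      have h5 : y - z.1 = 0 := by
        rw [← norm_eq_zero]; exact pow_eq_zero_iff two_ne_zero |>.1 (le_antisymm h4 (by positivity))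
      exact hyE (by rwa [sub_eq_zero.1 h5])
  have h1 : ((c + ‖p‖ * κ z.1 E : ℝ) : EReal) ≤ 0 := by
    refine le_trans ?_ key
    rw [EReal.coe_add, EReal.coe_mul]
    gcongr
  exact_mod_cast h1

/-- The viscosity inequality for a supersolution at a noncritical point. -/
lemma IsUpperTest.super_ineq {κ : Space N → Set (Space N) → ℝ} {T : ℝ} {v Θ : Space N × ℝ → ℝ}
    (hv : IsSupersolution ℓ β κ T v) {z : Space N × ℝ} {p : Space N} {c C a b : ℝ}
    (h : IsUpperTest T (fun w => -v w) (fun w => -Θ w) z (-p) (-c) C a b) (hp : p ≠ 0)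
    {E : Set (Space N)} (hE : E ∈ RegularSets N ℓ β)
    (hsub : interior E ⊆ {y | Θ z < Θ (y, z.2)})
    (hjet : IsSuperjet E z.1 p (scalarOp N (-(2 * C + 2)))) : 0 ≤ c + ‖p‖ * κ z.1 E := by
  obtain ⟨r, hr, hball⟩ := Metric.eventually_nhds_iff.1 (hjet.2.2 1 one_pos)
  obtain ⟨φ, hadm, hle, hφz, hg, hH, ht, hlev⟩ := h.exists_admissible (neg_ne_zero.2 hp) κ hr
  have hmin : IsMinOn (fun w => v w - -φ w) (univ ×ˢ Icc a b) z := fun w hw => by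
    have := hle w.1 w.2 hw.2
    simp only [mem_ofPred_eq, hφz]
    simp only [Prod.mk.eta] at this
    linarith
  have hadm' := hadm.neg
  have key := (hv.2.2 a b _ z hadm' hmin).2 (by rw [spaceGrad_neg, hg, neg_neg]; exact hp)
  rw [spaceGrad_neg, spaceHess_neg, timeDeriv_neg, hg, hH, ht, neg_neg, neg_neg,
    neg_scalarOp] at key
  have hup : upperCurvature ℓ β κ z.1 p (scalarOp N (-(2 * C)))
      {y | -φ z < -φ (y, z.2)} ≤ (κ z.1 E : EReal) := by
    refine sInf_le ⟨E, hE, fun y hy => ?_, hjet.mono_scalarOp (by linarith), rfl⟩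
    by_contra hcon
    simp only [mem_ofPred_eq, neg_lt_neg_iff, not_lt] at hcon
    rcases hlev y hcon with h1 | ⟨h1, h2⟩
    · exact absurd (hsub hy) (by simp only [mem_ofPred_eq, not_lt]; linarith)
    · have h3 := hball (by rwa [dist_eq_norm]) (interior_subset hy)
      rw [inner_neg_left] at h2
      simp only [scalarOp, smul_apply, ContinuousLinearMap.id_apply, inner_smul_left,
        conj_trivial, real_inner_self_eq_norm_sq] at h3
      rw [real_inner_comm] at h3
      have h4 : ‖y - z.1‖ ^ 2 ≤ 0 := by nlinarith
      have h5 : y - z.1 = 0 := by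
        rw [← norm_eq_zero]; exact pow_eq_zero_iff two_ne_zero |>.1 (le_antisymm h4 (by positivity))
      rw [sub_eq_zero.1 h5] at hy
      exact hjet.1.2 hy
  have h1 : 0 ≤ ((c + ‖p‖ * κ z.1 E : ℝ) : EReal) := by
    refine le_trans key ?_
    rw [EReal.coe_add, EReal.coe_mul]
    gcongr
  exact_mod_cast h1

/-- **Comparison of time slopes at noncritical points.** -/
theorem slope_le_of_firstOrder {κ : Space N → Set (Space N) → ℝ} (hκ : IsCurvature ℓ β κ)
    (hFO : FirstOrderCondition ℓ β κ) {T : ℝ} {u v Θ Ξ : Space N × ℝ → ℝ}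
    (hu : IsSubsolution ℓ β κ T u) (hv : IsSupersolution ℓ β κ T v)
    {z z' : Space N × ℝ} {p : Space N} (hp : p ≠ 0) {c c' C a b a' b' : ℝ} (hC : 0 < C)
    (hΘ : IsUpperTest T u Θ z p c C a b)
    (hΞ : IsUpperTest T (fun w => -v w) (fun w => -Ξ w) z' (-p) (-c') C a' b')
    {L : ℝ≥0} (hL : LipschitzWith L fun ξ => Θ (z.1 + ξ, z.2) - Θ z)
    (hU : LowerSupported C fun ξ => Θ (z.1 + ξ, z.2) - Θ z)
    (hV : UpperSupported C fun ξ => Ξ (z'.1 + ξ, z'.2) - Ξ z')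
    (hUV : ∀ ξ, Θ (z.1 + ξ, z.2) - Θ z ≤ Ξ (z'.1 + ξ, z'.2) - Ξ z')
    (htouch : ∀ ξ, Θ (z.1 + ξ, z.2) - Θ z = Ξ (z'.1 + ξ, z'.2) - Ξ z' → ∀ k,
      Θ (z.1 + (ξ + k), z.2) ≤ Θ (z.1 + ξ, z.2) + ⟪p, k⟫ + C * ‖k‖ ^ 2) : c ≤ c' := by
  have hpn : 0 < ‖p‖ := norm_pos_iff.2 hp
  have hconst : ∀ {Φ : Space N × ℝ → ℝ} {A : Set ℝ} {w : Space N × ℝ}, ConstOutsideCompact Φ A →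
      w.2 ∈ A → ∃ R k, ∀ ξ, R < ‖ξ‖ → Φ (w.1 + ξ, w.2) - Φ w = k := by
    intro Φ A w ⟨K, hK, hk⟩ hw
    obtain ⟨R, hR⟩ := hK.isBounded.subset_closedBall w.1
    obtain ⟨k, hk⟩ := hk _ hw
    refine ⟨R, k - Φ w, fun ξ hξ => ?_⟩
    rw [hk _ fun hmem => not_lt.2 (by simpa [dist_eq_norm] using hR hmem) hξ]
  obtain ⟨R₁, k₁, h₁⟩ := hconst hΘ.const (Ioo_subset_Icc_self hΘ.mem)
  obtain ⟨R₂, k₂, h₂⟩ := hconst hΞ.const (Ioo_subset_Icc_self hΞ.mem)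
  have hVc : Continuous fun ξ => Ξ (z'.1 + ξ, z'.2) - Ξ z' := by
    have h1 : Continuous Ξ := by simpa only [neg_neg] using hΞ.cont.fun_neg
    have : Continuous fun ξ : Space N => (z'.1 + ξ, z'.2) := by fun_prop
    exact (h1.comp this).sub continuous_const
  obtain ⟨S, hS, hUS, hSV, h0S, A₀, hA₀⟩ := exists_interposed_set hC hL hVc hp
    (R := max R₁ R₂) (fun x hx => h₁ x (lt_of_le_of_lt (le_max_left _ _) hx))
    (cV := -k₂) (fun x hx => by
      have := h₂ x (lt_of_le_of_lt (le_max_right _ _) hx)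
      linarith) hU hV hUV
    (fun x hx k => by linarith [htouch x hx k]) (by simp) (by simp)
  -- Large enough for the paraboloids bounding the interposed set and for the slack required of the
  -- competitors.
  set A := max A₀ (2 * C + 2) with hA
  obtain ⟨hsup, hsub⟩ := hA₀ A (le_max_left _ _)
  have hA2 : 2 * C + 2 ≤ A := le_max_right _ _
  -- The first order condition is used with the mismatched operators `A` and `-A`, the only ones
  -- known to be jets of `S`. It remains to squeeze the common value between `-c' / ‖p‖` and `-c /
  -- ‖p‖`.
  have hfo := hFO S hS 0 h0S p hp _ _ hsup hsub
  have hlow : lowerCurvature ℓ β κ 0 p (scalarOp N A) S ≤ ((-c / ‖p‖ : ℝ) : EReal) := by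
    refine sSup_le ?_
    rintro _ ⟨E, hE, hSE, hj, rfl⟩
    have h3 : κ 0 E = κ z.1 ((fun y => y + z.1) '' E) := by
      have h4 : (0 : Space N) ∈ frontier E := by simpa [frontier_compl] using hj.1
      simpa only [zero_add] using hκ.translation E hE 0 h4 z.1
    have h5 := hΘ.sub_ineq hu hp (RegularSets.translate hE z.1) (fun y hy => ?_)
      (by simpa only [zero_add] using (hj.mono_scalarOp hA2).translate z.1)
    · rw [← h3] at h5
      rw [EReal.coe_le_coe_iff, le_div_iff₀ hpn]
      linarith
    · refine ⟨y - z.1, hSE (hUS ?_), by simp⟩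
      simp only [mem_ofPred_eq, add_sub_cancel]
      exact sub_nonneg.2 hy
  have hupp : ((-c' / ‖p‖ : ℝ) : EReal) ≤ upperCurvature ℓ β κ 0 p (scalarOp N (-A)) S := by
    refine le_sInf ?_
    rintro _ ⟨E, hE, hSE, hj, rfl⟩
    have h3 : κ 0 E = κ z'.1 ((fun y => y + z'.1) '' E) := by
      simpa only [zero_add] using hκ.translation E hE 0 hj.1 z'.1
    have h5 := hΞ.super_ineq hv hp (RegularSets.translate hE z'.1) (fun y hy => ?_)
      (by simpa only [zero_add] using
        (hj.mono_scalarOp (by linarith : -A ≤ -(2 * C + 2))).translate z'.1)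
    · rw [← h3] at h5
      rw [EReal.coe_le_coe_iff, div_le_iff₀ hpn]
      linarith
    · have h6 : y ∈ (Homeomorph.addRight z'.1) '' interior E := by
        rw [Homeomorph.image_interior]; exact hy
      obtain ⟨x, hx, rfl⟩ := h6
      have h7 : x ∈ interior S := interior_mono hSE (by simpa using hx)
      have h8 := hSV h7
      simp only [mem_ofPred_eq] at h8
      simp only [Homeomorph.coe_addRight, mem_ofPred_eq, add_comm x]
      linarith
  rw [hfo] at hlow
  have h9 := EReal.coe_le_coe_iff.1 (hupp.trans hlow)
  rw [div_le_div_iff_of_pos_right hpn] at h9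
  linarith

end TestFunctions

/-! ### Curvatures of balls: finiteness and monotonicity of `c̄` -/

section Balls

variable {N ℓ : ℕ} {β : ℝ≥0}

/-- Smooth functions are of class `C^{ℓ,β}` on smaller balls. -/
lemma isCHolderOn_of_contDiffAt (hβ : β ≤ 1) {h : Space N → ℝ} {R r : ℝ} (hrR : r < R)
    (hh : ∀ y, ‖y‖ < R → ContDiffAt ℝ ∞ h y) : IsCHolderOn ℓ β h (Metric.ball 0 r) := by
  have hd : ∀ y, ‖y‖ < R → ContDiffAt ℝ 1 (iteratedFDeriv ℝ ℓ h) y := fun y hy =>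
    (hh y hy).iteratedFDeriv_right (by norm_cast; exact le_top)
  have hcont : ContinuousOn (fun y => ‖fderiv ℝ (iteratedFDeriv ℝ ℓ h) y‖)
      (Metric.closedBall 0 r) := fun y hy =>
    ((hd y (lt_of_le_of_lt (by simpa using hy) hrR)).continuousAt_fderiv
      (by norm_num)).norm.continuousWithinAt
  obtain ⟨C, hC⟩ := (isCompact_closedBall (0 : Space N) r).bddAbove_image hcont
  have hlip : LipschitzOnWith (Real.toNNReal C) (iteratedFDeriv ℝ ℓ h) (Metric.ball 0 r) := by
    refine (convex_ball (0 : Space N) r).lipschitzOnWith_of_nnnorm_fderiv_le (𝕜 := ℝ)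
      (fun y hy => ?_) fun y hy => ?_
    · exact (hd y (lt_trans (by simpa using hy) hrR)).differentiableAt (by norm_num)
    · rw [← norm_toNNReal]
      refine Real.toNNReal_le_toNNReal ?_
      exact hC ⟨y, Metric.ball_subset_closedBall hy, rfl⟩
  refine ⟨fun y hy => ((hh y (lt_trans (by simpa using hy) hrR)).of_le
    (by norm_cast; exact le_top)).contDiffWithinAt, _,
    hlip.holderOnWith.of_le (D := Real.toNNReal (2 * r)) (fun x hx y hy => ?_) hβ⟩
  rw [edist_dist]
  refine ENNReal.ofReal_le_ofReal ?_
  have h1 := dist_triangle_right x y 0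
  have h2 := Metric.mem_ball.1 hx
  have h3 := Metric.mem_ball.1 hy
  linarith

/-- Cylinders are open. -/
lemma isOpen_cylinder (c ν : Space N) (r s : ℝ) : IsOpen (cylinder c ν r s) := by
  have h1 : Continuous fun y : Space N => ‖horiz ν (y - c)‖ := by unfold horiz; fun_prop
  have h2 : Continuous fun y : Space N => |⟪ν, y - c⟫| := by fun_prop
  exact (isOpen_lt h1 continuous_const).inter (isOpen_lt h2 continuous_const)

/-- The graph function of a sphere of radius `ρ` over a tangent hyperplane. -/
noncomputable def sphereGraph (ρ : ℝ) (y : Space N) : ℝ := √(ρ ^ 2 - ‖y‖ ^ 2) - ρ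

lemma sphereGraph_bounds {ρ : ℝ} {y : Space N} (hy : ‖y‖ < ρ / 2) :
    |sphereGraph ρ y| < ρ / 2 := by
  have h0 := norm_nonneg y
  have hρ : 0 < ρ := by linarith
  rw [sphereGraph, abs_lt]
  constructor
  · have : ρ / 2 < √(ρ ^ 2 - ‖y‖ ^ 2) := Real.lt_sqrt_of_sq_lt (by nlinarith)
    linarith
  · have : √(ρ ^ 2 - ‖y‖ ^ 2) ≤ ρ := Real.sqrt_le_iff.2 ⟨hρ.le, by nlinarith⟩
    linarith

lemma sphereGraph_contDiffAt {ρ : ℝ} {y : Space N} (hy : ‖y‖ < ρ) :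
    ContDiffAt ℝ ∞ (sphereGraph ρ) y := by
  have h0 := norm_nonneg y
  have h1 : ρ ^ 2 - ‖y‖ ^ 2 ≠ 0 := by nlinarith
  have h2 : ContDiffAt ℝ ∞ (fun y : Space N => ρ ^ 2 - ‖y‖ ^ 2) y :=
    contDiffAt_const.sub ((contDiff_norm_sq ℝ).contDiffAt)
  exact (h2.sqrt h1).sub contDiffAt_const

/-- Charts of a ball and of its complement near a boundary point. -/
lemma ball_charts (hβ : β ≤ 1) {ρ : ℝ} (hρ : 0 < ρ) {e : Space N} (he : ‖e‖ = ρ) :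
    ∃ ν : Space N, ‖ν‖ = 1 ∧ ‖-ν‖ = 1 ∧ e ∈ cylinder e ν (ρ / 2) (ρ / 2) ∧
      e ∈ cylinder e (-ν) (ρ / 2) (ρ / 2) ∧
      IsGraphFun ℓ β (ρ / 2) (ρ / 2) (sphereGraph (N := N) ρ) ∧
      IsGraphFun ℓ β (ρ / 2) (ρ / 2) (fun y : Space N => -sphereGraph ρ y) ∧
      (∀ y ∈ cylinder e ν (ρ / 2) (ρ / 2),
        (‖y‖ < ρ ↔ ⟪ν, y - e⟫ < sphereGraph ρ (horiz ν (y - e))) ∧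
        (‖y‖ ≤ ρ ↔ ⟪ν, y - e⟫ ≤ sphereGraph ρ (horiz ν (y - e)))) ∧
      ∀ y ∈ cylinder e (-ν) (ρ / 2) (ρ / 2),
        (ρ < ‖y‖ ↔ ⟪-ν, y - e⟫ < -sphereGraph ρ (horiz (-ν) (y - e))) ∧
        (ρ ≤ ‖y‖ ↔ ⟪-ν, y - e⟫ ≤ -sphereGraph ρ (horiz (-ν) (y - e))) := by
  set ν : Space N := (1 / ρ) • e with hν
  have hν1 : ‖ν‖ = 1 := by
    rw [hν, norm_smul, Real.norm_of_nonneg (by positivity), he]; field_simp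
  have hneg : ∀ y, horiz (-ν) y = horiz ν y := fun y => by
    simp [horiz, inner_neg_left]
  have hcyl : cylinder e (-ν) (ρ / 2) (ρ / 2) = cylinder e ν (ρ / 2) (ρ / 2) := by
    ext y; simp only [cylinder, mem_ofPred_eq, hneg, inner_neg_left, abs_neg]
  have hmem : e ∈ cylinder e ν (ρ / 2) (ρ / 2) := by
    simp only [cylinder, mem_ofPred_eq, sub_self, inner_zero_right, abs_zero]
    exact ⟨by simpa [horiz] using hρ, by linarith⟩
  have hsm : ∀ y : Space N, ‖y‖ < ρ → ContDiffAt ℝ ∞ (sphereGraph ρ) y :=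
    fun y hy => sphereGraph_contDiffAt hy
  have hchart : ∀ y ∈ cylinder e ν (ρ / 2) (ρ / 2),
        (‖y‖ < ρ ↔ ⟪ν, y - e⟫ < sphereGraph ρ (horiz ν (y - e))) ∧
        (‖y‖ ≤ ρ ↔ ⟪ν, y - e⟫ ≤ sphereGraph ρ (horiz ν (y - e))) := by
    intro y hy
    obtain ⟨hy1, hy2⟩ := hy
    have e1 : e = ρ • ν := by rw [hν, smul_smul, mul_one_div_cancel hρ.ne', one_smul]
    have e2 : ⟪ν, y⟫ = ρ + ⟪ν, y - e⟫ := by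
      rw [inner_sub_right, e1, inner_smul_right, real_inner_self_eq_norm_sq, hν1]; ring
    have e3 : horiz ν y = horiz ν (y - e) := by
      have : horiz ν e = 0 := by
        rw [horiz, e1, inner_smul_right, real_inner_self_eq_norm_sq, hν1]; simp
      rw [horiz_sub, this, sub_zero]
    have hn := norm_sq_eq_horiz hν1 y
    rw [e2, e3] at hn
    set t := ⟪ν, y - e⟫
    set a := ‖horiz ν (y - e)‖
    have ht := abs_lt.1 hy2
    have ha : 0 ≤ a := norm_nonneg _
    have hpos : 0 < ρ + t := by linarith
    have hsq : 0 ≤ ρ ^ 2 - a ^ 2 := by nlinarith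
    have hy0 := norm_nonneg y
    simp only [sphereGraph]
    constructor
    · rw [lt_sub_iff_add_lt, add_comm, Real.lt_sqrt hpos.le, ← sq_lt_sq₀ hy0 hρ.le]
      constructor <;> intro h <;> linarith
    · rw [le_sub_iff_add_le, add_comm, Real.le_sqrt' hpos, ← sq_le_sq₀ hy0 hρ.le]
      constructor <;> intro h <;> linarith
  refine ⟨ν, hν1, by rwa [norm_neg], hmem, hcyl ▸ hmem,
    ⟨isCHolderOn_of_contDiffAt hβ (by linarith) hsm, fun y hy => ?_⟩,
    ⟨isCHolderOn_of_contDiffAt hβ (by linarith) fun y hy => (hsm y hy).neg, fun y hy => ?_⟩,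
    hchart, fun y hy => ?_⟩
  · exact sphereGraph_bounds (by simpa using hy)
  · rw [abs_neg]
    exact sphereGraph_bounds (by simpa using hy)
  · rw [hcyl] at hy
    obtain ⟨h1, h2⟩ := hchart y hy
    rw [hneg, inner_neg_left, neg_lt_neg_iff, neg_le_neg_iff]
    constructor
    · rw [← not_le, h2, not_le]
    · rw [← not_lt, h1, not_lt]

lemma closedBall_mem_regularSets (hβ : β ≤ 1) {ρ : ℝ} (hρ : 0 < ρ) :
    Metric.closedBall (0 : Space N) ρ ∈ RegularSets N ℓ β := by
  refine ⟨Metric.ball 0 ρ, ⟨Metric.isOpen_ball, fun x hx => ?_⟩, ?_, (closure_ball _ hρ.ne').symm⟩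
  · rw [frontier_ball _ hρ.ne', mem_sphere_zero_iff_norm] at hx
    obtain ⟨ν, h1, -, h2, -, h3, -, h4, -⟩ := ball_charts (ℓ := ℓ) hβ hρ hx
    exact ⟨_, ν, _, _, _, h1, h2, h3, fun y hy => by simpa using (h4 y hy).1⟩
  · rw [frontier_ball _ hρ.ne']
    exact isCompact_sphere _ _

lemma compl_ball_mem_regularSets (hβ : β ≤ 1) {ρ : ℝ} (hρ : 0 < ρ) :
    (Metric.ball (0 : Space N) ρ)ᶜ ∈ RegularSets N ℓ β := by
  refine ⟨(Metric.closedBall 0 ρ)ᶜ, ⟨Metric.isClosed_closedBall.isOpen_compl, fun x hx => ?_⟩, ?_,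
    ?_⟩
  · rw [frontier_compl, frontier_closedBall _ hρ.ne', mem_sphere_zero_iff_norm] at hx
    obtain ⟨ν, -, h1, -, h2, -, h3, -, h4⟩ := ball_charts (ℓ := ℓ) hβ hρ hx
    exact ⟨_, -ν, _, _, _, h1, h2, h3, fun y hy => by simpa using (h4 y hy).1⟩
  · rw [frontier_compl, frontier_closedBall _ hρ.ne']
    exact isCompact_sphere _ _
  · rw [closure_compl, interior_closedBall _ hρ.ne']

/-- A fixed set with closed graph descriptions converges to itself. -/
lemma tendstoRegular_const {E : Set (Space N)} (hc : IsCompact (frontier E))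
    (hE : ∀ x ∈ frontier E, ∃ (c ν : Space N) (r s : ℝ) (h : Space N → ℝ),
      ‖ν‖ = 1 ∧ x ∈ cylinder c ν r s ∧ IsGraphFun ℓ β r s h ∧
      ∀ y ∈ cylinder c ν r s, y ∈ E ↔ ⟪ν, y - c⟫ ≤ h (horiz ν (y - c))) :
    TendstoRegular ℓ β (fun _ => E) E := by
  choose! c ν r s h hν hx hh hg using hE
  obtain ⟨t, ht, hcov⟩ := hc.elim_nhds_subcover (fun x => cylinder (c x) (ν x) (r x) (s x))
    fun x hxE => (isOpen_cylinder _ _ _ _).mem_nhds (hx x hxE)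
  have hcov' : frontier E ⊆ ⋃ i : Fin t.card, cylinder (c (t.equivFin.symm i).1)
      (ν (t.equivFin.symm i).1) (r (t.equivFin.symm i).1) (s (t.equivFin.symm i).1) :=
    fun y hy => by
    obtain ⟨x, hxt, hyx⟩ := mem_iUnion₂.1 (hcov hy)
    refine mem_iUnion.2 ⟨t.equivFin ⟨x, hxt⟩, ?_⟩
    simpa using hyx
  have hm : ∀ i : Fin t.card, (t.equivFin.symm i).1 ∈ frontier E := fun i =>
    ht _ (t.equivFin.symm i).2
  refine ⟨t.card, fun i => c (t.equivFin.symm i).1, fun i => ν (t.equivFin.symm i).1,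
    fun i => r (t.equivFin.symm i).1, fun i => s (t.equivFin.symm i).1,
    fun i => h (t.equivFin.symm i).1, fun _ i => h (t.equivFin.symm i).1, fun i => hν _ (hm i),
    hcov', fun i => ⟨hh _ (hm i), hg _ (hm i)⟩,
    Eventually.of_forall fun n => ⟨hcov', fun i => ⟨hh _ (hm i), hg _ (hm i)⟩⟩,
    fun i => ⟨fun j _ => ?_, fun _ => 0, tendsto_const_nhds, Eventually.of_forall fun n => ?_⟩⟩
  · rw [Metric.tendstoUniformlyOn_iff]
    exact fun ε hε => Eventually.of_forall fun n x _ => by simpa using hε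
  · intro x _ y _
    simp

/-- A curvature is continuous along the boundary of such a set. -/
lemma IsCurvature.continuousOn_frontier {κ : Space N → Set (Space N) → ℝ}
    (hκ : IsCurvature ℓ β κ) {E : Set (Space N)} (hE : E ∈ RegularSets N ℓ β)
    (hconst : TendstoRegular ℓ β (fun _ => E) E) :
    ContinuousOn (fun x => κ x E) (frontier E) := by
  rw [continuousOn_iff_continuous_domRestrict, continuous_iff_seqContinuous]
  intro xn x hx
  exact hκ.continuity (fun _ => E) E (fun n => xn n) x (fun _ => hE) hE hconst
    (fun n => (xn n).2) x.2 ((continuous_subtype_val.tendsto x).comp hx)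

/-- The set of values whose supremum is `c̄(ρ)` is bounded above. -/
lemma bddAbove_ballCurvature (hβ : β ≤ 1) {κ : Space N → Set (Space N) → ℝ}
    (hκ : IsCurvature ℓ β κ) {ρ : ℝ} (hρ : 0 < ρ) :
    BddAbove ((fun x => max (κ x (Metric.closedBall 0 ρ)) (-κ x (Metric.ball 0 ρ)ᶜ)) ''
      Metric.sphere (0 : Space N) ρ) := by
  have f1 : frontier (Metric.closedBall (0 : Space N) ρ) = Metric.sphere 0 ρ :=
    frontier_closedBall _ hρ.ne'
  have f2 : frontier (Metric.ball (0 : Space N) ρ)ᶜ = Metric.sphere 0 ρ := by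
    rw [frontier_compl, frontier_ball _ hρ.ne']
  have c1 : ContinuousOn (fun x => κ x (Metric.closedBall 0 ρ)) (Metric.sphere (0 : Space N) ρ) := by
    rw [← f1]
    refine hκ.continuousOn_frontier (closedBall_mem_regularSets hβ hρ) (tendstoRegular_const
      (by rw [f1]; exact isCompact_sphere _ _) fun x hx => ?_)
    rw [f1, mem_sphere_zero_iff_norm] at hx
    obtain ⟨ν, h1, -, h2, -, h3, -, h4, -⟩ := ball_charts (ℓ := ℓ) hβ hρ hx
    exact ⟨_, ν, _, _, _, h1, h2, h3, fun y hy => by simpa using (h4 y hy).2⟩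
  have c2 : ContinuousOn (fun x => κ x (Metric.ball 0 ρ)ᶜ) (Metric.sphere (0 : Space N) ρ) := by
    rw [← f2]
    refine hκ.continuousOn_frontier (compl_ball_mem_regularSets hβ hρ) (tendstoRegular_const
      (by rw [f2]; exact isCompact_sphere _ _) fun x hx => ?_)
    rw [f2, mem_sphere_zero_iff_norm] at hx
    obtain ⟨ν, -, h1, -, h2, -, h3, -, h4⟩ := ball_charts (ℓ := ℓ) hβ hρ hx
    exact ⟨_, -ν, _, _, _, h1, h2, h3, fun y hy => by simpa using (h4 y hy).2⟩
  exact (isCompact_sphere _ _).bddAbove_image (c1.sup c2.neg)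

/-- `c̄` is nonincreasing. -/
lemma upperBallCurvature_antitone (hN : 1 ≤ N) (hβ : β ≤ 1) {κ : Space N → Set (Space N) → ℝ}
    (hκ : IsCurvature ℓ β κ) {ρ R : ℝ} (hρ : 0 < ρ) (hρR : ρ ≤ R) :
    upperBallCurvature κ R ≤ upperBallCurvature κ ρ := by
  have hR : 0 < R := hρ.trans_le hρR
  have : Nonempty (Fin N) := ⟨⟨0, hN⟩⟩
  have hne : (Metric.sphere (0 : Space N) R).Nonempty := NormedSpace.sphere_nonempty.2 hR.le
  refine csSup_le (hne.image _) ?_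
  rintro _ ⟨x, hx, rfl⟩
  rw [mem_sphere_zero_iff_norm] at hx
  set y : Space N := (ρ / R) • x with hy
  -- The translation taking the small ball into the large one, tangent from inside at `x`;
  -- monotonicity then compares curvatures at the common boundary point, and likewise for the
  -- complements.
  set v : Space N := (1 - ρ / R) • x with hv
  have hyv : y + v = x := by rw [hy, hv, ← add_smul]; simp
  have hq : 0 ≤ 1 - ρ / R := by rw [sub_nonneg, div_le_one hR]; exact hρR
  have hyn : ‖y‖ = ρ := by
    rw [hy, norm_smul, Real.norm_of_nonneg (by positivity), hx]; field_simp
  have hvn : ‖v‖ = R - ρ := by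
    rw [hv, norm_smul, Real.norm_of_nonneg hq, hx]; field_simp
  have f : ∀ {E : Set (Space N)} {s : ℝ} {z : Space N}, frontier E = Metric.sphere 0 s → ‖z‖ = s →
      z ∈ frontier E := fun h hz => by rw [h, mem_sphere_zero_iff_norm]; exact hz
  have f1 : ∀ {s : ℝ}, 0 < s → frontier (Metric.closedBall (0 : Space N) s) = Metric.sphere 0 s :=
    fun hs => frontier_closedBall _ hs.ne'
  have f2 : ∀ {s : ℝ}, 0 < s → frontier (Metric.ball (0 : Space N) s)ᶜ = Metric.sphere 0 s :=
    fun hs => by rw [frontier_compl, frontier_ball _ hs.ne']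
  have ft : ∀ {E : Set (Space N)}, y ∈ frontier E → x ∈ frontier ((fun z => z + v) '' E) := by
    intro E hE
    have : (Homeomorph.addRight v) '' frontier E = frontier ((Homeomorph.addRight v) '' E) :=
      Homeomorph.image_frontier _ _
    exact this ▸ ⟨y, hE, hyv⟩
  have k1 : κ x (Metric.closedBall 0 R) ≤ κ y (Metric.closedBall 0 ρ) := by
    have hreg := closedBall_mem_regularSets (N := N) (ℓ := ℓ) hβ hρ
    rw [hκ.translation _ hreg y (f (f1 hρ) hyn) v, hyv]
    refine hκ.mono _ (RegularSets.translate hreg v) _ (closedBall_mem_regularSets hβ hR) ?_ x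
      ⟨f (f1 hR) hx, ft (f (f1 hρ) hyn)⟩
    rintro _ ⟨z, hz, rfl⟩
    rw [mem_closedBall_zero_iff] at hz ⊢
    refine (norm_add_le _ _).trans ?_
    linarith
  have k2 : -κ x (Metric.ball 0 R)ᶜ ≤ -κ y (Metric.ball 0 ρ)ᶜ := by
    have hreg := compl_ball_mem_regularSets (N := N) (ℓ := ℓ) hβ hρ
    rw [hκ.translation _ hreg y (f (f2 hρ) hyn) v, hyv, neg_le_neg_iff]
    refine hκ.mono _ (compl_ball_mem_regularSets hβ hR) _ (RegularSets.translate hreg v) ?_ x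
      ⟨ft (f (f2 hρ) hyn), f (f2 hR) hx⟩
    intro z hz
    refine ⟨z - v, ?_, by simp⟩
    rw [mem_compl_iff, mem_ball_zero_iff, not_lt] at hz ⊢
    have := norm_sub_norm_le z v
    linarith
  -- Boundedness is essential: the real `sSup` of an unbounded set is the default value zero.
  refine le_csSup_of_le (bddAbove_ballCurvature hβ hκ hρ) ⟨y, by simpa using hyn, rfl⟩ ?_
  exact max_le_max k1 k2

end Balls

/-! ### Construction of flat profiles -/

section FlatProfile

/-- All derivatives of the smooth transition function are bounded. -/
lemma exists_bound_iteratedFDeriv_smoothTransition (j : ℕ) :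
    ∃ B, ∀ x, ‖iteratedFDeriv ℝ j Real.smoothTransition x‖ ≤ B := by
  have hcont : Continuous fun x => ‖iteratedFDeriv ℝ j Real.smoothTransition x‖ :=
    (Real.smoothTransition.contDiff (n := (⊤ : ℕ∞)).continuous_iteratedFDeriv
      (by norm_cast; exact le_top)).norm
  obtain ⟨B, hB⟩ := (isCompact_Icc (a := (-1 : ℝ)) (b := 2)).bddAbove_image hcont.continuousOn
  have hconst : ∀ c : ℝ, |c| ≤ 1 → ∀ x : ℝ, ‖iteratedFDeriv ℝ j (fun _ : ℝ => c) x‖ ≤ 1 := by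
    intro c hc x
    rcases Nat.eq_zero_or_pos j with rfl | hj
    · simpa using hc
    · rw [iteratedFDeriv_const_of_ne hj.ne']; simp
  refine ⟨max B 1, fun x => ?_⟩
  rcases lt_or_ge x (-1) with h | h
  · have : Real.smoothTransition =ᶠ[𝓝 x] fun _ => 0 := by
      filter_upwards [Iio_mem_nhds (h.trans (by norm_num : (-1 : ℝ) < 0))] with y hy
      exact Real.smoothTransition.zero_of_nonpos (le_of_lt hy)
    rw [(this.iteratedFDeriv ℝ j).eq_of_nhds]
    exact (hconst 0 (by simp) x).trans (le_max_right _ _)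
  rcases lt_or_ge 2 x with h' | h'
  · have : Real.smoothTransition =ᶠ[𝓝 x] fun _ => 1 := by
      filter_upwards [Ioi_mem_nhds ((by norm_num : (1 : ℝ) < 2).trans h')] with y hy
      exact Real.smoothTransition.one_of_one_le (le_of_lt hy)
    rw [(this.iteratedFDeriv ℝ j).eq_of_nhds]
    exact (hconst 1 (by simp) x).trans (le_max_right _ _)
  · exact (hB ⟨x, ⟨h, h'⟩, rfl⟩).trans (le_max_left _ _)

/-- A smooth nondecreasing function vanishing exactly on the negative axis, which is smaller than
a given positive function of `s > 0` that decreases to zero arbitrarily fast as `s → 0`. -/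
lemma exists_smooth_monotone_slow {D : ℝ → ℝ} (hD0 : ∀ s, 0 ≤ D s)
    (hD : ∀ r s, 0 < r → r ≤ s → D s ≤ D r) :
    ∃ G : ℝ → ℝ, ContDiff ℝ ∞ G ∧ Monotone G ∧ (∀ s ≤ 0, G s = 0) ∧ (∀ s > 0, 0 < G s) ∧
      ∀ s > 0, G s * D s ≤ 1 := by
  set b : ℕ → ℝ := fun k => 1 / 2 / 2 ^ k with hb
  have hbsum : HasSum b 1 := hasSum_geometric_two' 1
  have hb0 : ∀ k, 0 < b k := fun k => by simp only [hb]; positivity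
  set τ : ℕ → ℝ := fun k => 1 / ((k : ℝ) + 1) with hτ
  have hτ0 : ∀ k, 0 < τ k := fun k => by simp only [hτ]; positivity
  -- The `k`-th bump is active only for `s > τ k`, where `D s ≤ D (τ k)`; this weight bounds its
  -- product with `D s` by `b k`, and the `b k` sum to one. Dividing by `1 + D` also keeps `a k ≤ b
  -- k`, so all series of derivatives converge.
  set a : ℕ → ℝ := fun k => b k / (1 + D (τ k)) with ha
  have hden : ∀ k, 1 ≤ 1 + D (τ k) := fun k => by linarith [hD0 (τ k)]
  have ha0 : ∀ k, 0 < a k := fun k => div_pos (hb0 k) (by linarith [hden k])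
  have hab : ∀ k, a k ≤ b k := fun k => div_le_self (hb0 k).le (hden k)
  set f : ℕ → ℝ → ℝ := fun k s => a k * Real.smoothTransition (s - τ k) with hf
  have hst : ContDiff ℝ ∞ Real.smoothTransition := Real.smoothTransition.contDiff
  have hfd : ∀ k, ContDiff ℝ ∞ (f k) := fun k =>
    contDiff_const.mul (hst.comp (contDiff_id.sub contDiff_const))
  have hf0 : ∀ k s, 0 ≤ f k s := fun k s => mul_nonneg (ha0 k).le (Real.smoothTransition.nonneg _)
  have hfb : ∀ k s, f k s ≤ b k := fun k s =>
    (mul_le_of_le_one_right (ha0 k).le (Real.smoothTransition.le_one _)).trans (hab k)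
  have hfs : ∀ s, Summable fun k => f k s := fun s =>
    Summable.of_nonneg_of_le (fun k => hf0 k s) (fun k => hfb k s) hbsum.summable
  choose B hB using exists_bound_iteratedFDeriv_smoothTransition
  refine ⟨fun s => ∑' k, f k s, ?_, fun s t hst => ?_, fun s hs => ?_, fun s hs => ?_,
    fun s hs => ?_⟩
  · refine contDiff_tsum (N := (⊤ : ℕ∞)) (v := fun j k => b k * B j) hfd
      (fun j _ => hbsum.summable.mul_right _) fun j k x _ => ?_
    have e : f k = a k • fun s => Real.smoothTransition (s - τ k) := rfl
    have hd : ContDiffAt ℝ j (fun s => Real.smoothTransition (s - τ k)) x :=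
      (Real.smoothTransition.contDiff (n := (j : ℕ∞)).comp
        (contDiff_id.sub contDiff_const)).contDiffAt
    rw [e, iteratedFDeriv_const_smul_apply hd, iteratedFDeriv_comp_sub, norm_smul,
      Real.norm_of_nonneg (ha0 k).le]
    exact mul_le_mul (hab k) (hB j _) (norm_nonneg _) (hb0 k).le
  · refine (hfs s).tsum_le_tsum (fun k => ?_) (hfs t)
    have := ha0 k
    exact mul_le_mul_of_nonneg_left (Real.smoothTransition.monotone (by linarith)) this.le
  · refine (tsum_congr fun k => ?_).trans tsum_zero
    simp only [hf]
    rw [Real.smoothTransition.zero_of_nonpos (by linarith [hτ0 k]), mul_zero]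
  · obtain ⟨k, hk⟩ := exists_nat_one_div_lt hs
    refine (hfs s).tsum_pos (fun k => hf0 k s) k ?_
    exact mul_pos (ha0 k) (Real.smoothTransition.pos_of_pos (sub_pos.2 hk))
  · rw [← tsum_mul_right, ← hbsum.tsum_eq]
    refine ((hfs s).mul_right _).tsum_le_tsum (fun k => ?_) hbsum.summable
    rcases le_or_gt s (τ k) with h | h
    · simp only [hf]
      rw [Real.smoothTransition.zero_of_nonpos (by linarith), mul_zero, zero_mul]
      exact (hb0 k).le
    · have h1 : f k s ≤ a k :=
        mul_le_of_le_one_right (ha0 k).le (Real.smoothTransition.le_one _)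
      have h2 := hD _ _ (hτ0 k) h.le
      calc f k s * D s ≤ a k * D (τ k) := mul_le_mul h1 h2 (hD0 _) (ha0 k).le
        _ ≤ a k * (1 + D (τ k)) := by have := ha0 k; gcongr; linarith
        _ = b k := by simp only [ha]; have := hden k; field_simp

variable {N ℓ : ℕ} {β : ℝ≥0}

/-- **Flat profiles exist.** They are taken as smooth functions of the squared radius. -/
theorem exists_flatProfile (hN : 1 ≤ N) (hβ : β ≤ 1) {κ : Space N → Set (Space N) → ℝ}
    (hκ : IsCurvature ℓ β κ) : ∃ g p : ℝ → ℝ, ContDiff ℝ ∞ g ∧ (∀ s, HasDerivAt g (p s) s) ∧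
      g 0 = 0 ∧ Monotone g ∧ (∀ s ∈ Ioo (0 : ℝ) 2, 0 < p s) ∧ (∀ s ≥ 2, g s = g 2) ∧
      ∀ α > 0, IsFlatProfile κ fun r => α * g (r ^ 2) := by
  -- The extra constant controls `|c̄|` on `(0, 1]` even where `c̄` is negative, since there `c̄` is
  -- at least its value at one.
  set D : ℝ → ℝ := fun s => max (upperBallCurvature κ (√s)) 0 + |upperBallCurvature κ 1| with hD
  obtain ⟨G, hG, hGm, hG0, hGp, hGD⟩ := exists_smooth_monotone_slow (D := D)
    (fun s => by simp only [hD]; positivity) (fun r s hr hrs => by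
      simp only [hD]
      gcongr
      exact upperBallCurvature_antitone hN hβ hκ (Real.sqrt_pos.2 hr) (Real.sqrt_le_sqrt hrs))
  have hDc : ∀ ρ, 0 < ρ → ρ ≤ 1 → |upperBallCurvature κ ρ| ≤ D (ρ ^ 2) := fun ρ h0 h1 => by
    simp only [hD]
    rw [Real.sqrt_sq h0.le, abs_le]
    have h2 := upperBallCurvature_antitone hN hβ hκ h0 h1
    have h3 := neg_abs_le (upperBallCurvature κ 1)
    have h4 := le_max_left (upperBallCurvature κ ρ) 0
    have h5 := le_max_right (upperBallCurvature κ ρ) 0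
    have h6 := abs_nonneg (upperBallCurvature κ 1)
    constructor <;> linarith
  -- The factor switches the derivative off beyond `2`, making its integral `g` eventually constant.
  -- Composing `g` with the squared radius keeps the penalty smooth at the origin of `ℝ^N`.
  set p : ℝ → ℝ := fun t => G t * Real.smoothTransition (2 - t) with hp
  have hst : ContDiff ℝ ∞ Real.smoothTransition := Real.smoothTransition.contDiff
  have hpd : ContDiff ℝ ∞ p := hG.mul (hst.comp (contDiff_const.sub contDiff_id))
  have hGn : ∀ s, 0 ≤ G s := fun s => by
    rcases le_or_gt s 0 with h | h
    · exact (hG0 s h).ge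
    · exact (hGp s h).le
  have hp0 : ∀ s, 0 ≤ p s := fun s => mul_nonneg (hGn s) (Real.smoothTransition.nonneg _)
  set g : ℝ → ℝ := fun s => ∫ t in (0 : ℝ)..s, p t with hg
  have hgd : ∀ s, HasDerivAt g (p s) s := fun s =>
    intervalIntegral.integral_hasDerivAt_right (hpd.continuous.intervalIntegrable _ _)
      hpd.continuous.stronglyMeasurable.stronglyMeasurableAtFilter hpd.continuous.continuousAt
  have hgderiv : deriv g = p := funext fun s => (hgd s).deriv
  have hgC : ContDiff ℝ ∞ g := by
    rw [contDiff_infty_iff_deriv, hgderiv]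
    exact ⟨fun s => (hgd s).differentiableAt, hpd⟩
  have hgm : Monotone g := monotone_of_deriv_nonneg (fun s => (hgd s).differentiableAt)
    fun s => by rw [hgderiv]; exact hp0 s
  have hg0 : g 0 = 0 := by simp [hg]
  have hgc : ∀ s ≥ 2, g s = g 2 := fun s hs => by
    have h1 : g s - g 2 = ∫ t in (2 : ℝ)..s, p t := by
      simp only [hg]
      exact intervalIntegral.integral_interval_sub_left (hpd.continuous.intervalIntegrable _ _)
        (hpd.continuous.intervalIntegrable _ _)
    have h2 : ∫ t in (2 : ℝ)..s, p t = ∫ t in (2 : ℝ)..s, (0 : ℝ) := by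
      refine intervalIntegral.integral_congr fun t ht => ?_
      rw [uIcc_of_le hs] at ht
      simp only [hp]
      rw [Real.smoothTransition.zero_of_nonpos (by linarith [ht.1]), mul_zero]
    rw [h2, intervalIntegral.integral_zero] at h1
    linarith
  refine ⟨g, p, hgC, hgd, hg0, hgm, fun s hs => mul_pos (hGp s hs.1)
    (Real.smoothTransition.pos_of_pos (by linarith [hs.2])), hgc, fun α hα => ?_⟩
  have hsq : ∀ r : ℝ, HasDerivAt (fun r : ℝ => r ^ 2) (2 * r) r := fun r => by
    simpa using hasDerivAt_pow 2 r
  set f : ℝ → ℝ := fun r => α * g (r ^ 2) with hf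
  have hfC : ContDiff ℝ ∞ f := contDiff_const.mul (hgC.comp (contDiff_id.pow 2))
  have hfd : ∀ r, HasDerivAt f (α * (p (r ^ 2) * (2 * r))) r := fun r =>
    (HasDerivAt.comp (h₂ := g) (h := fun r : ℝ => r ^ 2) r (hgd (r ^ 2)) (hsq r)).const_mul α
  have hfderiv : deriv f = fun r => α * (p (r ^ 2) * (2 * r)) := funext fun r => (hfd r).deriv
  have hfd2 : ∀ r, HasDerivAt (deriv f)
      (α * (deriv p (r ^ 2) * (2 * r) * (2 * r) + p (r ^ 2) * 2)) r := fun r => by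
    rw [hfderiv]
    have h1 : HasDerivAt (fun r => p (r ^ 2)) (deriv p (r ^ 2) * (2 * r)) r :=
      HasDerivAt.comp (h₂ := p) (h := fun r : ℝ => r ^ 2) r
        (hpd.differentiable (by norm_num) (r ^ 2)).hasDerivAt (hsq r)
    have h2 : HasDerivAt (fun r : ℝ => 2 * r) 2 r := by
      simpa using (hasDerivAt_id r).const_mul (2 : ℝ)
    exact (h1.mul h2).const_mul α
  have hU : UniqueDiffOn ℝ (Ici (0 : ℝ)) := uniqueDiffOn_Ici 0
  have hw1 : ∀ r ∈ Ici (0 : ℝ), derivWithin f (Ici 0) r = α * (p (r ^ 2) * (2 * r)) :=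
    fun r hr => (hfd r).hasDerivWithinAt.derivWithin (hU r hr)
  have hw2 : ∀ r ∈ Ici (0 : ℝ), iteratedDerivWithin 2 f (Ici 0) r =
      α * (deriv p (r ^ 2) * (2 * r) * (2 * r) + p (r ^ 2) * 2) := fun r hr => by
    rw [iteratedDerivWithin_eq_iteratedDeriv hU ((hfC.of_le (by norm_cast)).contDiffAt) hr,
      iteratedDeriv_succ, iteratedDeriv_one, (hfd2 r).deriv]
  have hp00 : p 0 = 0 := by simp [hp, hG0 0 le_rfl]
  refine ⟨hfC.contDiffOn, by simp [hf, hg0], by rw [hw1 0 self_mem_Ici]; simp,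
    by rw [hw2 0 self_mem_Ici]; simp [hp00], ⟨1, one_pos, fun r hr => ?_⟩,
    ⟨2, two_pos, fun r hr => ?_⟩, ?_⟩
  · rw [hw2 r hr.1.le]
    have hr2 : r ^ 2 < 1 := by nlinarith [hr.1, hr.2]
    have hr0 : 0 < r ^ 2 := pow_pos hr.1 2
    have h1 : p =ᶠ[𝓝 (r ^ 2)] G := by
      filter_upwards [Iio_mem_nhds hr2] with s hs
      simp only [hp]
      have hs' : s < 1 := hs
      rw [Real.smoothTransition.one_of_one_le (by linarith), mul_one]
    have h2 : 0 ≤ deriv p (r ^ 2) := by rw [h1.deriv_eq]; exact hGm.deriv_nonneg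
    have h3 : 0 < p (r ^ 2) := by rw [h1.eq_of_nhds]; exact hGp _ hr0
    have h4 : 0 ≤ deriv p (r ^ 2) * (2 * r) * (2 * r) := by
      have := hr.1.le; positivity
    have : 0 < deriv p (r ^ 2) * (2 * r) * (2 * r) + p (r ^ 2) * 2 := by linarith
    positivity
  · simp only [hf]
    rw [hgc (r ^ 2) (by nlinarith), hgc (2 ^ 2) (by norm_num)]
  · refine squeeze_zero_norm' (a := fun ρ : ℝ => 2 * α * ρ) ?_ ?_
    · filter_upwards [Ioo_mem_nhdsGT (zero_lt_one' ℝ)] with ρ hρ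
      rw [hw1 ρ hρ.1.le, Real.norm_eq_abs, abs_mul,
        abs_of_nonneg (by have := hρ.1.le; have := hp0 (ρ ^ 2); positivity)]
      have h1 := hDc ρ hρ.1 hρ.2.le
      have h2 : p (ρ ^ 2) ≤ G (ρ ^ 2) :=
        mul_le_of_le_one_right (hGn _) (Real.smoothTransition.le_one _)
      have h3 := hGD (ρ ^ 2) (pow_pos hρ.1 2)
      have h4 : p (ρ ^ 2) * |upperBallCurvature κ ρ| ≤ 1 :=
        (mul_le_mul h2 h1 (abs_nonneg _) (hGn _)).trans h3
      have h5 : 0 < 2 * α * ρ := by have := hρ.1; positivity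
      calc _ = 2 * α * ρ * (p (ρ ^ 2) * |upperBallCurvature κ ρ|) := by ring
        _ ≤ 2 * α * ρ * 1 := by gcongr
        _ = _ := mul_one _
    · have : Tendsto (fun ρ : ℝ => 2 * α * ρ) (𝓝 0) (𝓝 (2 * α * 0)) :=
        Continuous.tendsto (by fun_prop) 0
      rw [mul_zero] at this
      exact this.mono_left nhdsWithin_le_nhds

end FlatProfile

/-! ### Supremal convolution with a bounded flat penalty -/

section SupConvolution

variable {N : ℕ}

/-- A bounded penalisation `F`, maximal and constant outside the ball of radius `2`, with
quadratic expansions of slope `q`. -/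
structure IsPenalty (F : Space N → ℝ) (q : Space N → Space N) (M C : ℝ) (L : ℝ≥0) : Prop where
  zero : F 0 = 0
  nonneg : ∀ x, 0 ≤ F x
  le : ∀ x, F x ≤ M
  eq : ∀ x, 2 ≤ ‖x‖ → F x = M
  quad : HasQuadExpansion C F q
  lip : LipschitzWith L F

/-- `U` is the supremal convolution of `w`, restricted to times in `[0, τ]`, with the
penalisation `F x + n t²`, and the supremum is attained. -/
structure IsSupConvolution (F : Space N → ℝ) (n τ : ℝ) (w U : Space N × ℝ → ℝ) : Prop where
  le : ∀ x t y, ∀ s ∈ Icc 0 τ, w (y, s) - F (x - y) - n * (t - s) ^ 2 ≤ U (x, t)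
  attained : ∀ x t, ∃ y, ∃ s ∈ Icc 0 τ, U (x, t) = w (y, s) - F (x - y) - n * (t - s) ^ 2

/-- At each time of `A`, `w` is constant outside the ball of radius `R`. -/
def ConstOutsideBall (R : ℝ) (w : Space N × ℝ → ℝ) (A : Set ℝ) : Prop :=
  ∀ t ∈ A, ∀ x y, R < ‖x‖ → R < ‖y‖ → w (x, t) = w (y, t)

/-- The gradient is a positive multiple of `x` as long as `0 < ‖x‖² < 2`. Hence the origin is the
only critical point there, which later identifies the point where the convolution is attained. -/
lemma exists_isPenalty {g p : ℝ → ℝ} (hg : ContDiff ℝ ∞ g) (hgp : ∀ s, HasDerivAt g (p s) s)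
    (hg0 : g 0 = 0) (hgm : Monotone g) (hp : ∀ s ∈ Ioo (0 : ℝ) 2, 0 < p s)
    (hg2 : ∀ s ≥ 2, g s = g 2) {n : ℝ} (hn : 0 < n) :
    ∃ q M C L, IsPenalty (N := N) (fun x => n * g (‖x‖ ^ 2)) q M C L ∧
      ∀ x, ‖x‖ ^ 2 < 2 → q x = 0 → x = 0 := by
  set F : Space N → ℝ := fun x => n * g (‖x‖ ^ 2) with hF
  have hFd : ContDiff ℝ ∞ F := contDiff_const.mul (hg.comp (contDiff_id.norm_sq ℝ))
  have hc : ∀ x : Space N, 2 ≤ ‖x‖ → F x = n * g 2 := fun x hx => by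
    simp only [hF]
    rw [hg2 _ (by nlinarith)]
  obtain ⟨C, hC⟩ := exists_hasQuadExpansion (hFd.of_le (by norm_cast)) (R := 2)
    fun x hx => hc x hx.le
  have hFs : ContDiff ℝ 1 fun x => F x - n * g 2 := (hFd.of_le (by norm_cast)).sub contDiff_const
  obtain ⟨L, hL⟩ := ContDiff.lipschitzWith_of_hasCompactSupport
    (HasCompactSupport.intro (isCompact_closedBall (0 : Space N) 2) fun x hx => by
      rw [hc x (le_of_lt (by simpa using hx)), sub_self]) hFs (by norm_num)
  refine ⟨gradient F, n * g 2, C, L, ⟨by simp [hF, hg0], fun x => ?_, fun x => ?_, hc, hC, ?_⟩,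
    fun x hx hq => ?_⟩
  · exact mul_nonneg hn.le (hg0 ▸ hgm (sq_nonneg _))
  · rcases le_total (‖x‖ ^ 2) 2 with h | h
    · exact mul_le_mul_of_nonneg_left (hgm h) hn.le
    · simp only [hF]; rw [hg2 _ h]
  · refine LipschitzWith.of_dist_le_mul fun x y => ?_
    simpa [Real.dist_eq] using hL.dist_le_mul x y
  · by_contra hx0
    have h1 : HasFDerivAt F (n • p (‖x‖ ^ 2) • (2 : ℕ) • innerSL ℝ x) x := by
      have := (hgp (‖x‖ ^ 2)).comp_hasFDerivAt x (hasStrictFDerivAt_norm_sq x).hasFDerivAt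
      simpa using this.const_mul n
    have h2 := congrArg (fun A : Space N →L[ℝ] ℝ => A x) (h1.unique (hC.hasFDerivAt x))
    have hx' : 0 < ‖x‖ := norm_pos_iff.2 hx0
    have h3 := hp _ ⟨pow_pos hx' 2, hx⟩
    rw [hq] at h2
    simp only [smul_apply, innerSL_apply_apply, smul_eq_mul, inner_zero_left, nsmul_eq_mul,
      Nat.cast_ofNat, real_inner_self_eq_norm_sq] at h2
    have : 0 < n * (p (‖x‖ ^ 2) * (2 * ‖x‖ ^ 2)) := by positivity
    exact this.ne' h2

variable {F : Space N → ℝ} {q : Space N → Space N} {M C n τ R : ℝ} {L : ℝ≥0}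
  {w U : Space N × ℝ → ℝ}

/-- A bounded penalty is not coercive, but far out both `w` and the penalty are constant in space,
so every distant point can be replaced by one on the sphere of radius `R'`, and the maximisation
takes place on a compact set. -/
lemma exists_isSupConvolution (hN : 1 ≤ N) (hF : IsPenalty F q M C L) (hτ : 0 ≤ τ)
    (hw : UpperSemicontinuousOn w (univ ×ˢ Icc 0 τ)) (hR : ConstOutsideBall R w (Icc 0 τ)) :
    ∃ U, IsSupConvolution F n τ w U := by
  have key : ∀ z : Space N × ℝ, ∃ z' : Space N × ℝ, z'.2 ∈ Icc 0 τ ∧ ∀ y, ∀ s ∈ Icc 0 τ,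
      w (y, s) - F (z.1 - y) - n * (z.2 - s) ^ 2 ≤
        w z' - F (z.1 - z'.1) - n * (z.2 - z'.2) ^ 2 := by
    intro z
    set R' := |R| + 3 + ‖z.1‖ with hR'
    have hR'0 : 0 ≤ R' := by positivity
    have hRR' : R < R' := by
      have := le_abs_self R
      have := norm_nonneg z.1
      linarith
    have hcont : ContinuousOn (fun z' : Space N × ℝ => - F (z.1 - z'.1) - n * (z.2 - z'.2) ^ 2)
        (Metric.closedBall 0 R' ×ˢ Icc 0 τ) := by
      have := hF.lip.continuous
      fun_prop
    have husc : UpperSemicontinuousOn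
        (fun z' : Space N × ℝ => w z' + (- F (z.1 - z'.1) - n * (z.2 - z'.2) ^ 2))
        (Metric.closedBall 0 R' ×ˢ Icc 0 τ) :=
      (hw.mono (prod_mono (subset_univ _) le_rfl)).add hcont.upperSemicontinuousOn
    obtain ⟨z', hz', hmax⟩ := husc.exists_isMaxOn
      ⟨((0 : Space N), (0 : ℝ)), mem_prod.2 ⟨by simpa using hR'0, by simpa using hτ⟩⟩
      ((isCompact_closedBall _ _).prod isCompact_Icc)
    have hmax' : ∀ y, ‖y‖ ≤ R' → ∀ s ∈ Icc 0 τ, w (y, s) - F (z.1 - y) - n * (z.2 - s) ^ 2 ≤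
        w z' - F (z.1 - z'.1) - n * (z.2 - z'.2) ^ 2 := fun y hy s hs => by
      have := hmax (show (y, s) ∈ Metric.closedBall 0 R' ×ˢ Icc 0 τ from
        ⟨by simpa using hy, hs⟩)
      simp only [mem_ofPred_eq] at this
      linarith
    refine ⟨z', hz'.2, fun y s hs => ?_⟩
    rcases le_or_gt ‖y‖ R' with h | h
    · exact hmax' y h s hs
    · obtain ⟨y₀, hy₀⟩ : ∃ y₀ : Space N, ‖y₀‖ = R' :=
        ⟨EuclideanSpace.single ⟨0, hN⟩ R', by simpa using hR'0⟩
      have hfar : ∀ y : Space N, R' ≤ ‖y‖ → F (z.1 - y) = M := fun y hy => by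
        refine hF.eq _ ?_
        have := norm_sub_norm_le y z.1
        rw [norm_sub_rev] at this
        have := abs_nonneg R
        linarith
      have := hmax' y₀ hy₀.le s hs
      rw [hfar y₀ hy₀.ge] at this
      rwa [hfar y h.le, hR s hs y y₀ (by linarith) (by linarith)]
  choose f hf hfm using key
  exact ⟨fun z => w (f z) - F (z.1 - (f z).1) - n * (z.2 - (f z).2) ^ 2,
    fun x t y s hs => hfm (x, t) y s hs, fun x t => ⟨(f (x, t)).1, (f (x, t)).2, hf _, rfl⟩⟩

namespace IsSupConvolution

/-- If the maximiser for `x` lies outside the `R`-ball, the other point can use itself at no spatial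
cost; if it lies inside, the penalty already has its maximal value `M`, and the same maximiser does
at least as well. -/
lemma constOutside (hU : IsSupConvolution F n τ w U) (hF : IsPenalty F q M C L)
    (hR : ConstOutsideBall R w (Icc 0 τ)) : ConstOutsideBall (R + 2) U univ := by
  have key : ∀ t x y, R + 2 < ‖x‖ → R + 2 < ‖y‖ → U (x, t) ≤ U (y, t) := by
    intro t x y hx hy
    obtain ⟨x', s, hs, he⟩ := hU.attained x t
    rcases lt_or_ge R ‖x'‖ with h | h
    · have := hU.le y t y s hs
      rw [sub_self, hF.zero, hR s hs y x' (by linarith) h] at this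
      linarith [hF.nonneg (x - x')]
    · have := hU.le y t x' s hs
      have h1 := hF.eq (x - x') (by linarith [norm_sub_norm_le x x'])
      linarith [hF.le (y - x')]
  exact fun t _ x y hx hy => le_antisymm (key t x y hx hy) (key t y x hy hx)

/-- Keeping the maximiser fixed while time moves gives a lower parabola with explicit slope. -/
lemma time_lower (hU : IsSupConvolution F n τ w U) {x x' : Space N} {t s : ℝ}
    (hs : s ∈ Icc 0 τ) (he : U (x, t) = w (x', s) - F (x - x') - n * (t - s) ^ 2) (r : ℝ) :
    U (x, t) - 2 * n * (t - s) * r - n * r ^ 2 ≤ U (x, t + r) := by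
  have := hU.le x (t + r) x' s hs
  have e : n * (t + r - s) ^ 2 = n * (t - s) ^ 2 + 2 * n * (t - s) * r + n * r ^ 2 := by ring
  linarith

/-- Keeping the maximiser fixed while `x` moves transfers the expansion of the penalty; hence the
slope is minus that of `F`. -/
lemma space_lower (hU : IsSupConvolution F n τ w U) (hF : IsPenalty F q M C L) {x x' : Space N}
    {t s : ℝ} (hs : s ∈ Icc 0 τ)
    (he : U (x, t) = w (x', s) - F (x - x') - n * (t - s) ^ 2) (k : Space N) :
    U (x, t) + ⟪-q (x - x'), k⟫ - C * ‖k‖ ^ 2 ≤ U (x + k, t) := by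
  have h1 := hU.le (x + k) t x' s hs
  have h2 := (abs_le.1 (hF.quad (x - x') k)).2
  rw [add_sub_right_comm] at h1
  rw [inner_neg_left]
  linarith

lemma lowerSupported (hU : IsSupConvolution F n τ w U) (hF : IsPenalty F q M C L) (x : Space N)
    (t c : ℝ) : LowerSupported C fun k => U (x + k, t) + c := fun k => by
  obtain ⟨x', s, hs, he⟩ := hU.attained (x + k) t
  refine ⟨-q (x + k - x'), fun k' => ?_⟩
  have := hU.space_lower hF hs he k'
  rw [add_assoc] at this
  linarith

lemma space_le (hU : IsSupConvolution F n τ w U) (hF : IsPenalty F q M C L) (x y : Space N)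
    (t : ℝ) : U (x, t) ≤ U (y, t) + L * dist x y := by
  obtain ⟨x', s, hs, he⟩ := hU.attained x t
  have h1 := hU.le y t x' s hs
  have h2 := hF.lip.dist_le_mul (y - x') (x - x')
  rw [dist_sub_right, Real.dist_eq, dist_comm] at h2
  linarith [le_abs_self (F (y - x') - F (x - x'))]

lemma time_le (hU : IsSupConvolution F n τ w U) (hn : 0 ≤ n) (x : Space N) (t r : ℝ) :
    U (x, t) ≤ U (x, r) + n * (|r - t| * (|r| + |t| + 2 * τ)) := by
  obtain ⟨x', s, hs, he⟩ := hU.attained x t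
  have h1 := hU.le x r x' s hs
  have h2 : (r - s) ^ 2 - (t - s) ^ 2 ≤ |r - t| * (|r| + |t| + 2 * τ) := by
    calc (r - s) ^ 2 - (t - s) ^ 2 = (r - t) * (r + t - 2 * s) := by ring
      _ ≤ |(r - t) * (r + t - 2 * s)| := le_abs_self _
      _ = |r - t| * |r + t - 2 * s| := abs_mul _ _
      _ ≤ _ := by
        gcongr
        calc |r + t - 2 * s| ≤ |r + t| + |2 * s| := abs_sub _ _
          _ ≤ |r| + |t| + 2 * τ := by
            rw [abs_of_nonneg (by linarith [hs.1] : (0 : ℝ) ≤ 2 * s)]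
            linarith [abs_add_le r t, hs.2]
  have h3 := mul_le_mul_of_nonneg_left h2 hn
  linarith

lemma lipschitz (hU : IsSupConvolution F n τ w U) (hF : IsPenalty F q M C L) (x : Space N)
    (t c : ℝ) : LipschitzWith L fun k => U (x + k, t) + c := by
  refine LipschitzWith.of_dist_le_mul fun k l => ?_
  have h1 := hU.space_le hF (x + k) (x + l) t
  have h2 := hU.space_le hF (x + l) (x + k) t
  rw [dist_comm (x + l)] at h2
  rw [dist_add_left] at h1 h2
  rw [Real.dist_eq, abs_le]
  constructor <;> linarith

lemma continuous (hU : IsSupConvolution F n τ w U) (hF : IsPenalty F q M C L) (hn : 0 ≤ n) :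
    Continuous U := by
  refine continuous_iff_continuousAt.2 fun z => tendsto_iff_dist_tendsto_zero.2 ?_
  have hb : ∀ z' : Space N × ℝ, dist (U z') (U z) ≤
      L * dist z'.1 z.1 + n * (|z'.2 - z.2| * (|z'.2| + |z.2| + 2 * τ)) := fun z' => by
    have h1 := hU.space_le hF z'.1 z.1 z'.2
    have h2 := hU.space_le hF z.1 z'.1 z'.2
    have h3 := hU.time_le hn z.1 z'.2 z.2
    have h4 := hU.time_le hn z.1 z.2 z'.2
    rw [dist_comm] at h2
    rw [abs_sub_comm, add_comm |z.2|] at h3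
    rw [Real.dist_eq, abs_le]
    simp only [Prod.mk.eta] at h1 h2 h3 h4
    constructor <;> linarith
  refine squeeze_zero (fun _ => dist_nonneg) hb ?_
  have : Tendsto (fun z' : Space N × ℝ => L * dist z'.1 z.1 +
      n * (|z'.2 - z.2| * (|z'.2| + |z.2| + 2 * τ))) (𝓝 z)
      (𝓝 (L * dist z.1 z.1 + n * (|z.2 - z.2| * (|z.2| + |z.2| + 2 * τ)))) :=
    Continuous.tendsto (by fun_prop) z
  simpa using this

lemma le_of_le (hU : IsSupConvolution F n τ w U) (hF : IsPenalty F q M C L) (hn : 0 ≤ n) {B : ℝ}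
    (hB : ∀ x, ∀ t ∈ Icc 0 τ, w (x, t) ≤ B) (x : Space N) (t : ℝ) : U (x, t) ≤ B := by
  obtain ⟨x', s, hs, he⟩ := hU.attained x t
  have : 0 ≤ n * (t - s) ^ 2 := by positivity
  linarith [hB x' s hs, hF.nonneg (x - x')]

/-- Times at distance at least one from `[0, τ]` cost `n`; this confines the later maximisation to a
compact time interval. -/
lemma le_of_far (hU : IsSupConvolution F n τ w U) (hF : IsPenalty F q M C L) (hn : 0 ≤ n) {B : ℝ}
    (hB : ∀ x, ∀ t ∈ Icc 0 τ, w (x, t) ≤ B) (x : Space N) {t : ℝ}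
    (ht : t ∉ Icc (-1) (τ + 1)) : U (x, t) ≤ B - n := by
  obtain ⟨x', s, hs, he⟩ := hU.attained x t
  have h1 : 1 ≤ (t - s) ^ 2 := by
    rw [mem_Icc, not_and_or, not_le, not_le] at ht
    rcases ht with h | h
    · nlinarith [hs.1]
    · nlinarith [hs.2]
  have : n * 1 ≤ n * (t - s) ^ 2 := by gcongr
  linarith [hB x' s hs, hF.nonneg (x - x')]

end IsSupConvolution

end SupConvolution

/-! ### Maxima of the doubled function and their contact points -/

section Contact

variable {N ℓ : ℕ} {β : ℝ≥0}

/-- `(x, y, t)` maximises `U(x, t) + W(y, t) - n |x - y|²`. -/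
def IsDoublingMax (n : ℝ) (U W : Space N × ℝ → ℝ) (x y : Space N) (t : ℝ) : Prop :=
  ∀ x' y' t', U (x', t') + W (y', t') - n * ‖x' - y'‖ ^ 2 ≤ U (x, t) + W (y, t) - n * ‖x - y‖ ^ 2

lemma IsDoublingMax.symm {n : ℝ} {U W : Space N × ℝ → ℝ} {x y : Space N} {t : ℝ}
    (h : IsDoublingMax n U W x y t) : IsDoublingMax n W U y x t := fun x' y' t' => by
  have := h y' x' t'
  rw [norm_sub_rev x' y', norm_sub_rev y x]
  linarith

variable {F : Space N → ℝ} {q : Space N → Space N} {M C n τ R : ℝ} {L : ℝ≥0}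
  {w₁ w₂ U W : Space N × ℝ → ℝ} {x y x' y' : Space N} {t t' s' : ℝ}

/-- With `y` frozen, maximality bounds `U` by the quadratic coupling minus `W(y, ·)`, and `W` has a
lower parabola in time. So a single maximum yields a space-time paraboloid above `U`. -/
lemma IsDoublingMax.upper (h : IsDoublingMax n U W x y t) (hW : IsSupConvolution F n τ w₂ W)
    (hs : s' ∈ Icc 0 τ) (hy' : W (y, t) = w₂ (y', s') - F (y - y') - n * (t - s') ^ 2)
    (k : Space N) (r : ℝ) :
    U (x + k, t + r) ≤ U (x, t) + ⟪(2 * n) • (x - y), k⟫ + 2 * n * (t - s') * r +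
      n * (‖k‖ ^ 2 + r ^ 2) := by
  have h1 := h (x + k) y (t + r)
  have h2 := hW.time_lower hs hy' r
  rw [add_sub_right_comm x k y, norm_add_sq_real] at h1
  rw [inner_smul_left, conj_trivial]
  linarith

/-- `U(x, ·)` is enclosed between two parabolas touching at `t`, whose slopes must coincide. Not
doubling time thus costs nothing: the convolutions supply differentiability in time at the maximum.
-/
lemma IsDoublingMax.time_slope (h : IsDoublingMax n U W x y t) (hU : IsSupConvolution F n τ w₁ U)
    (hW : IsSupConvolution F n τ w₂ W) (ht : t' ∈ Icc 0 τ) (hs : s' ∈ Icc 0 τ)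
    (hx' : U (x, t) = w₁ (x', t') - F (x - x') - n * (t - t') ^ 2)
    (hy' : W (y, t) = w₂ (y', s') - F (y - y') - n * (t - s') ^ 2) :
    -(2 * n * (t - t')) = 2 * n * (t - s') := by
  refine scalar_slope_unique (C := n) (D := n) one_pos fun r _ => ?_
  have h1 := h.upper hW hs hy' 0 r
  have h2 := hU.time_lower ht hx' r
  rw [add_zero, inner_zero_right, norm_zero] at h1
  linarith

/-- At a maximum point on the diagonal, the supremal convolution is attained at the point itself,
provided that the penalisation has no other relevant critical point. -/
lemma IsDoublingMax.eq_of_diag (h : IsDoublingMax n U W x x t) (hF : IsPenalty F q M C L)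
    (hU : IsSupConvolution F n τ w₁ U) (hW : IsSupConvolution F n τ w₂ W) (ht : t' ∈ Icc 0 τ)
    (hx' : U (x, t) = w₁ (x', t') - F (x - x') - n * (t - t') ^ 2)
    (hq : q (x - x') = 0 → x - x' = 0) : x' = x := by
  obtain ⟨y', s', hs, hy'⟩ := hW.attained x t
  have : -q (x - x') = 0 := by
    refine slope_unique (C := C) (D := n) one_pos fun k _ => ?_
    have h1 := h.upper hW hs hy' k 0
    have h2 := hU.space_lower hF ht hx' k
    rw [add_zero, sub_self, smul_zero] at h1
    linarith
  exact (sub_eq_zero.1 (hq (neg_eq_zero.1 this))).symm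

variable {h h' : ℝ → ℝ} {C₁ T : ℝ}

/-- The test function obtained by shifting the supremal convolution. -/
noncomputable def contactTest (U : Space N × ℝ → ℝ) (h h' : ℝ → ℝ) (C₁ k : ℝ) (x x' : Space N)
    (t t' : ℝ) (z : Space N × ℝ) : ℝ :=
  h t' + h' t' * (z.2 - t') + C₁ * (z.2 - t') ^ 2 + U (z.1 + (x - x'), z.2 + (t - t')) + k

lemma contactTest_sub (k : ℝ) (ξ : Space N) :
    contactTest U h h' C₁ k x x' t t' (x' + ξ, t') - contactTest U h h' C₁ k x x' t t' (x', t') =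
      U (x + ξ, t) - U (x, t) := by
  have e1 : x' + ξ + (x - x') = x + ξ := by abel
  have e2 : x' + (x - x') = x := by abel
  have e3 : t' + (t - t') = t := by ring
  simp only [contactTest, e1, e2, e3]
  ring

lemma ConstOutsideBall.constOutsideCompact (hR : ConstOutsideBall R U univ) (v : Space N)
    (r : ℝ) (f : ℝ → ℝ) (A : Set ℝ) :
    ConstOutsideCompact (fun z => f z.2 + U (z.1 + v, z.2 + r)) A := by
  refine ⟨Metric.closedBall 0 (R + ‖v‖), isCompact_closedBall _ _, fun s _ => ?_⟩
  by_cases hne : ∃ x₀ : Space N, R < ‖x₀‖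
  · obtain ⟨x₀, hx₀⟩ := hne
    refine ⟨f s + U (x₀, s + r), fun x hx => ?_⟩
    have h1 : R + ‖v‖ < ‖x‖ := by simpa using hx
    have h2 := norm_sub_norm_le x (-v)
    rw [sub_neg_eq_add, norm_neg] at h2
    simp only
    rw [hR _ trivial (x + v) x₀ (by linarith) hx₀]
  · push Not at hne
    refine ⟨0, fun x hx => absurd ?_ hx⟩
    simpa using (hne x).trans (le_add_of_nonneg_right (norm_nonneg v))

/-- Shifting `U` by the displacement from contact point to maximum point moves the touching to `(x',
t')`; the parabola above `h` undoes the subtraction of the barrier and adds `h' t'` to the time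
slope. -/
lemma IsDoublingMax.isUpperTest (hm : IsDoublingMax n U W x y t) (hF : IsPenalty F q M C L)
    (hn : 0 ≤ n) (hU : IsSupConvolution F n τ (fun z => w₁ z - h z.2) U)
    (hW : IsSupConvolution F n τ w₂ W) (hR : ConstOutsideBall R U univ)
    (hh : ∀ s ∈ Icc 0 τ, ∀ r ∈ Icc 0 τ, h s ≤ h r + h' r * (s - r) + C₁ * (s - r) ^ 2)
    (hC₁ : 0 ≤ C₁) (hτT : τ ≤ T) (ht : t' ∈ Ioo 0 τ) (hs : s' ∈ Icc 0 τ)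
    (hx' : U (x, t) = w₁ (x', t') - h t' - F (x - x') - n * (t - t') ^ 2)
    (hy' : W (y, t) = w₂ (y', s') - F (y - y') - n * (t - s') ^ 2) {D : ℝ} (hD : n + C₁ ≤ D) :
    IsUpperTest T w₁ (contactTest U h h' C₁ (F (x - x') + n * (t - t') ^ 2) x x' t t') (x', t')
      ((2 * n) • (x - y)) (2 * n * (t - s') + h' t') D 0 τ := by
  have e2 : x' + (x - x') = x := by abel
  have e3 : t' + (t - t') = t := by ring
  refine ⟨le_rfl, hτT, ht, ?_, ?_, fun z s hz => ?_, ?_, fun z s hz => ?_⟩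
  · have h1 := hU.continuous hF hn
    unfold contactTest
    fun_prop
  · have := hR.constOutsideCompact (x - x') (t - t') (fun s => h t' + h' t' * (s - t') +
      C₁ * (s - t') ^ 2 + (F (x - x') + n * (t - t') ^ 2)) (Icc 0 τ)
    convert this using 2 with z
    simp only [contactTest]
    ring
  · have h1 := hU.le (z + (x - x')) (s + (t - t')) z s hz
    have h2 := hh s hz t' (Ioo_subset_Icc_self ht)
    rw [add_sub_cancel_left, add_sub_cancel_left] at h1
    simp only [contactTest]
    linarith
  · simp only [contactTest, e2, e3]
    rw [hx']
    ring
  · have h1 := hm.upper hW hs hy' (z - x') (s - t')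
    have e4 : z + (x - x') = x + (z - x') := by abel
    have e5 : s + (t - t') = t + (s - t') := by ring
    simp only [contactTest, e2, e3, e4, e5]
    have h2 : (n + C₁) * (‖z - x'‖ ^ 2 + (s - t') ^ 2) ≤ D * (‖z - x'‖ ^ 2 + (s - t') ^ 2) := by
      gcongr
    have h3 : 0 ≤ C₁ * ‖z - x'‖ ^ 2 := by positivity
    linarith

/-- If the maximum points of `U` and `W` are interior in time, the maximum of the doubled function
lies on the diagonal. -/
lemma IsDoublingMax.diag {κ : Space N → Set (Space N) → ℝ} (hκ : IsCurvature ℓ β κ)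
    (hFO : FirstOrderCondition ℓ β κ) {u v : Space N × ℝ → ℝ} (hu : IsSubsolution ℓ β κ T u)
    (hv : IsSupersolution ℓ β κ T v) (hm : IsDoublingMax n U W x y t) (hF : IsPenalty F q M C L)
    (hn : 0 < n) (hU : IsSupConvolution F n τ (fun z => u z - h z.2) U)
    (hW : IsSupConvolution F n τ (fun z => -v z - h z.2) W) (hUR : ConstOutsideBall R U univ)
    (hWR : ConstOutsideBall R W univ)
    (hh : ∀ s ∈ Icc 0 τ, ∀ r ∈ Icc 0 τ, h s ≤ h r + h' r * (s - r) + C₁ * (s - r) ^ 2)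
    (hh' : ∀ s ∈ Icc 0 τ, 0 < h' s) (hC₁ : 0 ≤ C₁) (hτT : τ ≤ T) (ht : t' ∈ Ioo 0 τ)
    (hs : s' ∈ Ioo 0 τ) (hx' : U (x, t) = u (x', t') - h t' - F (x - x') - n * (t - t') ^ 2)
    (hy' : W (y, t) = -v (y', s') - h s' - F (y - y') - n * (t - s') ^ 2) : x = y := by
  by_contra hne
  have hp : (2 * n) • (x - y) ≠ 0 := smul_ne_zero (by positivity) (sub_ne_zero.2 hne)
  have ht' := Ioo_subset_Icc_self ht
  have hs' := Ioo_subset_Icc_self hs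
  set D := max C (n + C₁) with hD
  have hDC : C ≤ D := le_max_left _ _
  have hDn : n + C₁ ≤ D := le_max_right _ _
  set Θ := contactTest U h h' C₁ (F (x - x') + n * (t - t') ^ 2) x x' t t' with hΘ
  set Ω := contactTest W h h' C₁ (F (y - y') + n * (t - s') ^ 2) y y' t s' with hΩ
  have h1 : IsUpperTest T u Θ (x', t') ((2 * n) • (x - y)) (2 * n * (t - s') + h' t') D 0 τ :=
    hm.isUpperTest hF hn.le hU hW hUR hh hC₁ hτT ht hs' hx' hy' hDn
  have h2 : IsUpperTest T (fun z => -v z) (fun z => -(-Ω z)) (y', s') (-((2 * n) • (x - y)))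
      (-(-(2 * n * (t - t') + h' s'))) D 0 τ := by
    simp only [neg_neg]
    rw [← smul_neg, neg_sub]
    exact hm.symm.isUpperTest hF hn.le hW hU hWR hh hC₁ hτT hs ht' hy' hx' hDn
  have e1 : ∀ ξ, Θ (x' + ξ, t') - Θ (x', t') = U (x + ξ, t) - U (x, t) := contactTest_sub _
  have e2 : ∀ ξ, -Ω (y' + ξ, s') - -Ω (y', s') = -W (y + ξ, t) + W (y, t) := fun ξ => by
    have : Ω (y' + ξ, s') - Ω (y', s') = W (y + ξ, t) - W (y, t) := contactTest_sub _ _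
    linarith
  have hxy : ∀ ξ k : Space N, x + ξ + k - (y + ξ) = x - y + k := fun ξ k => by abel
  -- The resulting ordering of slopes, together with `time_slope`, reads `h' t' + h' s' ≤ 0`,
  -- contrary to `h' > 0`.
  have key := slope_le_of_firstOrder hκ hFO hu hv hp (lt_of_lt_of_le (by positivity) hDn) h1 h2
    (L := L) ?_ ?_ ?_ ?_ ?_
  · have h3 := hm.time_slope hU hW ht' hs' hx' hy'
    linarith [hh' _ ht', hh' _ hs']
  · simp only [e1]
    exact hU.lipschitz hF x t (-U (x, t))
  · simp only [e1]
    intro ξ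
    obtain ⟨a, ha⟩ := hU.lowerSupported hF x t (-U (x, t)) ξ
    refine ⟨a, fun k => ?_⟩
    have : C * ‖k‖ ^ 2 ≤ D * ‖k‖ ^ 2 := by gcongr
    linarith [ha k]
  · simp only [e2]
    intro ξ
    obtain ⟨a, ha⟩ := hW.lowerSupported hF y t (-W (y, t)) ξ
    refine ⟨-a, fun k => ?_⟩
    have : C * ‖k‖ ^ 2 ≤ D * ‖k‖ ^ 2 := by gcongr
    rw [inner_neg_left]
    linarith [ha k]
  · intro ξ
    simp only [e1, e2]
    have := hm (x + ξ) (y + ξ) t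
    rw [add_sub_add_right_eq_sub] at this
    linarith
  -- Equality at `ξ` means that `(x + ξ, y + ξ, t)` is again a maximum of the doubled function, with
  -- the same difference `x - y`; hence the same slope `2n(x - y)` bounds `U` from above there.
  · intro ξ hξ k
    simp only [e1, e2] at hξ
    have h4 := hm (x + ξ + k) (y + ξ) t
    rw [hxy, norm_add_sq_real] at h4
    have h5 := e1 (ξ + k)
    have h6 := e1 ξ
    simp only [← add_assoc] at h5 ⊢
    rw [inner_smul_left, conj_trivial]
    have : n * ‖k‖ ^ 2 ≤ D * ‖k‖ ^ 2 := by gcongr; linarith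
    linarith

/-- The test function used when the maximum lies on the diagonal. -/
lemma exists_critical_test {κ : Space N → Set (Space N) → ℝ} (hF : IsPenalty F q M C L)
    (hFd : ContDiff ℝ 2 F) {f : ℝ → ℝ} (hf : IsFlatProfile κ f) (hFf : ∀ z, F z = f ‖z‖)
    (hn : 0 < n) (hU : IsSupConvolution F n τ (fun z => w₁ z - h z.2) U)
    (hh : ∀ s ∈ Icc 0 τ, ∀ r ∈ Icc 0 τ, h s ≤ h r + h' r * (s - r) + C₁ * (s - r) ^ 2)
    (hC₁ : 0 ≤ C₁) (hτT : τ ≤ T) (ht : t' ∈ Ioo 0 τ)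
    (hx : U (x, t) = w₁ (x, t') - h t' - F (x - x) - n * (t - t') ^ 2) :
    ∃ φ, IsAdmissible κ T 0 τ φ (x, t') ∧ (∀ y, ∀ s ∈ Icc 0 τ, w₁ (y, s) ≤ φ (y, s)) ∧
      w₁ (x, t') = φ (x, t') ∧ spaceGrad φ (x, t') = 0 ∧
      timeDeriv φ (x, t') = h' t' - 2 * n * (t - t') := by
  -- Read the convolution at the fixed point `(x, t)` as an upper bound for `w₁`. After its linear
  -- time part is removed, the function equals `φ (x, t') + F (x - y) + (C₁ + n)(s - t')²`, which is
  -- exactly of the admissible form.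
  set φ : Space N × ℝ → ℝ := fun z => h t' + h' t' * (z.2 - t') + C₁ * (z.2 - t') ^ 2 +
    F (x - z.1) + n * (t - z.2) ^ 2 + U (x, t) with hφ
  have hφd : ContDiff ℝ 2 φ := by
    have h1 : ContDiff ℝ 2 fun z : Space N × ℝ => F (x - z.1) :=
      hFd.comp (contDiff_const.sub contDiff_fst)
    have h2 : ContDiff ℝ 2 fun z : Space N × ℝ => z.2 - t' := contDiff_snd.sub contDiff_const
    have h3 : ContDiff ℝ 2 fun z : Space N × ℝ => t - z.2 := contDiff_const.sub contDiff_snd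
    exact ((((contDiff_const.add (contDiff_const.mul h2)).add
      (contDiff_const.mul (h2.pow 2))).add h1).add (contDiff_const.mul (h3.pow 2))).add
      contDiff_const
  have hg : spaceGrad φ (x, t') = 0 := by
    have : IsLocalMin (fun y => φ (y, t')) x := Eventually.of_forall fun y => by
      simp only [hφ]
      rw [sub_self x, hF.zero]
      linarith [hF.nonneg (x - y)]
    simp [spaceGrad, gradient, this.fderiv_eq_zero]
  have htd : timeDeriv φ (x, t') = h' t' - 2 * n * (t - t') := by
    have h1 : HasDerivAt (fun s : ℝ => s - t') 1 t' := (hasDerivAt_id t').sub_const t'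
    have h2 : HasDerivAt (fun s : ℝ => t - s) (-1) t' := (hasDerivAt_id t').const_sub t
    have h3 := (((((h1.const_mul (h' t')).const_add (h t')).add
      ((h1.pow 2).const_mul C₁)).add_const (F (x - x))).add ((h2.pow 2).const_mul n)).add_const
      (U (x, t))
    refine h3.deriv.trans ?_
    simp
    ring
  refine ⟨φ, ⟨le_rfl, hτT, ht, hφd.continuous.continuousOn, hφd.contDiffAt, ?_, fun _ => ?_⟩,
    fun y s hs => ?_, ?_, hg, htd⟩
  · refine ⟨Metric.closedBall x 2, isCompact_closedBall _ _, fun s _ =>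
      ⟨h t' + h' t' * (s - t') + C₁ * (s - t') ^ 2 + M + n * (t - s) ^ 2 + U (x, t),
        fun y hy => ?_⟩⟩
    simp only [hφ]
    rw [hF.eq (x - y) (by
      rw [Metric.mem_closedBall, dist_comm, dist_eq_norm, not_le] at hy; exact hy.le)]
  · have hsq : ∀ r : ℝ, HasDerivAt (fun r : ℝ => (C₁ + n) * r ^ 2) ((C₁ + n) * (2 * r)) r :=
      fun r => by simpa using (hasDerivAt_pow 2 r).const_mul (C₁ + n)
    refine ⟨f, fun r => (C₁ + n) * r ^ 2, hf, ⟨?_, by simp, ?_, fun r hr => by positivity⟩,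
      fun y s _ => ?_⟩
    · exact (contDiff_const.mul (contDiff_id.pow 2)).contDiffOn
    · rw [(hsq 0).hasDerivWithinAt.derivWithin (uniqueDiffOn_Ici 0 0 self_mem_Ici)]
      simp
    · rw [htd, ← norm_sub_rev, ← hFf]
      have e : φ (y, s) - φ (x, t') - (h' t' - 2 * n * (t - t')) * (s - t') =
          F (x - y) + (C₁ + n) * |s - t'| ^ 2 := by
        simp only [hφ]
        rw [sub_self x, hF.zero, sq_abs]
        ring
      rw [e, abs_of_nonneg]
      have := hF.nonneg (x - y)
      positivity
  · have h1 := hU.le x t y s hs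
    have h2 := hh s hs t' (Ioo_subset_Icc_self ht)
    simp only [hφ]
    linarith
  · simp only [hφ]
    rw [hx]
    ring

end Contact

/-! ### Localisation in space and time and the final contradiction -/

section Comparison

variable {N ℓ : ℕ} {β : ℝ≥0}

lemma ConstOutsideCompact.exists_ball {w : Space N × ℝ → ℝ} {A : Set ℝ}
    (h : ConstOutsideCompact w A) : ∃ R, ConstOutsideBall R w A := by
  obtain ⟨K, hK, hc⟩ := h
  obtain ⟨R, hR⟩ := hK.isBounded.subset_closedBall 0
  have hout : ∀ x : Space N, R < ‖x‖ → x ∉ K := fun x hx hxK =>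
    not_lt.2 (by simpa using hR hxK) hx
  refine ⟨R, fun t ht x y hx hy => ?_⟩
  obtain ⟨c, hc⟩ := hc t ht
  rw [hc x (hout x hx), hc y (hout y hy)]

lemma ConstOutsideBall.mono {w : Space N × ℝ → ℝ} {A A' : Set ℝ} {R R' : ℝ}
    (h : ConstOutsideBall R w A) (hR : R ≤ R') (hA : A' ⊆ A) : ConstOutsideBall R' w A' :=
  fun t ht x y hx hy => h t (hA ht) x y (hR.trans_lt hx) (hR.trans_lt hy)

lemma exists_norm_eq (hN : 1 ≤ N) {r : ℝ} (hr : 0 ≤ r) : ∃ x : Space N, ‖x‖ = r :=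
  ⟨EuclideanSpace.single ⟨0, hN⟩ r, by simpa using hr⟩

lemma exists_upper_bound (hN : 1 ≤ N) {w : Space N × ℝ → ℝ} {R T : ℝ} (hR0 : 0 ≤ R)
    (hw : UpperSemicontinuousOn w (univ ×ˢ Icc 0 T)) (hR : ConstOutsideBall R w (Icc 0 T)) :
    ∃ B, ∀ x, ∀ t ∈ Icc 0 T, w (x, t) ≤ B := by
  obtain ⟨B, hB⟩ := (hw.mono (prod_mono (subset_univ _) le_rfl)).bddAbove_of_isCompact
    ((isCompact_closedBall (0 : Space N) (R + 1)).prod isCompact_Icc)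
  have hB' : ∀ x, ‖x‖ ≤ R + 1 → ∀ t ∈ Icc 0 T, w (x, t) ≤ B := fun x hx t ht =>
    hB ⟨(x, t), ⟨by simpa using hx, ht⟩, rfl⟩
  refine ⟨B, fun x t ht => ?_⟩
  rcases le_or_gt ‖x‖ (R + 1) with h | h
  · exact hB' x h t ht
  · obtain ⟨e, he⟩ := exists_norm_eq hN (by linarith : 0 ≤ R + 1)
    rw [hR t ht x e (by linarith) (by linarith)]
    exact hB' e he.le t ht

/-- Near the initial time and the diagonal `u` exceeds `v` only slightly. -/
lemma exists_initial_gap (hN : 1 ≤ N) {u v : Space N × ℝ → ℝ} {R T : ℝ} (hR0 : 0 ≤ R)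
    (hT : 0 < T) (hu : UpperSemicontinuousOn u (univ ×ˢ Icc 0 T))
    (hv : LowerSemicontinuousOn v (univ ×ˢ Icc 0 T)) (huR : ConstOutsideBall R u (Icc 0 T))
    (hvR : ConstOutsideBall R v (Icc 0 T)) (h0 : ∀ x, u (x, 0) ≤ v (x, 0)) {δ : ℝ} (hδ : 0 < δ) :
    ∃ ρ > 0, ∀ x y, ∀ t ∈ Icc 0 T, ∀ s ∈ Icc 0 T, ‖x - y‖ < ρ → t < ρ → s < ρ →
      u (x, t) - v (y, s) < δ := by
  have key : ∀ᶠ k : Space N × ℝ × ℝ in 𝓝 (0, 0, 0), ∀ x ∈ Metric.closedBall (0 : Space N) (R + 1),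
      k.2.1 ∈ Icc 0 T → k.2.2 ∈ Icc 0 T → u (x, k.2.1) - v (x - k.1, k.2.2) < δ := by
    refine (isCompact_closedBall _ _).eventually_forall_of_forall_eventually fun x₀ _ => ?_
    have h0T : (x₀, (0 : ℝ)) ∈ (univ : Set (Space N)) ×ˢ Icc 0 T := ⟨trivial, le_rfl, hT.le⟩
    have h1 := hu _ h0T (u (x₀, 0) + δ / 2) (by linarith)
    have h2 := hv _ h0T (v (x₀, 0) - δ / 2) (by linarith)
    rw [eventually_nhdsWithin_iff] at h1 h2
    have c1 : Tendsto (fun z : (Space N × ℝ × ℝ) × Space N => (z.2, z.1.2.1))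
        (𝓝 ((0, 0, 0), x₀)) (𝓝 (x₀, 0)) := Continuous.tendsto' (by fun_prop) _ _ rfl
    have c2 : Tendsto (fun z : (Space N × ℝ × ℝ) × Space N => (z.2 - z.1.1, z.1.2.2))
        (𝓝 ((0, 0, 0), x₀)) (𝓝 (x₀, 0)) := Continuous.tendsto' (by fun_prop) _ _ (by simp)
    filter_upwards [c1.eventually h1, c2.eventually h2] with z hz1 hz2 ht hs
    have h3 := hz1 ⟨trivial, ht⟩
    have h4 := hz2 ⟨trivial, hs⟩
    linarith [h0 x₀]
  obtain ⟨ρ, hρ, hball⟩ := Metric.eventually_nhds_iff.1 key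
  have hnear : ∀ x y, ‖x‖ ≤ R + 1 → ∀ t ∈ Icc 0 T, ∀ s ∈ Icc 0 T, ‖x - y‖ < ρ → t < ρ → s < ρ →
      u (x, t) - v (y, s) < δ := fun x y hx t ht s hs h1 h2 h3 => by
    have := hball (y := (x - y, t, s)) (by
      simp only [Prod.dist_eq, dist_zero_right, Real.norm_eq_abs, max_lt_iff]
      exact ⟨h1, by rwa [abs_of_nonneg ht.1], by rwa [abs_of_nonneg hs.1]⟩) x (by simpa using hx)
      ht hs
    simpa using this
  refine ⟨min ρ 1, by positivity, fun x y t ht s hs h1 h2 h3 => ?_⟩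
  rw [lt_min_iff] at h1 h2 h3
  rcases le_or_gt ‖x‖ (R + 1) with h | h
  · exact hnear x y h t ht s hs h1.1 h2.1 h3.1
  · obtain ⟨e, he⟩ := exists_norm_eq hN (by linarith : 0 ≤ R + 1)
    have hy : R < ‖y‖ := by linarith [norm_sub_norm_le x y, h1.2]
    rw [huR t ht x e (by linarith) (by linarith), hvR s hs y e hy (by linarith)]
    exact hnear e e he.le t ht s hs (by simpa using hρ) h2.1 h3.1

/-- When both points are outside the `R`-ball they may be merged into one fixed point without
lowering the value; otherwise positivity of the functional bounds `‖x - y‖` and thus both points.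
The search reduces to a compact set. -/
lemma exists_isDoublingMax (hN : 1 ≤ N) {U W : Space N × ℝ → ℝ} {n R B a b : ℝ} (hn : 1 ≤ n)
    (hR0 : 0 ≤ R) (hU : Continuous U) (hW : Continuous W) (hUR : ConstOutsideBall R U univ)
    (hWR : ConstOutsideBall R W univ) (hB : ∀ x y t, U (x, t) + W (y, t) ≤ B)
    (hfar : ∀ x y, ∀ t ∉ Icc a b, U (x, t) + W (y, t) ≤ 0) {x₁ : Space N} {t₁ : ℝ}
    (hpos : 0 < U (x₁, t₁) + W (x₁, t₁)) : ∃ x y t, IsDoublingMax n U W x y t := by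
  set Ψ : Space N × Space N × ℝ → ℝ := fun z =>
    U (z.1, z.2.2) + W (z.2.1, z.2.2) - n * ‖z.1 - z.2.1‖ ^ 2 with hΨ
  have hΨc : Continuous Ψ := by fun_prop
  set S : Set (Space N × Space N × ℝ) :=
    Metric.closedBall 0 (R + (B + 1)) ×ˢ Metric.closedBall 0 (R + (B + 1)) ×ˢ Icc a b with hS
  have hSc : IsCompact S :=
    (isCompact_closedBall _ _).prod ((isCompact_closedBall _ _).prod isCompact_Icc)
  have hB0 : 0 < B := hpos.trans_le (hB _ _ _)
  have red : ∀ x y t, 0 < Ψ (x, y, t) → ∃ z ∈ S, Ψ (x, y, t) ≤ Ψ z := by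
    intro x y t hxy
    have hlt : 0 < U (x, t) + W (y, t) := by
      have : 0 ≤ n * ‖x - y‖ ^ 2 := by positivity
      simp only [hΨ] at hxy
      linarith
    have ht : t ∈ Icc a b := by
      by_contra h
      exact absurd (hfar x y t h) (not_le.2 hlt)
    by_cases hout : R < ‖x‖ ∧ R < ‖y‖
    · obtain ⟨e, he⟩ := exists_norm_eq hN (by linarith : 0 ≤ R + (B + 1))
      refine ⟨(e, e, t), ⟨by simp [he], by simp [he], ht⟩, ?_⟩
      have : 0 ≤ n * ‖x - y‖ ^ 2 := by positivity
      simp only [hΨ, sub_self, norm_zero]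
      rw [hUR t trivial x e hout.1 (by linarith), hWR t trivial y e hout.2 (by linarith)]
      linarith
    · have hd : ‖x - y‖ < B + 1 := by
        by_contra! h
        have h1 : 1 * (B + 1) ^ 2 ≤ n * ‖x - y‖ ^ 2 := by gcongr
        have h2 := hB x y t
        simp only [hΨ] at hxy
        nlinarith
      have h1 := norm_sub_norm_le x y
      have h2 := norm_sub_norm_le y x
      rw [norm_sub_rev] at h2
      have h3 : ‖x‖ ≤ R + (B + 1) ∧ ‖y‖ ≤ R + (B + 1) := by
        rw [not_and_or, not_lt, not_lt] at hout
        rcases hout with h | h <;> constructor <;> linarith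
      exact ⟨(x, y, t), ⟨by simpa using h3.1, by simpa using h3.2, ht⟩, le_rfl⟩
  have hpos' : 0 < Ψ (x₁, x₁, t₁) := by simpa [hΨ] using hpos
  obtain ⟨z₁, hz₁, hle₁⟩ := red _ _ _ hpos'
  obtain ⟨z, hz, hmax⟩ := hSc.exists_isMaxOn ⟨z₁, hz₁⟩ hΨc.continuousOn
  refine ⟨z.1, z.2.1, z.2.2, fun x y t => ?_⟩
  change Ψ (x, y, t) ≤ Ψ z
  rcases le_or_gt (Ψ (x, y, t)) 0 with h | h
  · exact h.trans (hpos'.le.trans (hle₁.trans (hmax hz₁)))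
  · obtain ⟨z', hz', hle⟩ := red _ _ _ h
    exact hle.trans (hmax hz')

/-- The second order remainder of `1 / (T - s)` about `r` is exactly `(s - r)² / ((T - r)² (T -
s))`, and both factors of the denominator are controlled by `T - τ`. -/
lemma barrier_le {γ T τ s r : ℝ} (hγ : 0 ≤ γ) (hτ : τ < T) (hs : s ≤ τ) (hr : r ≤ τ) :
    γ / (T - s) ≤ γ / (T - r) + γ / (T - r) ^ 2 * (s - r) + γ / (T - τ) ^ 3 * (s - r) ^ 2 := by
  have h1 : 0 < T - τ := by linarith
  have h2 : 0 < T - s := by linarith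
  have h3 : 0 < T - r := by linarith
  have e : γ / (T - s) = γ / (T - r) + γ / (T - r) ^ 2 * (s - r) +
      γ / ((T - r) ^ 2 * (T - s)) * (s - r) ^ 2 := by
    field_simp
    ring
  rw [e]
  have h4 : (T - τ) ^ 3 ≤ (T - r) ^ 2 * (T - s) := by
    rw [pow_succ]
    gcongr
  gcongr

/-- The doubled function has no maximum whose associated maximum points of `U` and `W` are interior
in time and close in space. -/
lemma IsDoublingMax.false_of_interior {κ : Space N → Set (Space N) → ℝ} (hκ : IsCurvature ℓ β κ)
    (hFO : FirstOrderCondition ℓ β κ) {T : ℝ} {u v U W : Space N × ℝ → ℝ}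
    (hu : IsSubsolution ℓ β κ T u) (hv : IsSupersolution ℓ β κ T v) {F : Space N → ℝ}
    {q : Space N → Space N} {M C C₁ n τ R : ℝ} {L : ℝ≥0} {h h' f : ℝ → ℝ} {x y x' y' : Space N}
    {t t' s' : ℝ} (hm : IsDoublingMax n U W x y t) (hF : IsPenalty F q M C L)
    (hFd : ContDiff ℝ 2 F) (hf : IsFlatProfile κ f) (hFf : ∀ z, F z = f ‖z‖)
    (hn : 0 < n) (hU : IsSupConvolution F n τ (fun z => u z - h z.2) U)
    (hW : IsSupConvolution F n τ (fun z => -v z - h z.2) W) (hUR : ConstOutsideBall R U univ)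
    (hWR : ConstOutsideBall R W univ)
    (hh : ∀ s ∈ Icc 0 τ, ∀ r ∈ Icc 0 τ, h s ≤ h r + h' r * (s - r) + C₁ * (s - r) ^ 2)
    (hh' : ∀ s ∈ Icc 0 τ, 0 < h' s) (hC₁ : 0 ≤ C₁) (hτT : τ ≤ T) (ht : t' ∈ Ioo 0 τ)
    (hs : s' ∈ Ioo 0 τ) (hx' : U (x, t) = u (x', t') - h t' - F (x - x') - n * (t - t') ^ 2)
    (hy' : W (y, t) = -v (y', s') - h s' - F (y - y') - n * (t - s') ^ 2)
    (hqx : q (x - x') = 0 → x - x' = 0) (hqy : q (y - y') = 0 → y - y' = 0) : False := by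
  have hxy : x = y := hm.diag hκ hFO hu hv hF hn hU hW hUR hWR hh hh' hC₁ hτT ht hs hx' hy'
  subst hxy
  have ht' := Ioo_subset_Icc_self ht
  have hs' := Ioo_subset_Icc_self hs
  have ex := hm.eq_of_diag hF hU hW ht' hx' hqx
  have ey := hm.symm.eq_of_diag hF hW hU hs' hy' hqy
  subst ex
  subst ey
  have hts := hm.time_slope hU hW ht' hs' hx' hy'
  obtain ⟨φ, hφ, hφle, hφe, hφg, hφt⟩ := exists_critical_test hF hFd hf hFf hn hU hh hC₁ hτT ht hx'
  obtain ⟨χ, hχ, hχle, hχe, hχg, hχt⟩ := exists_critical_test hF hFd hf hFf hn hW hh hC₁ hτT hs hy'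
  have k1 := (hu.2.2 0 τ φ _ hφ (fun z hz => by
    have := hφle z.1 z.2 hz.2
    simp only [mem_ofPred_eq, Prod.mk.eta] at this ⊢
    linarith)).1 hφg
  have k2 := (hv.2.2 0 τ _ _ hχ.neg (fun z hz => by
    have := hχle z.1 z.2 hz.2
    simp only [mem_ofPred_eq, Prod.mk.eta] at this ⊢
    linarith)).1 (by rw [spaceGrad_neg, hχg, neg_zero])
  rw [timeDeriv_neg] at k2
  -- The slopes of the two test functions have opposite convolution parts by `hts`, so adding the
  -- inequalities leaves `h' t' + h' s' ≤ 0`.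
  linarith [hh' t' ht', hh' s' hs']

/-- A flat penalisation which localises at the scale `r` when it is bounded by `B`. -/
lemma exists_localizing_penalty (hN : 1 ≤ N) (hβ : β ≤ 1) {κ : Space N → Set (Space N) → ℝ}
    (hκ : IsCurvature ℓ β κ) {B r : ℝ} (hB : 0 ≤ B) (hr0 : 0 < r) (hr1 : r < 1) :
    ∃ (n : ℝ) (F : Space N → ℝ) (q : Space N → Space N) (M C : ℝ) (L : ℝ≥0) (f : ℝ → ℝ),
      B < n ∧ (∀ s : ℝ, n * s ^ 2 ≤ B → |s| < r) ∧ IsPenalty F q M C L ∧ ContDiff ℝ 2 F ∧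
      IsFlatProfile κ f ∧ (∀ x, F x = f ‖x‖) ∧ (∀ x, F x ≤ B → ‖x‖ < r) ∧
      ∀ x, ‖x‖ < r → q x = 0 → x = 0 := by
  obtain ⟨g, p, hg, hgp, hg0, hgm, hp, hg2, hflat⟩ := exists_flatProfile hN hβ hκ
  have hgr : 0 < g (r ^ 2) := by
    have hmono : StrictMonoOn g (Icc 0 1) := strictMonoOn_of_deriv_pos (convex_Icc 0 1)
      hg.continuous.continuousOn fun s hs => by
        rw [interior_Icc] at hs
        rw [(hgp s).deriv]
        exact hp s ⟨hs.1, by linarith [hs.2]⟩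
    have := hmono ⟨le_rfl, zero_le_one⟩ ⟨sq_nonneg r, by nlinarith⟩ (pow_pos hr0 2)
    rwa [hg0] at this
  obtain ⟨n, hn0, hnr, hng⟩ : ∃ n : ℝ, 0 < n ∧ B < n * r ^ 2 ∧ B < n * g (r ^ 2) := by
    have hm : 0 < min (r ^ 2) (g (r ^ 2)) := lt_min (by positivity) hgr
    refine ⟨(B + 1) / min (r ^ 2) (g (r ^ 2)), by positivity, ?_, ?_⟩
    · calc B < (B + 1) / min (r ^ 2) (g (r ^ 2)) * min (r ^ 2) (g (r ^ 2)) := by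
            rw [div_mul_cancel₀ _ hm.ne']; linarith
        _ ≤ _ := by gcongr; exact min_le_left _ _
    · calc B < (B + 1) / min (r ^ 2) (g (r ^ 2)) * min (r ^ 2) (g (r ^ 2)) := by
            rw [div_mul_cancel₀ _ hm.ne']; linarith
        _ ≤ _ := by gcongr; exact min_le_right _ _
  have hnB : B < n := hnr.trans_le (mul_le_of_le_one_right hn0.le (by nlinarith))
  obtain ⟨q, M, C, L, hF, hq⟩ := exists_isPenalty (N := N) hg hgp hg0 hgm hp hg2 hn0
  set F : Space N → ℝ := fun x => n * g (‖x‖ ^ 2) with hFdef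
  have hFd : ContDiff ℝ 2 F :=
    contDiff_const.mul ((hg.of_le (by norm_cast)).comp (contDiff_id.norm_sq ℝ))
  have hFr : ∀ x, F x ≤ B → ‖x‖ < r := fun x hx => by
    by_contra! h
    have : n * g (r ^ 2) ≤ n * g (‖x‖ ^ 2) := by
      have : g (r ^ 2) ≤ g (‖x‖ ^ 2) := hgm (by gcongr)
      gcongr
    simp only [hFdef] at hx
    linarith
  have hsqr : ∀ s : ℝ, n * s ^ 2 ≤ B → |s| < r := fun s hs => by
    refine abs_lt_of_sq_lt_sq ?_ hr0.le
    by_contra! h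
    have : n * r ^ 2 ≤ n * s ^ 2 := by gcongr
    linarith
  refine ⟨n, F, q, M, C, L, _, hnB, hsqr, hF, hFd, hflat n hn0, fun _ => rfl, hFr,
    fun x hx => hq x ?_⟩
  have := norm_nonneg x
  nlinarith

/-- A barrier which is small at two given times and large at a later time. -/
lemma exists_barrier {T t₁ t₂ B δ : ℝ} (ht₁ : t₁ < T) (ht₂ : t₂ < T) (hB : 0 ≤ B) (hδ : 0 < δ) :
    ∃ (τ : ℝ) (h h' : ℝ → ℝ) (C₁ : ℝ), τ < T ∧ t₁ ≤ τ ∧ t₂ ≤ τ ∧ h t₁ ≤ δ ∧ h t₂ ≤ δ ∧ B < h τ ∧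
      0 ≤ C₁ ∧ ContinuousOn h (Iic τ) ∧ (∀ s ≤ τ, 0 < h s) ∧ (∀ s ≤ τ, 0 < h' s) ∧
      ∀ s ≤ τ, ∀ r ≤ τ, h s ≤ h r + h' r * (s - r) + C₁ * (s - r) ^ 2 := by
  have h1 : 0 < T - t₁ := by linarith
  have h2 : 0 < T - t₂ := by linarith
  obtain ⟨γ, hγ, hγ₁, hγ₂⟩ : ∃ γ : ℝ, 0 < γ ∧ γ / (T - t₁) ≤ δ ∧ γ / (T - t₂) ≤ δ := by
    refine ⟨δ * min (T - t₁) (T - t₂), by positivity, ?_, ?_⟩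
    · rw [div_le_iff₀ h1]; gcongr; exact min_le_left _ _
    · rw [div_le_iff₀ h2]; gcongr; exact min_le_right _ _
  -- The distance from `τ` to `T`: small enough that `γ / m ≥ B + 1`, and that both given times
  -- precede `τ`.
  set m := min (γ / (B + 1)) (min (T - t₁) (T - t₂)) with hm
  have hm0 : 0 < m := by positivity
  have hm1 : m ≤ γ / (B + 1) := min_le_left _ _
  have hm2 : m ≤ T - t₁ := (min_le_right _ _).trans (min_le_left _ _)
  have hm3 : m ≤ T - t₂ := (min_le_right _ _).trans (min_le_right _ _)
  have hTs : ∀ s ≤ T - m, 0 < T - s := fun s hs => by linarith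
  refine ⟨T - m, fun s => γ / (T - s), fun s => γ / (T - s) ^ 2, γ / (T - (T - m)) ^ 3,
    by linarith, by linarith, by linarith, hγ₁, hγ₂, ?_, ?_, ?_, fun s hs => div_pos hγ (hTs s hs),
    fun s hs => div_pos hγ (pow_pos (hTs s hs) 2),
    fun s hs r hr => barrier_le hγ.le (by linarith) hs hr⟩
  · simp only [sub_sub_cancel]
    rw [lt_div_iff₀ hm0]
    rw [le_div_iff₀ (by linarith)] at hm1
    linarith
  · rw [sub_sub_cancel]; positivity
  · exact continuousOn_const.div (by fun_prop) fun s hs => (hTs s hs).ne'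

/-- If `u` exceeds `v` by a fixed amount at arbitrarily close points, a contradiction follows. -/
theorem false_of_gap (hN : 1 ≤ N) (hβ : β ≤ 1) {T : ℝ} (hT : 0 < T)
    {κ : Space N → Set (Space N) → ℝ} (hκ : IsCurvature ℓ β κ)
    (hFO : FirstOrderCondition ℓ β κ) {u v : Space N × ℝ → ℝ} (hu : IsSubsolution ℓ β κ T u)
    (hv : IsSupersolution ℓ β κ T v) (h0 : ∀ x, u (x, 0) ≤ v (x, 0)) {δ : ℝ} (hδ : 0 < δ)
    (hgap : ∀ ε > 0, ∃ y₁ t₁ y₂ t₂, t₁ ∈ Ico 0 T ∧ t₂ ∈ Ico 0 T ∧ ‖y₁ - y₂‖ < ε ∧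
      |t₁ - t₂| < ε ∧ δ ≤ u (y₁, t₁) - v (y₂, t₂)) : False := by
  have huc := hu.1
  have hvc := hv.1
  obtain ⟨R₁, hR₁⟩ := hu.2.1.exists_ball
  obtain ⟨R₂, hR₂⟩ := hv.2.1.exists_ball
  obtain ⟨R, hR0, huR, hvR⟩ : ∃ R, 0 ≤ R ∧ ConstOutsideBall R u (Icc 0 T) ∧
      ConstOutsideBall R v (Icc 0 T) :=
    ⟨max 0 (max R₁ R₂), le_max_left _ _, hR₁.mono (by simp) le_rfl, hR₂.mono (by simp) le_rfl⟩
  have hnvc : UpperSemicontinuousOn (fun z => -v z) (univ ×ˢ Icc 0 T) := hvc.neg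
  have hnvR : ConstOutsideBall R (fun z => -v z) (Icc 0 T) := fun t ht x y hx hy =>
    congrArg Neg.neg (hvR t ht x y hx hy)
  obtain ⟨B₁, hB₁⟩ := exists_upper_bound hN hR0 huc huR
  obtain ⟨B₂, hB₂⟩ := exists_upper_bound hN hR0 hnvc hnvR
  obtain ⟨B, hB12, hB1⟩ : ∃ B, B₁ + B₂ ≤ B ∧ 1 ≤ B := ⟨max _ _, le_max_left _ _, le_max_right _ _⟩
  obtain ⟨ρ₀, hρ₀, hsmall₀⟩ := exists_initial_gap hN hR0 hT huc hvc huR hvR h0 (half_pos hδ)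
  obtain ⟨r, hr0, hr1, hrρ⟩ : ∃ r : ℝ, 0 < r ∧ r < 1 ∧ 3 * r ≤ ρ₀ :=
    ⟨min ρ₀ 1 / 3, by positivity, by linarith [min_le_right ρ₀ 1], by linarith [min_le_left ρ₀ 1]⟩
  obtain ⟨n, F, q, M, C, L, f, hnB, hsqr, hF, hFd, hf, hFf, hFr, hcrit⟩ :=
    exists_localizing_penalty hN hβ hκ (by linarith : 0 ≤ B) hr0 hr1
  have hn0 : 0 < n := by linarith
  -- two close points where the gap occurs
  obtain ⟨y₁, t₁, y₂, t₂, ht₁, ht₂, hclose, hgap⟩ : ∃ y₁ t₁ y₂ t₂, t₁ ∈ Ico 0 T ∧ t₂ ∈ Ico 0 T ∧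
      F (y₁ - y₂) + n * (t₁ - t₂) ^ 2 < δ / 4 ∧ δ ≤ u (y₁, t₁) - v (y₂, t₂) := by
    have hc : Continuous fun z : Space N × ℝ => F z.1 + n * z.2 ^ 2 := by
      have := hFd.continuous
      fun_prop
    have h1 : ∀ᶠ z : Space N × ℝ in 𝓝 0, F z.1 + n * z.2 ^ 2 < δ / 4 := by
      refine hc.continuousAt.eventually_lt continuousAt_const ?_
      simp only [Prod.fst_zero, Prod.snd_zero, hF.zero]
      linarith
    obtain ⟨ε, hε, hball⟩ := Metric.eventually_nhds_iff.1 h1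
    obtain ⟨y₁, t₁, y₂, t₂, h1, h2, h3, h4, h5⟩ := hgap ε hε
    exact ⟨y₁, t₁, y₂, t₂, h1, h2, hball (y := (y₁ - y₂, t₁ - t₂)) (by
      rw [dist_zero_right, Prod.norm_def]; exact max_lt h3 h4), h5⟩
  obtain ⟨τ, h, h', C₁, hτT, hτ₁, hτ₂, hh₁, hh₂, hτB, hC₁0, hhc, hpos, hpos', hbar⟩ :=
    exists_barrier ht₁.2 ht₂.2 (by linarith : 0 ≤ B) (by linarith : 0 < δ / 8)
  have hτ0 : 0 ≤ τ := ht₁.1.trans hτ₁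
  have hsub : Icc 0 τ ⊆ Icc 0 T := Icc_subset_Icc_right hτT.le
  have hhc : UpperSemicontinuousOn (fun z : Space N × ℝ => -h z.2) (univ ×ˢ Icc 0 τ) :=
    ((hhc.comp continuousOn_snd fun z hz => hz.2.2).neg).upperSemicontinuousOn
  have hconv : ∀ w : Space N × ℝ → ℝ, UpperSemicontinuousOn w (univ ×ˢ Icc 0 T) →
      ConstOutsideBall R w (Icc 0 T) → ∃ U, IsSupConvolution F n τ (fun z => w z - h z.2) U ∧
        ConstOutsideBall (R + 2) U univ := fun w hw hwR => by
    have h1 : ConstOutsideBall R (fun z => w z - h z.2) (Icc 0 τ) := fun t ht x y hx hy => by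
      simp only [hwR t (hsub ht) x y hx hy]
    obtain ⟨U, hU⟩ := exists_isSupConvolution (n := n) hN hF hτ0 (by
      simpa only [sub_eq_add_neg] using (hw.mono (prod_mono le_rfl hsub)).add hhc) h1
    exact ⟨U, hU, hU.constOutside hF h1⟩
  obtain ⟨U, hU, hUR⟩ := hconv u huc huR
  obtain ⟨W, hW, hWR⟩ := hconv _ hnvc hnvR
  have hbU : ∀ x, ∀ t ∈ Icc 0 τ, u (x, t) - h t ≤ B₁ := fun x t ht => by
    linarith [hB₁ x t (hsub ht), hpos t ht.2]
  have hbW : ∀ x, ∀ t ∈ Icc 0 τ, -v (x, t) - h t ≤ B₂ := fun x t ht => by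
    linarith [hB₂ x t (hsub ht), hpos t ht.2]
  -- Both convolutions are evaluated at `(y₁, t₁)`, using `(y₂, t₂)` as competitor for `W`. From the
  -- gap `δ` one loses at most `δ/8` for each barrier value and `δ/4` for the penalties.
  have hstart : δ / 2 ≤ U (y₁, t₁) + W (y₁, t₁) := by
    have h1 := hU.le y₁ t₁ y₁ t₁ ⟨ht₁.1, hτ₁⟩
    have h2 := hW.le y₁ t₁ y₂ t₂ ⟨ht₂.1, hτ₂⟩
    rw [sub_self, sub_self, hF.zero] at h1
    linarith
  obtain ⟨x, y, t, hm⟩ := exists_isDoublingMax hN (n := n) (hB1.trans hnB.le)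
    (by linarith : 0 ≤ R + 2) (hU.continuous hF hn0.le) (hW.continuous hF hn0.le) hUR hWR
    (B := B₁ + B₂) (a := -1) (b := τ + 1)
    (fun x y t => add_le_add (hU.le_of_le hF hn0.le hbU x t) (hW.le_of_le hF hn0.le hbW y t))
    (fun x y t ht => by
      linarith [hU.le_of_far hF hn0.le hbU x ht, hW.le_of_far hF hn0.le hbW y ht])
    (by linarith : 0 < U (y₁, t₁) + W (y₁, t₁))
  obtain ⟨x', t', ht', hx'⟩ := hU.attained x t
  obtain ⟨y', s', hs', hy'⟩ := hW.attained y t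
  simp only at hx' hy'
  have hval : δ / 2 ≤ u (x', t') - v (y', s') - h t' - h s' - F (x - x') - F (y - y') -
      n * (t - t') ^ 2 - n * (t - s') ^ 2 - n * ‖x - y‖ ^ 2 := by
    have := hm y₁ y₁ t₁
    rw [sub_self, norm_zero] at this
    linarith
  have hle : u (x', t') - v (y', s') ≤ B := by
    linarith [hB₁ x' t' (hsub ht'), hB₂ y' s' (hsub hs')]
  have p1 := hpos t' ht'.2
  have p2 := hpos s' hs'.2
  have p3 := hF.nonneg (x - x')
  have p4 := hF.nonneg (y - y')
  have p5 : 0 ≤ n * (t - t') ^ 2 := by positivity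
  have p6 : 0 ≤ n * (t - s') ^ 2 := by positivity
  have p7 : 0 ≤ n * ‖x - y‖ ^ 2 := by positivity
  have b1 : ‖x - x'‖ < r := hFr _ (by linarith)
  have b2 : ‖y - y'‖ < r := hFr _ (by linarith)
  have b3 : |t - t'| < r := hsqr _ (by linarith)
  have b4 : |t - s'| < r := hsqr _ (by linarith)
  have b5 : ‖x - y‖ < r := (le_abs_self _).trans_lt (hsqr _ (by linarith))
  have b6 : ‖x' - y'‖ < ρ₀ := by
    have e : x' - y' = (x' - x) + (x - y) + (y - y') := by abel
    have := norm_add₃_le (a := x' - x) (b := x - y) (c := y - y')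
    rw [← e, norm_sub_rev x' x] at this
    linarith
  rw [abs_lt] at b3 b4
  -- The contact points are within `3r ≤ ρ₀` in space, so if both times were small the initial
  -- ordering would make the difference less than `δ/2`.
  have hnot : ¬ (t' < ρ₀ ∧ s' < ρ₀) := fun hc => by
    linarith [hsmall₀ x' y' t' (hsub ht') s' (hsub hs') b6 hc.1 hc.2]
  -- If one contact time is zero, the other is below `2r < ρ₀`, which was just excluded. At time `τ`
  -- the barrier exceeds the bound `B`, which the value at least `δ/2` does not permit.
  have it : t' ∈ Ioo 0 τ := by
    refine ⟨ht'.1.lt_of_ne fun he => hnot ⟨by linarith, by linarith⟩, ht'.2.lt_of_ne fun he => ?_⟩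
    have : B < h t' := by rw [he]; exact hτB
    linarith
  have is : s' ∈ Ioo 0 τ := by
    refine ⟨hs'.1.lt_of_ne fun he => hnot ⟨by linarith, by linarith⟩, hs'.2.lt_of_ne fun he => ?_⟩
    have : B < h s' := by rw [he]; exact hτB
    linarith
  exact hm.false_of_interior hκ hFO hu hv hF hFd hf hFf hn0 hU hW hUR hWR
    (fun s hs r hr => hbar s hs.2 r hr.2) (fun s hs => hpos' s hs.2) hC₁0 hτT.le it is hx' hy'
    (hcrit _ b1) (hcrit _ b2)

end Comparison

end NonlocalCurvature

/-! ### The comparison principle -/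

theorem mainTheorem3 (N ℓ : ℕ) (hN : 1 ≤ N) (hℓ : 2 ≤ ℓ) (β : ℝ≥0) (hβ : β ≤ 1)
    (T : ℝ) (hT : 0 < T)
    (κ : NonlocalCurvature.Space N → Set (NonlocalCurvature.Space N) → ℝ)
    (hκ : NonlocalCurvature.IsCurvature ℓ β κ)
    (hFO : NonlocalCurvature.FirstOrderCondition ℓ β κ)
    (u v : NonlocalCurvature.Space N × ℝ → ℝ)
    (hu : NonlocalCurvature.IsSubsolution ℓ β κ T u)
    (hv : NonlocalCurvature.IsSupersolution ℓ β κ T v)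
    (h0 : ∀ x, u (x, 0) ≤ v (x, 0)) :
    (∀ x, ∀ t ∈ Set.Ico 0 T, u (x, t) ≤ v (x, t)) ∧
    (NonlocalCurvature.TerminalFromBelow T u → NonlocalCurvature.TerminalFromAbove T v →
      ∀ x, u (x, T) ≤ v (x, T)) := by
  refine ⟨fun x t ht => ?_, fun hTu hTv x => ?_⟩
  · by_contra! h
    refine NonlocalCurvature.false_of_gap hN hβ hT hκ hFO hu hv h0 (sub_pos.2 h) fun ε hε =>
      ⟨x, t, x, t, ht, ht, by simpa using hε, by simpa using hε, le_rfl⟩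
  · by_contra! h
    have hδ : 0 < (u (x, T) - v (x, T)) / 2 := by linarith
    -- The one-sided limits of `u` and `v` at the final time may be reached along different
    -- sequences, which is why the gap is allowed at two distinct nearby points. Half of the gap is
    -- given up, a quarter for each approximation.
    refine NonlocalCurvature.false_of_gap hN hβ hT hκ hFO hu hv h0 hδ fun ε hε => ?_
    have hnear : ∀ᶠ w in 𝓝[{w : NonlocalCurvature.Space N × ℝ | w.2 < T}] (x, T),
        w.2 ∈ Ico 0 T ∧ dist w.1 x < ε / 2 ∧ dist w.2 T < ε / 2 := by
      have h1 : ∀ᶠ w : NonlocalCurvature.Space N × ℝ in 𝓝 (x, T), 0 < w.2 :=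
        continuousAt_const.eventually_lt continuous_snd.continuousAt hT
      have h2 : ∀ᶠ w : NonlocalCurvature.Space N × ℝ in 𝓝 (x, T), dist w (x, T) < ε / 2 :=
        Metric.ball_mem_nhds _ (half_pos hε)
      filter_upwards [self_mem_nhdsWithin, nhdsWithin_le_nhds h1, nhdsWithin_le_nhds h2]
        with w hw1 hw2 hw3
      rw [Prod.dist_eq, max_lt_iff] at hw3
      exact ⟨⟨hw2.le, hw1⟩, hw3⟩
    obtain ⟨w₁, h1, h2, h3, h4⟩ := ((hTu x _ (half_pos hδ)).and_eventually hnear).exists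
    obtain ⟨w₂, h5, h6, h7, h8⟩ := ((hTv x _ (half_pos hδ)).and_eventually hnear).exists
    refine ⟨w₁.1, w₁.2, w₂.1, w₂.2, h2, h6, ?_, ?_, ?_⟩
    · rw [← dist_eq_norm]
      linarith [dist_triangle_right w₁.1 w₂.1 x]
    · rw [← Real.dist_eq]
      linarith [dist_triangle_right w₁.2 w₂.2 T]
    · simp only [Prod.mk.eta]
      linarith
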